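/- **Conventions.** An (a,b)-module is a free $\mathbb C[[b]]$-module of finite rank with a $\mathbb C$-linear endomorphism $a$ such that $ab-ba=b^2$. For $\lambda\in\mathbb Q$, $E_\lambda=\mathbb C[[b]]e$ with $ae=\lambda be$. For a finite set $\Lambda\subset\,]0,1]\cap\mathbb Q$ and $N\in\mathbb N$, $\Xi_\Lambda^{(N)}=\bigoplus_{\lambda\in\Lambda,\,0\le j\le N}\mathbb C[[b]]\,e_{\lambda,j}$ with $ae_{\lambda,0}=\lambda b e_{\lambda,0}$ and $ae_{\lambda,j}=\lambda be_{\lambda,j}+be_{\lambda,j-1}$ for $j\ge1$. A $[\lambda]$-primitive theme is an (a,b)-module isomorphic to a sub-(a,b)-module of some $\Xi_{\{\lambda\}}^{(N)}$ generated by one element. It has rank $k$ and fundamental invariants $\lambda_1,p_1,\dots,p_{k-1}$ if it has a filtration $0=F_0\subset F_1\subset\dots\subset F_k$ (with $F_k$ the whole module) by sub-(a,b)-modules with $F_j/F_{j-1}\simeq E_{\lambda_j}$ for $1\le j\le k$, where $\lambda_{j+1}=\lambda_j+p_j-1$. Let $X$ be a reduced complex space. A sheaf of $\mathcal O_X$-(a,b)-modules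 is a locally free sheaf of finite type of $\mathcal O_X[[b]]$-modules with an $\mathcal O_X$-linear $b$-adically continuous operator $a$ such that $ab-ba=b^2$; its fibres $E(x)$ are (a,b)-modules. It is a holomorphic family of themes of rank $k$ if locally on $X$ it is isomorphic to the $\mathcal O_X[[b]]$-submodule $\mathbb E_\varphi$ of $\Xi^{(k-1)}_{X,\Lambda}$ generated by the $a^\nu\varphi$, $\nu\ge 0$, for a finite $\Lambda\subset\,]0,1]\cap\mathbb Q$ and a holomorphic $\varphi$ with values in $\Xi^{(k-1)}_\Lambda$ such that $\mathbb E_\varphi$ has $\varphi,a\varphi,\dots,a^{k-1}\varphi$ as a basis over $\mathcal O_X[[b]]$, and that $\varphi(x),\dots,a^{k-1}\varphi(x)$ are $\mathbb C[[b]]$-linearly independent for each $x$. It has fundamental invariants $\lambda_1,p_1,\dots,p_{k-1}$ if each fibre is a $[\lambda]$-primitive theme with these invariants. Such a family $\mathbb E$ on $X$, with invariants $\lambda_1,p_1,\dots,p_{k-1}$, is *versal near* $x_0\in X$ if for each holomorphic family $\mathbb H$ with the same invariants on a reduced complex space $Y$ and each $y_0\in Y$ with $H(y_0)\simeq E(x_0)$,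 there are an open neighbourhood $U$ of $y_0$ and a holomorphic map $f:U\to X$ such that $f^*\mathbb E\simeq\mathbb H|_U$ as sheaves of $\mathcal O_U$-(a,b)-modules; it is *universal near* $x_0$ if moreover the germ at $y_0$ of such an $f$ is always unique. It is *locally versal* if it is versal near each point, and (globally) *universal* if it is universal near each point and each isomorphism class of $[\lambda]$-primitive themes with invariants $\lambda_1,p_1,\dots,p_{k-1}$ appears exactly once among the $E(x)$, $x\in X$. Let now $k\ge1$ be an integer, $\lambda_1>k-1$ a rational number, $p_1,\dots,p_{k-1}$ natural integers, and $\lambda_{j+1}=\lambda_j+p_j-1$. For $1\le j\le k-1$ let $V_j\subset\mathbb C[[b]]$ be spanned by $1,b,\dots,b^{k-j-1}$ and moreover, when $p_j+\dots+p_{k-1}\ge k-j$, by $b^{q_j}$, where $q_j=p_j+\dots+p_{j+h}$ with $h\ge 0$ minimal such that $q_j\ge k-j$. Let $W_j$ be the set of $S\in V_j$ with constant term $1$ and with a non-zero coefficient of $b^{p_j}$, and let $\mathcal S(\lambda_1,p_1,\dots,p_{k-1})=W_1\times\dots\times W_{k-1}$, a complex manifold with coordinates the coefficients of the $S_j$.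 The canonical family on it has as fibre at $\sigma=(S_1,\dots,S_{k-1})$ the (a,b)-module $E(\sigma)=\tilde{\mathcal A}/\tilde{\mathcal A}P(\sigma)$ with $P(\sigma)=(a-\lambda_1b)S_1^{-1}(a-\lambda_2b)\cdots S_{k-1}^{-1}(a-\lambda_kb)$, where $\tilde{\mathcal A}$ is the $b$-completion of $\mathbb C\langle a,b\rangle/(ab-ba-b^2)$; that is, $E(\sigma)$ has the $\mathbb C[[b]]$-basis $e_1,\dots,e_k$ with $(a-\lambda_1b)e_1=0$ and $(a-\lambda_{j+1}b)e_{j+1}=S_je_j$ for $1\le j\le k-1$, and its sheaf is free over $\mathcal O[[b]]$ with basis $e_1,\dots,e_k$. **Theorem.** The canonical family is a holomorphic family of $[\lambda]$-primitive themes with fundamental invariants $\lambda_1,p_1,\dots,p_{k-1}$, and it is locally versal. If each $[\lambda]$-primitive theme with these fundamental invariants has a unique canonical form, that is, is isomorphic to $E(\sigma)$ for exactly one $\sigma\in\mathcal S(\lambda_1,p_1,\dots,p_{k-1})$, then the canonical family is (globally) universal. This hypothesis, and hence the conclusion, holds for instance when $p_j\ge k-1$ for all $j\in[1,k-1]$.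 -/

import Mathlib

open Filter Topology TopologicalSpace PowerSeries

universe u v w z

namespace Themes

noncomputable section

/-! ### Reduced complex spaces -/

/-- A (locally closed) analytic subset of `ℂ^ι`: near each of its points it is the set of common
zeros of finitely many holomorphic functions.  (Equivalently: a closed analytic subset of some
open subset of `ℂ^ι`.) -/
def IsLocallyAnalyticSet {ι : Type} [Fintype ι] (A : Set (ι → ℂ)) : Prop :=
  ∀ x ∈ A, ∃ (m : ℕ) (g : Fin m → (ι → ℂ) → ℂ), (∀ i, AnalyticAt ℂ (g i) x) ∧
    ∀ᶠ y in 𝓝 x, (y ∈ A ↔ ∀ i, g i y = 0)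

/-- A reduced complex space, in Serre's form: a Hausdorff space with a sheaf of complex valued
functions (given by its germs: `holAt f x` says that `f` is holomorphic near `x`) which is locally
isomorphic to an analytic subset `A` of an open set of some `ℂ^ι`, endowed with the functions that
are locally restrictions of holomorphic functions of the ambient space. -/
class ReducedComplexSpace (X : Type u) [TopologicalSpace X] where
  t2 : T2Space X
  holAt : (X → ℂ) → X → Prop
  chart : ∀ x : X, ∃ (ι : Type) (_ : Fintype ι) (V : Set X) (Φ : X → ι → ℂ),
    IsOpen V ∧ x ∈ V ∧ IsEmbedding (V.domRestrict Φ) ∧ IsLocallyAnalyticSet (Φ '' V) ∧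
    ∀ y ∈ V, ∀ f : X → ℂ,
      holAt f y ↔ ∃ g : (ι → ℂ) → ℂ, AnalyticAt ℂ g (Φ y) ∧ f =ᶠ[𝓝 y] g ∘ Φ

section ComplexSpaces

variable {X : Type u} [TopologicalSpace X] [ReducedComplexSpace X]
variable {Y : Type w} [TopologicalSpace Y] [ReducedComplexSpace Y]

/-- `f` is holomorphic in a neighbourhood of `x`. -/
def HolAt (f : X → ℂ) (x : X) : Prop := ReducedComplexSpace.holAt f x

/-- Holomorphic maps between reduced complex spaces. -/
structure HolMap (f : X → Y) : Prop where
  continuous : Continuous f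
  comp : ∀ (x : X) (g : Y → ℂ), HolAt g (f x) → HolAt (g ∘ f) x

/-- The germ of `c` at `x` is a germ of section of `𝒪_X[[b]]`: all coefficients of `c` are
holomorphic on one common neighbourhood of `x`. -/
def HolSeriesAt (c : X → ℂ⟦X⟧) (x : X) : Prop :=
  ∀ᶠ y in 𝓝 x, ∀ m : ℕ, HolAt (fun t => coeff m (c t)) y

theorem HolAt.congr {f g : X → ℂ} {x : X} (hf : HolAt f x) (h : f =ᶠ[𝓝 x] g) : HolAt g x := by
  obtain ⟨ι, _, V, Φ, -, hx, -, -, hV⟩ := ReducedComplexSpace.chart x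
  obtain ⟨G, hG, hfG⟩ := (hV x hx f).1 hf
  exact (hV x hx g).2 ⟨G, hG, h.symm.trans hfG⟩

theorem HolAt.const (c : ℂ) (x : X) : HolAt (fun _ => c) x := by
  obtain ⟨ι, _, V, Φ, -, hx, -, -, hV⟩ := ReducedComplexSpace.chart x
  exact (hV x hx _).2 ⟨fun _ => c, analyticAt_const, EventuallyEq.rfl⟩

theorem HolAt.add {f g : X → ℂ} {x : X} (hf : HolAt f x) (hg : HolAt g x) :
    HolAt (fun t => f t + g t) x := by
  obtain ⟨ι, _, V, Φ, -, hx, -, -, hV⟩ := ReducedComplexSpace.chart x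
  obtain ⟨F, hF, hF'⟩ := (hV x hx f).1 hf
  obtain ⟨G, hG, hG'⟩ := (hV x hx g).1 hg
  exact (hV x hx _).2 ⟨fun t => F t + G t, hF.add hG, hF'.add hG'⟩

theorem HolAt.mul {f g : X → ℂ} {x : X} (hf : HolAt f x) (hg : HolAt g x) :
    HolAt (fun t => f t * g t) x := by
  obtain ⟨ι, _, V, Φ, -, hx, -, -, hV⟩ := ReducedComplexSpace.chart x
  obtain ⟨F, hF, hF'⟩ := (hV x hx f).1 hf
  obtain ⟨G, hG, hG'⟩ := (hV x hx g).1 hg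
  exact (hV x hx _).2 ⟨fun t => F t * G t, hF.mul hG, hF'.mul hG'⟩

theorem HolAt.sum {α : Type*} (s : Finset α) {f : α → X → ℂ} {x : X}
    (hf : ∀ i ∈ s, HolAt (f i) x) : HolAt (fun t => ∑ i ∈ s, f i t) x := by
  classical
  induction s using Finset.induction_on with
  | empty => simpa using HolAt.const 0 x
  | insert a s ha ih =>
    simp only [Finset.sum_insert ha]
    exact (hf a (by simp)).add (ih fun i hi => hf i (by simp [hi]))

theorem HolSeriesAt.eventually {c : X → ℂ⟦X⟧} {x : X} (h : HolSeriesAt c x) :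
    ∀ᶠ y in 𝓝 x, HolSeriesAt c y :=
  eventually_eventually_nhds.2 h

theorem HolSeriesAt.congr {c d : X → ℂ⟦X⟧} {x : X} (hc : HolSeriesAt c x) (h : c =ᶠ[𝓝 x] d) :
    HolSeriesAt d x := by
  filter_upwards [hc, eventually_eventually_nhds.2 h] with y hy hcd m
  exact (hy m).congr (hcd.mono fun t ht => by simp only [ht])

theorem HolSeriesAt.const (s : ℂ⟦X⟧) (x : X) : HolSeriesAt (fun _ => s) x :=
  Eventually.of_forall fun y m => HolAt.const (coeff m s) y

theorem HolSeriesAt.add {c d : X → ℂ⟦X⟧} {x : X} (hc : HolSeriesAt c x) (hd : HolSeriesAt d x) :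
    HolSeriesAt (fun t => c t + d t) x := by
  filter_upwards [hc, hd] with y h1 h2 m
  simpa only [map_add] using (h1 m).add (h2 m)

theorem HolSeriesAt.mul {c d : X → ℂ⟦X⟧} {x : X} (hc : HolSeriesAt c x) (hd : HolSeriesAt d x) :
    HolSeriesAt (fun t => c t * d t) x := by
  filter_upwards [hc, hd] with y h1 h2 m
  simp only [coeff_mul]
  exact HolAt.sum _ fun i _ => (h1 i.1).mul (h2 i.2)

theorem HolSeriesAt.sum {α : Type*} (s : Finset α) {f : α → X → ℂ⟦X⟧} {x : X}
    (hf : ∀ i ∈ s, HolSeriesAt (f i) x) : HolSeriesAt (fun t => ∑ i ∈ s, f i t) x := by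
  classical
  induction s using Finset.induction_on with
  | empty => simpa using HolSeriesAt.const 0 x
  | insert a s ha ih =>
    simp only [Finset.sum_insert ha]
    exact (hf a (by simp)).add (ih fun i hi => hf i (by simp [hi]))

theorem HolSeriesAt.derivative {c : X → ℂ⟦X⟧} {x : X} (hc : HolSeriesAt c x) :
    HolSeriesAt (fun t => PowerSeries.derivative ℂ (c t)) x := by
  filter_upwards [hc] with y h1 m
  simp only [coeff_derivative]
  exact (h1 (m + 1)).mul (HolAt.const _ y)

theorem HolSeriesAt.comp {f : X → Y} (hf : HolMap f) {c : Y → ℂ⟦X⟧} {x : X}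
    (hc : HolSeriesAt c (f x)) : HolSeriesAt (fun t => c (f t)) x :=
  (hf.continuous.continuousAt.eventually hc).mono fun y hy m => hf.comp y _ (hy m)

end ComplexSpaces

section OpenSubspaces

variable {X : Type u} [TopologicalSpace X] [ReducedComplexSpace X]

/-- An open subset of a reduced complex space is a reduced complex space. -/
instance openSubspace (U : Opens X) : ReducedComplexSpace U where
  t2 := by
    have := ReducedComplexSpace.t2 (X := X)
    infer_instance
  holAt f x := ∃ g : X → ℂ, HolAt g x.1 ∧ f =ᶠ[𝓝 x] g ∘ Subtype.val
  chart := by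
    intro x
    obtain ⟨ι, hι, V, Φ, hVo, hx, hemb, han, hV⟩ := ReducedComplexSpace.chart x.1
    refine ⟨ι, hι, Subtype.val ⁻¹' V, Φ ∘ Subtype.val, hVo.preimage continuous_subtype_val, hx,
      ?_, ?_, ?_⟩
    · have h1 : IsEmbedding (fun y : (Subtype.val ⁻¹' V : Set U) => (⟨y.1.1, y.2⟩ : V)) := by
        refine IsEmbedding.of_comp (g := Subtype.val) (by fun_prop) continuous_subtype_val ?_
        exact IsEmbedding.comp (g := (Subtype.val : U → X)) IsEmbedding.subtypeVal
          (IsEmbedding.subtypeVal (p := fun y : U => y ∈ (Subtype.val ⁻¹' V : Set U)))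
      exact hemb.comp h1
    · rintro _ ⟨y, hy, rfl⟩
      obtain ⟨m, g, hg, hA⟩ := han (Φ y.1) ⟨y.1, hy, rfl⟩
      refine ⟨m, g, hg, ?_⟩
      have hO : IsOpen (Subtype.val ⁻¹' (U : Set X) : Set V) :=
        U.isOpen.preimage continuous_subtype_val
      obtain ⟨O, hO1, hO2⟩ := hemb.isInducing.isOpen_iff.1 hO
      have hyO : Φ y.1 ∈ O := by
        have : (⟨y.1, hy⟩ : V) ∈ V.domRestrict Φ ⁻¹' O := by rw [hO2]; exact y.2
        exact this
      filter_upwards [hA, hO1.mem_nhds hyO] with t ht htO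
      rw [← ht]
      constructor
      · rintro ⟨t', ht', rfl⟩
        exact ⟨t'.1, ht', rfl⟩
      · rintro ⟨t', ht', rfl⟩
        have : (⟨t', ht'⟩ : V) ∈ V.domRestrict Φ ⁻¹' O := htO
        rw [hO2] at this
        exact ⟨⟨t', this⟩, ht', rfl⟩
    · intro y hy f
      constructor
      · rintro ⟨g, hg, hfg⟩
        obtain ⟨G, hG, hgG⟩ := (hV y.1 hy g).1 hg
        exact ⟨G, hG, hfg.trans (hgG.comp_tendsto continuous_subtype_val.continuousAt)⟩
      · rintro ⟨G, hG, hfG⟩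
        exact ⟨G ∘ Φ, (hV y.1 hy _).2 ⟨G, hG, EventuallyEq.rfl⟩, hfG⟩

theorem holMap_val (U : Opens X) : HolMap (Subtype.val : U → X) where
  continuous := continuous_subtype_val
  comp _ g hg := ⟨g, hg, EventuallyEq.rfl⟩

end OpenSubspaces

/-! ### (a,b)-modules -/

/-- An (a,b)-module: a free module of finite rank over `ℂ[[b]]` (`b` is `PowerSeries.X`) with a
`ℂ`-linear endomorphism `a` such that `a b - b a = b ^ 2`. -/
structure ABMod where
  carrier : Type v
  [addCommGroup : AddCommGroup carrier]
  [module : Module ℂ⟦X⟧ carrier]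
  [free : Module.Free ℂ⟦X⟧ carrier]
  [finite : Module.Finite ℂ⟦X⟧ carrier]
  a : carrier →+ carrier
  a_const : ∀ (c : ℂ) (m : carrier), a (C c • m) = C c • a m
  a_b : ∀ m : carrier, a ((X : ℂ⟦X⟧) • m) - (X : ℂ⟦X⟧) • a m = (X : ℂ⟦X⟧) ^ 2 • m

instance : CoeSort ABMod.{v} (Type v) := ⟨ABMod.carrier⟩

attribute [instance] ABMod.addCommGroup ABMod.module ABMod.free ABMod.finite

/-- The operator `a` is `b`-adically continuous, that is, `a S - S a = b ^ 2 S'` for all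
`S` in `ℂ[[b]]`. -/
theorem ABMod.a_smul (M : ABMod.{v}) (f : ℂ⟦X⟧) (m : M) :
    M.a (f • m) = f • M.a m + ((X : ℂ⟦X⟧) ^ 2 * derivative ℂ f) • m := by
  let D : ℂ⟦X⟧ → M := fun f => M.a (f • m) - f • M.a m - ((X : ℂ⟦X⟧) ^ 2 * derivative ℂ f) • m
  have hC : ∀ c g, D (g * X + C c) = (X : ℂ⟦X⟧) • D g := by
    intro c g
    have h1 : M.a ((g * X + C c) • m) =
        (X : ℂ⟦X⟧) • M.a (g • m) + (X : ℂ⟦X⟧) ^ 2 • g • m + C c • M.a m := by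
      rw [add_smul, map_add, M.a_const, mul_comm g, mul_smul]
      rw [sub_eq_iff_eq_add.1 (M.a_b (g • m))]
      abel
    have h2 : (X : ℂ⟦X⟧) ^ 2 * derivative ℂ (g * X + C c) =
        X ^ 2 * g + X * (X ^ 2 * derivative ℂ g) := by
      simp only [map_add, Derivation.leibniz, derivative_X, derivative_C, smul_eq_mul]
      ring
    simp only [D]
    rw [h1, h2]
    simp only [add_smul, smul_sub, mul_smul]
    rw [smul_comm g X]
    abel
  have hdiv : ∀ (n : ℕ) (f : ℂ⟦X⟧), ∃ x : M, D f = (X : ℂ⟦X⟧) ^ n • x := by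
    intro n
    induction n with
    | zero => exact fun f => ⟨D f, by simp⟩
    | succ n ih =>
      intro f
      obtain ⟨x, hx⟩ := ih (PowerSeries.mk fun p => coeff (p + 1) f)
      refine ⟨x, ?_⟩
      conv_lhs => rw [eq_shift_mul_X_add_const f]
      erw [hC]
      rw [hx, pow_succ', mul_smul]
  have h0 : D f = 0 := by
    let B := Module.Free.chooseBasis ℂ⟦X⟧ M
    apply B.repr.injective
    ext i n
    obtain ⟨x, hx⟩ := hdiv (n + 1) f
    rw [hx]
    simp [coeff_X_pow_mul']
  have : M.a (f • m) - f • M.a m - ((X : ℂ⟦X⟧) ^ 2 * derivative ℂ f) • m = 0 := h0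
  rw [sub_eq_zero, sub_eq_iff_eq_add] at this
  rw [this, add_comm]

/-- Isomorphisms of (a,b)-modules. -/
structure ABMod.Iso (M : ABMod.{v}) (N : ABMod.{z}) where
  toEquiv : M ≃ₗ[ℂ⟦X⟧] N
  map_a : ∀ m, toEquiv (M.a m) = N.a (toEquiv m)

/-- The sub-(a,b)-module generated by `m`: the `ℂ[[b]]`-module generated by the `a ^ ν m`. -/
def ABMod.genSubmodule (M : ABMod.{v}) (m : M) : Submodule ℂ⟦X⟧ M :=
  Submodule.span ℂ⟦X⟧ (Set.range fun ν : ℕ => M.a^[ν] m)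

theorem ABMod.a_mem_genSubmodule (M : ABMod.{v}) (m : M) {x : M} (hx : x ∈ M.genSubmodule m) :
    M.a x ∈ M.genSubmodule m := by
  induction hx using Submodule.span_induction with
  | mem x hx =>
    obtain ⟨ν, rfl⟩ := hx
    exact Submodule.subset_span ⟨ν + 1, Function.iterate_succ_apply' _ _ _⟩
  | zero => simp
  | add x y _ _ hx hy => simpa using add_mem hx hy
  | smul f x hx' hx =>
    rw [M.a_smul]
    exact add_mem (Submodule.smul_mem _ _ hx) (Submodule.smul_mem _ _ hx')

/-- The (a,b)-module generated by the element `m` of `M`. -/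
def ABMod.generated (M : ABMod.{v}) (m : M) : ABMod.{v} where
  carrier := M.genSubmodule m
  free := Module.Free.of_basis
    (Submodule.nonempty_basis_of_pid (Module.Free.chooseBasis ℂ⟦X⟧ M)
      (M.genSubmodule m)).choose_spec.some
  a :=
    { toFun := fun x => ⟨M.a x.1, M.a_mem_genSubmodule m x.2⟩
      map_zero' := by simp
      map_add' := fun x y => by ext; simp }
  a_const c x := by ext; exact M.a_const c x.1
  a_b x := by ext; exact M.a_b x.1

/-- The inclusion in `M` of the (a,b)-module generated by `m`. -/
def ABMod.incl (M : ABMod.{v}) (m : M) : M.generated m →ₗ[ℂ⟦X⟧] M := (M.genSubmodule m).subtype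

theorem ABMod.incl_injective (M : ABMod.{v}) (m : M) : Function.Injective (M.incl m) :=
  Subtype.val_injective

theorem ABMod.incl_a (M : ABMod.{v}) (m : M) (x : M.generated m) :
    M.incl m ((M.generated m).a x) = M.a (M.incl m x) := rfl

theorem ABMod.incl_mem (M : ABMod.{v}) (m : M) (x : M.generated m) :
    M.incl m x ∈ Submodule.span ℂ⟦X⟧ (Set.range fun ν : ℕ => M.a^[ν] m) := x.2

theorem ABMod.exists_incl (M : ABMod.{v}) (m : M) (ν : ℕ) :
    ∃ x : M.generated m, M.incl m x = M.a^[ν] m := ⟨⟨_, Submodule.subset_span ⟨ν, rfl⟩⟩, rfl⟩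

/-- The (a,b)-module `Ξ_Λ^{(N)} = ⨁_{λ ∈ Λ, 0 ≤ j ≤ N} ℂ[[b]] e_{λ,j}` with
`a e_{λ,0} = λ b e_{λ,0}` and `a e_{λ,j} = λ b e_{λ,j} + b e_{λ,j-1}` for `1 ≤ j`. -/
def Xi (Λ : Finset ℚ) (N : ℕ) : ABMod.{0} where
  carrier := Λ × Fin (N + 1) → ℂ⟦X⟧
  a := AddMonoidHom.mk' (fun ψ i => X ^ 2 * derivative ℂ (ψ i) + C ((i.1 : ℚ) : ℂ) * X * ψ i +
      if h : i.2.1 + 1 < N + 1 then X * ψ (i.1, ⟨i.2.1 + 1, h⟩) else 0) (by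
    intro ψ χ
    ext1 i
    simp only [Pi.add_apply, map_add]
    split_ifs <;> ring)
  a_const c ψ := by
    ext1 i
    simp only [AddMonoidHom.mk'_apply, Pi.smul_apply, smul_eq_mul, Derivation.leibniz,
      derivative_C]
    split_ifs <;> ring
  a_b ψ := by
    ext1 i
    simp only [AddMonoidHom.mk'_apply, Pi.smul_apply, Pi.sub_apply, smul_eq_mul,
      Derivation.leibniz, derivative_X]
    split_ifs <;> ring

/-- The exponents `λ_1, …, λ_{n+1}` (indexed from `0`) attached to the fundamental invariants
`λ_1, p_1, …, p_n`: `λ_{j+1} = λ_j + p_j - 1`. -/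
def expo {n : ℕ} (lam1 : ℚ) (p : Fin n → ℕ) (j : Fin (n + 1)) : ℚ :=
  lam1 + ∑ i : Fin n, if i.1 < j.1 then (p i : ℚ) - 1 else 0

/-- `E` is a `[λ]`-primitive theme: it is isomorphic to the (a,b)-module generated by one element
of `Ξ_λ^{(N)}`, for a rational `λ ∈ ]0,1]` and some `N`. -/
def IsPrimitiveTheme (E : ABMod.{v}) : Prop :=
  ∃ (lam : ℚ) (_ : 0 < lam) (_ : lam ≤ 1) (N : ℕ) (φ : Xi {lam} N),
    Nonempty (E.Iso ((Xi {lam} N).generated φ))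

/-- `E` is a `[λ]`-primitive theme of rank `n + 1` with fundamental invariants
`λ_1, p_1, …, p_n`: it has a composition series `0 = F_0 ⊂ F_1 ⊂ ⋯ ⊂ F_{n+1} = E` by
sub-(a,b)-modules such that `F_j / F_{j-1}` is isomorphic to
`E_{λ_j} = ℂ[[b]] e`, `a e = λ_j b e`, for all `j`. (The `F_j` are then the unique normal
submodules of the theme `E`.) -/
def IsThemeWithInvariants {n : ℕ} (lam1 : ℚ) (p : Fin n → ℕ) (E : ABMod.{v}) : Prop :=
  IsPrimitiveTheme E ∧
  ∃ F : Fin (n + 2) → Submodule ℂ⟦X⟧ E, F 0 = ⊥ ∧ F (Fin.last (n + 1)) = ⊤ ∧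
    (∀ j, ∀ x ∈ F j, E.a x ∈ F j) ∧
    ∀ j : Fin (n + 1), ∃ e : E,
      F j.succ = F j.castSucc ⊔ Submodule.span ℂ⟦X⟧ {e} ∧
      (∀ f : ℂ⟦X⟧, f • e ∈ F j.castSucc → f = 0) ∧
      E.a e - (C (expo lam1 p j : ℂ) * X) • e ∈ F j.castSucc

/-! ### Sheaves of `𝒪_X`-(a,b)-modules -/

section Families

/-- A sheaf of `𝒪_X`-(a,b)-modules on the reduced complex space `X`, that is, a locally free sheaf
of finite type of `𝒪_X[[b]]`-modules with an `𝒪_X`-linear continuous operator `a` satisfying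
`a b - b a = b ^ 2`.  As `X` is reduced, such a sheaf is a subsheaf of the sheaf of families of
elements of its fibres, and it is given in this way: by its fibres `fib x`, which are
(a,b)-modules, and its germs of sections (`SecAt s x`: near `x`, `s` is a section of the sheaf). -/
structure ABFamily (X : Type u) [TopologicalSpace X] [ReducedComplexSpace X] where
  fib : X → ABMod.{v}
  SecAt : (∀ x, fib x) → X → Prop
  frame : ∀ x : X, ∃ (r : ℕ) (e : Fin r → ∀ y, fib y), ∀ᶠ y in 𝓝 x,
    LinearIndependent ℂ⟦X⟧ (fun i => e i y) ∧
    Submodule.span ℂ⟦X⟧ (Set.range fun i => e i y) = ⊤ ∧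
    ∀ s, SecAt s y ↔ ∃ c : Fin r → X → ℂ⟦X⟧, (∀ i, HolSeriesAt (c i) y) ∧
      ∀ᶠ t in 𝓝 y, s t = ∑ i, c i t • e i t
  a_sec : ∀ s x, SecAt s x → SecAt (fun y => (fib y).a (s y)) x

variable {X : Type u} [TopologicalSpace X] [ReducedComplexSpace X]
variable {Y : Type w} [TopologicalSpace Y] [ReducedComplexSpace Y]

/-- Isomorphisms of sheaves of `𝒪_X`-(a,b)-modules. -/
structure ABFamily.Iso (E : ABFamily.{u, v} X) (H : ABFamily.{u, z} X) where
  toIso : ∀ x, (E.fib x).Iso (H.fib x)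
  sec_iff : ∀ s x, E.SecAt s x ↔ H.SecAt (fun y => (toIso y).toEquiv (s y)) x

/-- The analytic pull back `f^* E = 𝒪_Y[[b]] ⊗ f⁻¹ E`: its fibre at `y` is `E(f(y))` and its
sections are locally the combinations of pull backs of sections of `E` with coefficients in
`𝒪_Y[[b]]`. -/
def ABFamily.pullback (E : ABFamily.{u, v} X) (f : Y → X) (hf : HolMap f) : ABFamily.{w, v} Y where
  fib y := E.fib (f y)
  SecAt t y := ∃ (m : ℕ) (s : Fin m → ∀ x, E.fib x) (c : Fin m → Y → ℂ⟦X⟧),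
    (∀ i, E.SecAt (s i) (f y)) ∧ (∀ i, HolSeriesAt (c i) y) ∧
    ∀ᶠ y' in 𝓝 y, t y' = ∑ i, c i y' • s i (f y')
  frame := by
    intro y
    obtain ⟨r, e, he⟩ := E.frame (f y)
    refine ⟨r, fun i y => e i (f y), ?_⟩
    filter_upwards [hf.continuous.continuousAt.eventually he] with y' hy'
    obtain ⟨h1, h2, h3⟩ := hy'
    refine ⟨h1, h2, fun t => ⟨?_, ?_⟩⟩
    · rintro ⟨m, s, c, hs, hc, ht⟩
      choose d hd hsd using fun i => (h3 (s i)).1 (hs i)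
      refine ⟨fun j y => ∑ i, c i y * d i j (f y), fun j => HolSeriesAt.sum _ fun i _ =>
        (hc i).mul ((hd i j).comp hf), ?_⟩
      have hsd' : ∀ᶠ y in 𝓝 y', ∀ i, s i (f y) = ∑ j, d i j (f y) • e j (f y) :=
        eventually_all.2 fun i => hf.continuous.continuousAt.eventually (hsd i)
      filter_upwards [ht, hsd'] with y hy hy2
      rw [hy]
      simp only [hy2, Finset.smul_sum, Finset.sum_smul, mul_smul]
      exact Finset.sum_comm
    · rintro ⟨c, hc, ht⟩
      refine ⟨r, e, c, fun i => (h3 (e i)).2 ⟨fun j _ => if j = i then 1 else 0,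
        fun j => HolSeriesAt.const _ _, Eventually.of_forall fun z => by simp⟩, hc, ht⟩
  a_sec := by
    rintro t y ⟨m, s, c, hs, hc, ht⟩
    refine ⟨m + m, Fin.append (fun i x => (E.fib x).a (s i x)) s,
      Fin.append c (fun i y => PowerSeries.X ^ 2 * derivative ℂ (c i y)), ?_, ?_, ?_⟩
    · refine Fin.addCases (fun i => ?_) (fun i => ?_)
      · rw [Fin.append_left]
        exact E.a_sec _ _ (hs i)
      · rw [Fin.append_right]
        exact hs i
    · refine Fin.addCases (fun i => ?_) (fun i => ?_)
      · rw [Fin.append_left]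
        exact hc i
      · rw [Fin.append_right]
        exact (HolSeriesAt.const _ _).mul (hc i).derivative
    · filter_upwards [ht] with y' hy'
      rw [hy', map_sum, Fin.sum_univ_add]
      simp only [Fin.append_left, Fin.append_right, ABMod.a_smul, Finset.sum_add_distrib]

/-- The restriction of a sheaf of `𝒪_X`-(a,b)-modules to an open subset. -/
def ABFamily.restrict (E : ABFamily.{u, v} X) (U : Opens X) : ABFamily.{u, v} U :=
  E.pullback Subtype.val (holMap_val U)

/-! ### Holomorphic families of themes -/

/-- `φ : X → Ξ_Λ^{(N)}` is a `k`-thematic holomorphic map: it is holomorphic, and the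
`𝒪_X[[b]]`-submodule of `Ξ_{X,Λ}^{(N)}` generated by the `a ^ ν φ` is free with basis
`φ, a φ, …, a ^ (k-1) φ`; here the freeness is required at each point, so that the fibre of this
sheaf at `x` is the (a,b)-module of rank `k` generated by `φ(x)` in `Ξ_Λ^{(N)}`. -/
structure IsThematic (k : ℕ) {Λ : Finset ℚ} {N : ℕ} (φ : X → Xi Λ N) : Prop where
  hol : ∀ x i, HolSeriesAt (fun t => (φ t : Λ × Fin (N + 1) → ℂ⟦X⟧) i) x
  indep : ∀ x, LinearIndependent ℂ⟦X⟧ (fun j : Fin k => (Xi Λ N).a^[j] (φ x))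
  gen : ∀ ν : ℕ, ∃ c : Fin k → X → ℂ⟦X⟧, (∀ j x, HolSeriesAt (c j) x) ∧
    ∀ x, (Xi Λ N).a^[ν] (φ x) = ∑ j, c j x • (Xi Λ N).a^[j] (φ x)

/-- The sheaf of `𝒪_X`-(a,b)-modules `E_φ` of a `k`-thematic map `φ`: the subsheaf of
`Ξ_{X,Λ}^{(N)}` generated over `𝒪_X[[b]]` by the `a ^ ν φ`. -/
def thematicFamily {k : ℕ} {Λ : Finset ℚ} {N : ℕ} (φ : X → Xi Λ N) (hφ : IsThematic k φ) :
    ABFamily.{u, 0} X where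
  fib x := (Xi Λ N).generated (φ x)
  SecAt s x := ∃ (m : ℕ) (c : Fin m → X → ℂ⟦X⟧), (∀ ν, HolSeriesAt (c ν) x) ∧
    ∀ᶠ y in 𝓝 x, (Xi Λ N).incl (φ y) (s y) = ∑ ν, c ν y • (Xi Λ N).a^[ν] (φ y)
  frame := by
    intro x
    have hind := hφ.indep
    have hgen := hφ.gen
    clear hφ
    generalize Xi Λ N = M at φ hind hgen ⊢
    choose e he using fun (j : Fin k) (y : X) => M.exists_incl (φ y) j
    refine ⟨k, e, Eventually.of_forall fun y => ⟨?_, ?_, ?_⟩⟩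
    · apply LinearIndependent.of_comp (M.incl (φ y))
      have : (M.incl (φ y)) ∘ (fun j => e j y) = fun j : Fin k => M.a^[j] (φ y) :=
        funext fun j => he j y
      rw [this]
      exact hind y
    · rw [eq_top_iff]
      intro t _
      have key : Submodule.span ℂ⟦X⟧ (Set.range fun ν : ℕ => M.a^[ν] (φ y)) ≤
          Submodule.span ℂ⟦X⟧ (Set.range fun j : Fin k => M.a^[j] (φ y)) := by
        refine Submodule.span_le.2 ?_
        rintro _ ⟨ν, rfl⟩
        obtain ⟨c, -, hc⟩ := hgen ν
        simp only [hc y]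
        exact Submodule.sum_mem _ fun j _ =>
          Submodule.smul_mem _ _ (Submodule.subset_span ⟨j, rfl⟩)
      obtain ⟨c, hc⟩ := (Submodule.mem_span_range_iff_exists_fun _).1
        (key (M.incl_mem (φ y) t))
      refine (Submodule.mem_span_range_iff_exists_fun _).2 ⟨c, ?_⟩
      apply M.incl_injective
      simpa only [map_sum, map_smul, he] using hc
    · intro s
      have hsub : ∀ (c : Fin k → X → ℂ⟦X⟧) (t : X), (s t = ∑ j, c j t • e j t) ↔
          M.incl (φ t) (s t) = ∑ j, c j t • M.a^[j] (φ t) := by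
        intro c t
        rw [← (M.incl_injective (φ t)).eq_iff]
        simp only [map_sum, map_smul, he]
      constructor
      · rintro ⟨m, c, hc, hs⟩
        choose d hd hd' using hgen
        refine ⟨fun j t => ∑ ν : Fin m, c ν t * d ν j t, fun j => HolSeriesAt.sum _ fun ν _ =>
          (hc ν).mul (hd ν j y), ?_⟩
        filter_upwards [hs] with t ht
        refine (hsub (fun j t => ∑ ν : Fin m, c ν t * d ν j t) t).2 (ht.trans ?_)
        have : ∀ ν : Fin m, c ν t • M.a^[ν] (φ t) =
            ∑ j, (c ν t * d ν j t) • M.a^[j] (φ t) := by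
          intro ν
          conv_lhs => rw [hd' ν t]
          simp only [Finset.smul_sum, mul_smul]
        simp only [this, Finset.sum_smul]
        exact Finset.sum_comm
      · rintro ⟨c, hc, hs⟩
        exact ⟨k, c, hc, hs.mono fun t ht => (hsub c t).1 ht⟩
  a_sec := by
    clear hφ
    generalize Xi Λ N = M at φ ⊢
    rintro s x ⟨m, c, hc, hs⟩
    refine ⟨m + 1, fun ν y =>
      (if h : ν.1 < m then PowerSeries.X ^ 2 * derivative ℂ (c ⟨ν.1, h⟩ y) else 0) +
      (if h : 0 < ν.1 then c ⟨ν.1 - 1, by omega⟩ y else 0), ?_, ?_⟩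
    · intro ν
      refine HolSeriesAt.add ?_ ?_
      · split_ifs with h
        · exact (HolSeriesAt.const _ _).mul (hc _).derivative
        · exact HolSeriesAt.const _ _
      · split_ifs with h
        · exact hc _
        · exact HolSeriesAt.const _ _
    · filter_upwards [hs] with y hy
      rw [M.incl_a, hy, map_sum]
      simp only [add_smul, Finset.sum_add_distrib, ABMod.a_smul]
      rw [add_comm]
      congr 1
      · rw [Fin.sum_univ_castSucc]
        simp
      · rw [Fin.sum_univ_succ]
        rw [dif_neg (by simp), zero_smul, zero_add]
        simp only [Fin.val_succ, Nat.succ_pos, dite_true, Nat.add_sub_cancel,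
          Function.iterate_succ_apply', Fin.eta]

/-- `E` is a holomorphic family of themes of rank `k`: locally on `X`, it is isomorphic to the
sheaf `E_φ` of a `k`-thematic holomorphic map with values in some `Ξ_Λ^{(k-1)}`, with `Λ` a finite
subset of `]0,1] ∩ ℚ`. -/
def IsHolomorphicFamily (k : ℕ) (E : ABFamily.{u, v} X) : Prop :=
  ∀ x : X, ∃ (U : Opens X) (_ : x ∈ U) (Λ : Finset ℚ) (_ : ∀ l ∈ Λ, 0 < l ∧ l ≤ 1)
    (φ : U → Xi Λ (k - 1)) (hφ : IsThematic k φ),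
    Nonempty ((E.restrict U).Iso (thematicFamily φ hφ))

/-- `E` is a holomorphic family of `[λ]`-primitive themes with fundamental invariants
`λ_1, p_1, …, p_n` (hence of rank `n + 1`). -/
def IsFamilyWithInvariants {n : ℕ} (lam1 : ℚ) (p : Fin n → ℕ) (E : ABFamily.{u, v} X) : Prop :=
  IsHolomorphicFamily (n + 1) E ∧ ∀ x, IsThemeWithInvariants lam1 p (E.fib x)

/-! ### Versality and universality -/

/-- The holomorphic map `f : U → X` is such that `f^* E` is isomorphic to the restriction of `H`
to `U`. -/
def IsClassifyingMap (E : ABFamily.{u, v} X) (H : ABFamily.{w, z} Y) (U : Opens Y) (f : U → X) :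
    Prop :=
  ∃ hf : HolMap f, Nonempty ((E.pullback f hf).Iso (H.restrict U))

end Families

section Versality

variable {X : Type u} [TopologicalSpace X] [ReducedComplexSpace X]

/-- The family `E` is versal near `x₀`. -/
def IsVersalNear {n : ℕ} (lam1 : ℚ) (p : Fin n → ℕ) (E : ABFamily.{u, v} X) (x₀ : X) : Prop :=
  ∀ (Y : Type w) [TopologicalSpace Y] [ReducedComplexSpace Y] (y₀ : Y) (H : ABFamily.{w, z} Y),
    IsFamilyWithInvariants lam1 p H → Nonempty ((H.fib y₀).Iso (E.fib x₀)) →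
    ∃ (U : Opens Y) (_ : y₀ ∈ U) (f : U → X), IsClassifyingMap E H U f

/-- The germ at `y₀` of a classifying map as in the definition of the versality near `x₀` is
always unique. -/
def HasUniqueClassifyingGerms {n : ℕ} (lam1 : ℚ) (p : Fin n → ℕ) (E : ABFamily.{u, v} X)
    (x₀ : X) : Prop :=
  ∀ (Y : Type w) [TopologicalSpace Y] [ReducedComplexSpace Y] (y₀ : Y) (H : ABFamily.{w, z} Y),
    IsFamilyWithInvariants lam1 p H → Nonempty ((H.fib y₀).Iso (E.fib x₀)) →
    ∀ (U U' : Opens Y) (_ : y₀ ∈ U) (_ : y₀ ∈ U') (f : U → X) (f' : U' → X),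
      IsClassifyingMap E H U f → IsClassifyingMap E H U' f' →
      ∀ᶠ y in 𝓝 y₀, ∀ (h : y ∈ U) (h' : y ∈ U'), f ⟨y, h⟩ = f' ⟨y, h'⟩

/-- `E` is a holomorphic family of `[λ]`-primitive themes with fundamental invariants
`λ_1, p_1, …, p_n` which is versal near each point. -/
def IsLocallyVersal {n : ℕ} (lam1 : ℚ) (p : Fin n → ℕ) (E : ABFamily.{u, v} X) : Prop :=
  IsFamilyWithInvariants lam1 p E ∧ ∀ x₀, IsVersalNear.{u, v, w, z} lam1 p E x₀

/-- `E` is (globally) universal: it is universal near each point, and each isomorphism class of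
`[λ]`-primitive themes with fundamental invariants `λ_1, p_1, …, p_n` appears exactly once. -/
def IsUniversal {n : ℕ} (lam1 : ℚ) (p : Fin n → ℕ) (E : ABFamily.{u, v} X) : Prop :=
  IsLocallyVersal.{u, v, w, z} lam1 p E ∧
  (∀ x₀, HasUniqueClassifyingGerms.{u, v, w, z} lam1 p E x₀) ∧
  ∀ T : ABMod.{z}, IsThemeWithInvariants lam1 p T → ∃! x : X, Nonempty (T.Iso (E.fib x))

end Versality

/-! ### The canonical family -/

section Canonical

variable {n : ℕ}

/-- `p_i + ⋯ + p_{i+h}` (the sum stops at the last index). -/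
def pSum (p : Fin n → ℕ) (i : Fin n) (h : ℕ) : ℕ :=
  ∑ l : Fin n, if i.1 ≤ l.1 ∧ l.1 ≤ i.1 + h then p l else 0

/-- The exponents of the monomials spanning the space `V_{i+1}`, where `i = 0, …, n - 1`. With
`k = n + 1` and `j = i + 1`, one has `k - j = n - i`: they are `0, …, k - j - 1` and moreover,
when `p_j + ⋯ + p_{k-1} ≥ k - j`, the number `q_j = p_j + ⋯ + p_{j+h}` with `h` minimal such that
`q_j ≥ k - j`. -/
def vExponents (p : Fin n → ℕ) (i : Fin n) : Finset ℕ :=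
  Finset.range (n - i.1) ∪
    if pSum p i n < n - i.1 then ∅ else {pSum p i (sInf {h : ℕ | n - i.1 ≤ pSum p i h})}

/-- The space `V_{i+1}` of polynomials in `b`. -/
def V (p : Fin n → ℕ) (i : Fin n) : Submodule ℂ ℂ⟦X⟧ :=
  Submodule.span ℂ ((fun m : ℕ => (X : ℂ⟦X⟧) ^ m) '' (vExponents p i : Set ℕ))

/-- The set `W_{i+1}` of the elements of `V_{i+1}` with constant term `1` and with a non zero
coefficient of `b ^ p_{i+1}`. -/
def W (p : Fin n → ℕ) (i : Fin n) : Set ℂ⟦X⟧ :=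
  {S | S ∈ V p i ∧ coeff 0 S = 1 ∧ coeff (p i) S ≠ 0}

/-- The parameter space `S(λ_1, p_1, …, p_n)`: the set of `(S_1, …, S_n)` with `S_j ∈ W_j`. -/
def ParamSpace (p : Fin n → ℕ) : Type := {σ : Fin n → ℂ⟦X⟧ // ∀ i, σ i ∈ W p i}

/-- The coordinates on the parameter space: the coefficients of the `S_j`. -/
def ParamSpace.coord (p : Fin n → ℕ) (σ : ParamSpace p) :
    (Σ i : Fin n, vExponents p i) → ℂ := fun x => coeff x.2.1 (σ.1 x.1)

instance (p : Fin n → ℕ) : TopologicalSpace (ParamSpace p) :=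
  TopologicalSpace.induced (ParamSpace.coord p) inferInstance

theorem mem_V_iff (p : Fin n → ℕ) (i : Fin n) (S : ℂ⟦X⟧) :
    S ∈ V p i ↔ ∀ m ∉ vExponents p i, coeff m S = 0 := by
  constructor
  · intro hS m hm
    induction hS using Submodule.span_induction with
    | mem x hx =>
      obtain ⟨l, hl, rfl⟩ := hx
      have : m ≠ l := by rintro rfl; exact hm hl
      simp [coeff_X_pow, this]
    | zero => simp
    | add x y _ _ hx hy => simp [hx, hy]
    | smul c x _ hx => simp [hx]
  · intro h
    have : S = ∑ m ∈ vExponents p i, coeff m S • (X : ℂ⟦X⟧) ^ m := by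
      ext l
      by_cases hl : l ∈ vExponents p i
      · simp [coeff_X_pow, hl]
      · simp [coeff_X_pow, hl, h l hl]
    rw [this]
    exact Submodule.sum_mem _ fun m hm => Submodule.smul_mem _ _
      (Submodule.subset_span ⟨m, hm, rfl⟩)

theorem zero_mem_vExponents (p : Fin n → ℕ) (i : Fin n) : 0 ∈ vExponents p i := by
  have := i.2
  simp only [vExponents, Finset.mem_union, Finset.mem_range]
  left; omega

theorem p_mem_vExponents (p : Fin n → ℕ) (i : Fin n) : p i ∈ vExponents p i := by
  simp only [vExponents, Finset.mem_union, Finset.mem_range]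
  by_cases h : p i < n - i.1
  · exact Or.inl h
  · right
    have h0 : pSum p i 0 = p i := by
      unfold pSum
      rw [Finset.sum_eq_single i]
      · simp
      · intro l _ hl
        rw [if_neg]
        intro hh
        exact hl (Fin.ext (by omega))
      · simp
    have hle : p i ≤ pSum p i n := by
      unfold pSum
      refine le_trans ?_ (Finset.single_le_sum (fun _ _ => Nat.zero_le _) (Finset.mem_univ i))
      simp
    have hz : sInf {h : ℕ | n - i.1 ≤ pSum p i h} = 0 := by
      apply Nat.sInf_eq_zero.2
      left
      simp only [Set.mem_ofPred_eq, h0]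
      omega
    rw [if_neg (by omega), hz, h0]
    simp

theorem ParamSpace.coord_injective (p : Fin n → ℕ) : Function.Injective (ParamSpace.coord p) := by
  intro σ τ h
  apply Subtype.ext
  funext i
  ext m
  by_cases hm : m ∈ vExponents p i
  · exact congrFun h ⟨i, m, hm⟩
  · rw [(mem_V_iff p i _).1 (σ.2 i).1 m hm, (mem_V_iff p i _).1 (τ.2 i).1 m hm]

theorem ParamSpace.isEmbedding_coord (p : Fin n → ℕ) : IsEmbedding (ParamSpace.coord p) :=
  ⟨⟨rfl⟩, ParamSpace.coord_injective p⟩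

theorem ParamSpace.range_coord (p : Fin n → ℕ) : Set.range (ParamSpace.coord p) =
    {v | ∀ i, v ⟨i, 0, zero_mem_vExponents p i⟩ = 1 ∧ v ⟨i, p i, p_mem_vExponents p i⟩ ≠ 0} := by
  ext v
  constructor
  · rintro ⟨σ, rfl⟩ i
    exact ⟨(σ.2 i).2.1, (σ.2 i).2.2⟩
  · intro hv
    refine ⟨⟨fun i => PowerSeries.mk fun m =>
      if h : m ∈ vExponents p i then v ⟨i, m, h⟩ else 0, fun i => ⟨?_, ?_, ?_⟩⟩, ?_⟩
    · rw [mem_V_iff]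
      intro m hm
      simp [hm]
    · simpa [zero_mem_vExponents p i] using (hv i).1
    · simpa [p_mem_vExponents p i] using (hv i).2
    · funext ⟨i, m, hm⟩
      simp [ParamSpace.coord, hm]

/-- The complex manifold structure of the parameter space: it is identified by its coordinates
with an open subset of an affine subspace of some `ℂ^N`. -/
instance (p : Fin n → ℕ) : ReducedComplexSpace (ParamSpace p) where
  t2 := (ParamSpace.isEmbedding_coord p).t2Space
  holAt f σ := ∃ g : ((Σ i : Fin n, vExponents p i) → ℂ) → ℂ,
    AnalyticAt ℂ g (ParamSpace.coord p σ) ∧ f =ᶠ[𝓝 σ] g ∘ ParamSpace.coord p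
  chart := by
    intro σ
    refine ⟨_, inferInstance, Set.univ, ParamSpace.coord p, isOpen_univ, trivial, ?_, ?_,
      fun _ _ _ => Iff.rfl⟩
    · exact (ParamSpace.isEmbedding_coord p).comp IsEmbedding.subtypeVal
    · rw [Set.image_univ, ParamSpace.range_coord]
      intro v hv
      refine ⟨n, fun i w => w ⟨i, 0, zero_mem_vExponents p i⟩ - 1, fun i => ?_, ?_⟩
      · exact ((ContinuousLinearMap.proj (R := ℂ) (φ := fun _ => ℂ)
          (⟨i, 0, zero_mem_vExponents p i⟩ : Σ i : Fin n, vExponents p i)).analyticAt v).sub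
          analyticAt_const
      · have : ∀ᶠ w in 𝓝 v, ∀ i : Fin n, w ⟨i, p i, p_mem_vExponents p i⟩ ≠ 0 :=
          eventually_all.2 fun i => (continuous_apply _).continuousAt.eventually_ne (hv i).2
        filter_upwards [this] with w hw
        constructor
        · intro h i
          simp [(h i).1]
        · intro h i
          exact ⟨by simpa [sub_eq_zero] using h i, hw i⟩

/-- The (a,b)-module `E(σ)` with `ℂ[[b]]`-basis `e_1, …, e_{n+1}` such that
`(a - λ_1 b) e_1 = 0` and `(a - λ_{j+1} b) e_{j+1} = S_j e_j` for `1 ≤ j ≤ n`. This is the quotient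
`Ã / Ã P` with `P = (a - λ_1 b) S_1⁻¹ (a - λ_2 b) ⋯ S_n⁻¹ (a - λ_{n+1} b)`, where the class of `1`
is `e_{n+1}`; its universal property is proved below. -/
def canMod (lam1 : ℚ) (p : Fin n → ℕ) (S : Fin n → ℂ⟦X⟧) : ABMod.{0} where
  carrier := Fin (n + 1) → ℂ⟦X⟧
  a := AddMonoidHom.mk' (fun ψ i => X ^ 2 * derivative ℂ (ψ i) +
      C (expo lam1 p i : ℂ) * X * ψ i +
      if h : i.1 < n then S ⟨i.1, h⟩ * ψ ⟨i.1 + 1, by omega⟩ else 0) (by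
    intro ψ χ
    ext1 i
    simp only [Pi.add_apply, map_add]
    split_ifs <;> ring)
  a_const c ψ := by
    ext1 i
    simp only [AddMonoidHom.mk'_apply, Pi.smul_apply, smul_eq_mul, Derivation.leibniz,
      derivative_C]
    split_ifs <;> ring
  a_b ψ := by
    ext1 i
    simp only [AddMonoidHom.mk'_apply, Pi.smul_apply, Pi.sub_apply, smul_eq_mul,
      Derivation.leibniz, derivative_X]
    split_ifs <;> ring

theorem canMod_a_apply (lam1 : ℚ) (p : Fin n → ℕ) (S : Fin n → ℂ⟦X⟧) (ψ : Fin (n + 1) → ℂ⟦X⟧)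
    (i : Fin (n + 1)) : ((canMod lam1 p S).a ψ : Fin (n + 1) → ℂ⟦X⟧) i =
      X ^ 2 * derivative ℂ (ψ i) + C (expo lam1 p i : ℂ) * X * ψ i +
      if h : i.1 < n then S ⟨i.1, h⟩ * ψ ⟨i.1 + 1, by omega⟩ else 0 := rfl

/-- The element `e_{i+1}` of the basis of `E(σ)`. -/
def canBasis (lam1 : ℚ) (p : Fin n → ℕ) (S : Fin n → ℂ⟦X⟧) (i : Fin (n + 1)) : canMod lam1 p S :=
  (Pi.single i 1 : Fin (n + 1) → ℂ⟦X⟧)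

/-- `S_{n+1-t}⁻¹ (a - λ_{n+2-t} b) ⋯ S_n⁻¹ (a - λ_{n+1} b) m` (with `t` factors). -/
def partialP (lam1 : ℚ) (p : Fin n → ℕ) (S : Fin n → ℂ⟦X⟧) (M : ABMod.{v}) (m : M) : ℕ → M
  | 0 => m
  | t + 1 => if h : t < n then (S ⟨n - 1 - t, by omega⟩)⁻¹ •
      (M.a (partialP lam1 p S M m t) -
        (C (expo lam1 p ⟨n - t, by omega⟩ : ℂ) * X) • partialP lam1 p S M m t) else 0

/-- The action on `m` of `P = (a - λ_1 b) S_1⁻¹ (a - λ_2 b) ⋯ S_n⁻¹ (a - λ_{n+1} b)`. -/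
def applyP (lam1 : ℚ) (p : Fin n → ℕ) (S : Fin n → ℂ⟦X⟧) (M : ABMod.{v}) (m : M) : M :=
  M.a (partialP lam1 p S M m n) - (C (expo lam1 p 0 : ℂ) * X) • partialP lam1 p S M m n

theorem canMod_a_basis_zero (lam1 : ℚ) (p : Fin n → ℕ) (S : Fin n → ℂ⟦X⟧) :
    (canMod lam1 p S).a (canBasis lam1 p S 0) =
      (C (expo lam1 p 0 : ℂ) * X) • canBasis lam1 p S 0 := by
  change (_ : Fin (n + 1) → ℂ⟦X⟧) = _
  funext i
  erw [canMod_a_apply]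
  change _ = (C (expo lam1 p 0 : ℂ) * X) * (Pi.single 0 1 : Fin (n + 1) → ℂ⟦X⟧) i
  by_cases h0 : i = 0
  · subst h0
    simp [canBasis, Fin.ext_iff]
  · simp [canBasis, Fin.ext_iff, h0, Fin.val_eq_zero_iff]

theorem canMod_a_basis_succ (lam1 : ℚ) (p : Fin n → ℕ) (S : Fin n → ℂ⟦X⟧) (j : Fin n) :
    (canMod lam1 p S).a (canBasis lam1 p S j.succ) =
      (C (expo lam1 p j.succ : ℂ) * X) • canBasis lam1 p S j.succ +
        S j • canBasis lam1 p S j.castSucc := by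
  change (_ : Fin (n + 1) → ℂ⟦X⟧) = _
  funext i
  erw [canMod_a_apply]
  change _ = (C (expo lam1 p j.succ : ℂ) * X) * (Pi.single j.succ 1 : Fin (n + 1) → ℂ⟦X⟧) i +
    S j * (Pi.single j.castSucc 1 : Fin (n + 1) → ℂ⟦X⟧) i
  unfold canBasis
  by_cases h0 : i = j.succ
  · subst h0
    simp [Fin.ext_iff]
  · by_cases h1 : i = j.castSucc
    · subst h1
      simp [Pi.single_apply, Fin.ext_iff]
    · have h2 : i.1 ≠ j.1 := fun h => h1 (Fin.ext h)
      simp [h0, h1, h2, Fin.ext_iff]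

/-- The generator `e_{n+1}` of `E(σ)` is annihilated by `P`. -/
theorem canMod_applyP (lam1 : ℚ) (p : Fin n → ℕ) (S : Fin n → ℂ⟦X⟧)
    (hS : ∀ i, coeff 0 (S i) ≠ 0) :
    applyP lam1 p S (canMod lam1 p S) (canBasis lam1 p S (Fin.last n)) = 0 := by
  have key : ∀ t, (ht : t ≤ n) → partialP lam1 p S (canMod lam1 p S)
      (canBasis lam1 p S (Fin.last n)) t = canBasis lam1 p S ⟨n - t, by omega⟩ := by
    intro t
    induction t with
    | zero => intro _; rfl
    | succ t ih =>
      intro ht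
      have h1 : (⟨n - t, by omega⟩ : Fin (n + 1)) = (⟨n - 1 - t, by omega⟩ : Fin n).succ :=
        Fin.ext (by simp; omega)
      have h2 : (⟨n - (t + 1), by omega⟩ : Fin (n + 1)) =
        (⟨n - 1 - t, by omega⟩ : Fin n).castSucc := Fin.ext (by simp; omega)
      rw [partialP, dif_pos (by omega), ih (by omega), h1, canMod_a_basis_succ, h2,
        add_sub_cancel_left, smul_smul, PowerSeries.inv_mul_cancel _ (by simpa using hS _),
        one_smul]
  rw [applyP, key n le_rfl]
  have : (⟨n - n, by omega⟩ : Fin (n + 1)) = 0 := Fin.ext (by simp)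
  rw [this, canMod_a_basis_zero, sub_self]

/-- The universal property of `Ã / Ã P`: for each element `m` annihilated by `P` of an
(a,b)-module `M` there is a unique morphism `E(σ) → M` which maps the generator `e_{n+1}` to
`m`. -/
theorem canMod_universal (lam1 : ℚ) (p : Fin n → ℕ) (S : Fin n → ℂ⟦X⟧)
    (hS : ∀ i, coeff 0 (S i) ≠ 0) (M : ABMod.{v}) (m : M) (hm : applyP lam1 p S M m = 0) :
    ∃! F : canMod lam1 p S →ₗ[ℂ⟦X⟧] M,
      (∀ x, F ((canMod lam1 p S).a x) = M.a (F x)) ∧ F (canBasis lam1 p S (Fin.last n)) = m := by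
  have hb : ∀ x : canMod lam1 p S,
      x = ∑ i, (x : Fin (n + 1) → ℂ⟦X⟧) i • canBasis lam1 p S i := fun x =>
    (pi_eq_sum_univ' (x : Fin (n + 1) → ℂ⟦X⟧)).trans (by
      refine Finset.sum_congr rfl fun i _ => ?_
      congr 1)
  set w : Fin (n + 1) → M := fun i => partialP lam1 p S M m (n - i.1) with hw
  have w0 : M.a (w 0) = (C (expo lam1 p 0 : ℂ) * X) • w 0 := sub_eq_zero.1 hm
  have ws : ∀ j : Fin n, M.a (w j.succ) =
      (C (expo lam1 p j.succ : ℂ) * X) • w j.succ + S j • w j.castSucc := by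
    intro j
    have hj := j.2
    have h1 : n - j.castSucc.1 = (n - j.succ.1) + 1 := by simp; omega
    have h2 : (⟨n - (n - j.succ.1), by omega⟩ : Fin (n + 1)) = j.succ := Fin.ext (by simp; omega)
    have h3 : (⟨n - 1 - (n - j.succ.1), by simp; omega⟩ : Fin n) = j :=
      Fin.ext (by simp; omega)
    have h4 : w j.castSucc = (S j)⁻¹ • (M.a (w j.succ) -
        (C (expo lam1 p j.succ : ℂ) * X) • w j.succ) := by
      simp only [hw]
      rw [h1, partialP, dif_pos (by simp; omega), h2, h3]
    rw [h4, smul_smul, PowerSeries.mul_inv_cancel _ (by simpa using hS j), one_smul]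
    abel
  let F : canMod lam1 p S →ₗ[ℂ⟦X⟧] M := Fintype.linearCombination ℂ⟦X⟧ w
  have hF : ∀ i, F (canBasis lam1 p S i) = w i := fun i => by
    refine (Fintype.linearCombination_apply_single ℂ⟦X⟧ w i 1).trans (one_smul _ _)
  refine ⟨F, ⟨?_, ?_⟩, ?_⟩
  · have hbas : ∀ i, F ((canMod lam1 p S).a (canBasis lam1 p S i)) =
        M.a (F (canBasis lam1 p S i)) := by
      intro i
      refine Fin.cases ?_ (fun j => ?_) i
      · rw [canMod_a_basis_zero, map_smul, hF, w0]
      · rw [canMod_a_basis_succ, map_add, map_smul, map_smul, hF, hF, ws]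
    intro x
    rw [hb x]
    simp only [map_sum, ABMod.a_smul, map_add, map_smul, hbas]
  · rw [hF]
    simp [hw, partialP]
  · rintro G ⟨hG, hG'⟩
    have hGw : ∀ i, G (canBasis lam1 p S i) = w i := by
      intro i
      induction i using Fin.reverseInduction with
      | last =>
        rw [hG']
        simp [hw, partialP]
      | cast j ih =>
        have h := hG (canBasis lam1 p S j.succ)
        rw [canMod_a_basis_succ, map_add, map_smul, map_smul, ih, ws, add_right_inj] at h
        have h' := congrArg (fun x => (S j)⁻¹ • x) h
        simpa only [smul_smul, PowerSeries.inv_mul_cancel _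
          (show constantCoeff (S j) ≠ 0 by simpa using hS j), one_smul] using h'
    ext1 x
    rw [hb x]
    simp only [map_sum, map_smul, hGw, hF]

/-- The canonical family, parametrized by the complex manifold `S(λ_1, p_1, …, p_n)`: its fibre at
`σ` is `E(σ)`, and its sections are the holomorphic combinations of `e_1, …, e_{n+1}`. -/
def canonicalFamily (lam1 : ℚ) (p : Fin n → ℕ) : ABFamily.{0, 0} (ParamSpace p) where
  fib σ := canMod lam1 p σ.1
  SecAt s σ := ∀ i, HolSeriesAt (fun τ => (s τ : Fin (n + 1) → ℂ⟦X⟧) i) σ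
  frame := by
    intro σ
    refine ⟨n + 1, fun i τ => (Pi.single i 1 : Fin (n + 1) → ℂ⟦X⟧),
      Eventually.of_forall fun τ => ⟨?_, ?_, ?_⟩⟩
    · exact Pi.linearIndependent_single_one (Fin (n + 1)) ℂ⟦X⟧
    · have h := (Pi.basisFun ℂ⟦X⟧ (Fin (n + 1))).span_eq
      have h2 : (Pi.basisFun ℂ⟦X⟧ (Fin (n + 1)) : Fin (n + 1) → Fin (n + 1) → ℂ⟦X⟧) =
        fun i => Pi.single i 1 := funext fun i => Pi.basisFun_apply _ _ i
      rw [h2] at h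
      exact h
    · intro s
      have key : ∀ (c : Fin (n + 1) → ℂ⟦X⟧),
          ∑ i, c i • (Pi.single i 1 : Fin (n + 1) → ℂ⟦X⟧) = c := by
        intro c
        ext1 j
        simp [Finset.sum_apply, Pi.single_apply]
      constructor
      · intro h
        exact ⟨fun i τ => (s τ : Fin (n + 1) → ℂ⟦X⟧) i, h,
          Eventually.of_forall fun t => (key _).symm⟩
      · rintro ⟨c, hc, hs⟩ i
        refine (hc i).congr (hs.mono fun t ht => ?_)
        have : (s t : Fin (n + 1) → ℂ⟦X⟧) = fun j => c j t := ht.trans (key fun j => c j t)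
        exact (congrFun this i).symm
  a_sec := by
    intro s σ hs i
    have hS : ∀ (j : Fin n), HolSeriesAt (fun τ : ParamSpace p => τ.1 j) σ := by
      intro j
      refine Eventually.of_forall fun τ m => ?_
      by_cases hm : m ∈ vExponents p j
      · exact ⟨fun w => w ⟨j, m, hm⟩, (ContinuousLinearMap.proj (R := ℂ) (φ := fun _ => ℂ)
          (⟨j, m, hm⟩ : Σ i : Fin n, vExponents p i)).analyticAt _, EventuallyEq.rfl⟩
      · refine (HolAt.const 0 τ).congr (Eventually.of_forall fun t => ?_)
        exact ((mem_V_iff p j _).1 (t.2 j).1 m hm).symm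
    have h1 := ((HolSeriesAt.const (X ^ 2) σ).mul (hs i).derivative).add
      ((HolSeriesAt.const (C (expo lam1 p i : ℂ) * X) σ).mul (hs i))
    by_cases h : i.1 < n
    · refine (h1.add ((hS ⟨i.1, h⟩).mul (hs ⟨i.1 + 1, by omega⟩))).congr
        (Eventually.of_forall fun t => ?_)
      refine Eq.trans ?_ (canMod_a_apply lam1 p t.1 (s t) i).symm
      rw [dif_pos h]
    · refine h1.congr (Eventually.of_forall fun t => ?_)
      refine Eq.trans ?_ (canMod_a_apply lam1 p t.1 (s t) i).symm
      rw [dif_neg h, add_zero]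

/-- Each `[λ]`-primitive theme with fundamental invariants `λ_1, p_1, …, p_n` has a unique
canonical form: it is isomorphic to `E(σ)` for exactly one `σ` in `S(λ_1, p_1, …, p_n)`. -/
def HasUniqueCanonicalForms (lam1 : ℚ) (p : Fin n → ℕ) : Prop :=
  ∀ T : ABMod.{z}, IsThemeWithInvariants lam1 p T →
    ∃! σ : ParamSpace p, Nonempty (T.Iso (canMod lam1 p σ.1))

end Canonical

end

end Themes

/-! Write n = k - 1 and index from 0 as in the code. Everything rests on the operator z ↦ b² z' + c
b z, which multiplies the coefficient of b^m by m + c and moves it to degree m + 1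
(`coeff_succ_eul`). In coordinates, the equations (a - μb)x = g in Ξ, the changes of basis and the
morphisms between canonical forms all become triangular systems of scalar equations of this type.
Apart from the constant term of g, such an equation has at most one obstruction and one free
coefficient, both caused by the resonance m = -c. Solving it uses only ring operations and inverses
of nowhere vanishing functions, so holomorphic parameters are carried along. This is why the work is
done over a `FunAlg`: the holomorphic functions for families, all functions on a point for a single
module.

Versality. A family is locally generated by some φ with values in Ξ_Λ. Only the l ∈ Λ congruent to
λ_1 modulo ℤ matters, and the j-th term of the flag of a fibre involves only the indices smaller
than j (`IsFlag.le_xiSub`). After division by a unit, the leading coordinate of φ is a monomial;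
then (a - λ_k b)φ generates the preceding term of the flag. Iteration gives a basis w with (a -
λ_{j+1}b)w_{j+1} = S_j w_j and S_j(0) = 1. The coefficient of b^{p_j} in S_j is a ratio of
consecutive leading coefficients, hence is not zero (`coeff_lead_succ`). A unitriangular change of
basis, computed from the last row to the first, brings the S_j into W_j (`exists_reduction`): terms
of high degree are removed by free coefficients, except for one monomial b^{q_j} that resonance
protects. The resulting S_j are holomorphic and are the classifying map (`exists_canonical_chain`,
`nonempty_pullback_iso`).

The canonical family itself consists of themes because its basis can be realised in Ξ_l, one vector
after the other (`exists_embedded_chain`). Each step costs one power of b, and λ_1 > k - 1 provides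
enough of them.

Universality. A classifying map sends y to a canonical form of H(y), so uniqueness of these forms
determines it. When p_j ≥ k - 1 for all j, the matrix of an isomorphism E(σ) ≃ E(τ) is triangular
with a constant diagonal, and bounds on the valuations of its entries force σ = τ
(`IsMorphismMatrix.eq`). -/

namespace Themes

noncomputable section

/-! ### Power series with coefficients in an algebra of functions -/

/-- A `ℂ`-algebra of functions on `Y` which contains the inverses of its nowhere vanishing
elements. -/
structure FunAlg (Y : Type u) extends Subalgebra ℂ (Y → ℂ) where
  inv_mem : ∀ f ∈ carrier, (∀ y, f y ≠ 0) → (fun y => (f y)⁻¹) ∈ carrier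

section Series

variable {Y : Type u} (A : FunAlg Y)

/-- The families of power series whose coefficients belong to a given algebra of functions. -/
def serRing : Subring (Y → ℂ⟦X⟧) where
  carrier := {c | ∀ m, (fun y => coeff m (c y)) ∈ A.toSubalgebra}
  mul_mem' := by
    intro c d hc hd m
    have : (fun y => coeff m ((c * d) y)) =
        ∑ i ∈ Finset.HasAntidiagonal.antidiagonal m,
          (fun y => coeff i.1 (c y)) * fun y => coeff i.2 (d y) := by
      ext y
      simp [coeff_mul]
    rw [this]
    exact sum_mem fun i _ => mul_mem (hc _) (hd _)
  one_mem' m := by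
    have : (fun y : Y => coeff m ((1 : Y → ℂ⟦X⟧) y)) = algebraMap ℂ (Y → ℂ) (coeff m 1) := rfl
    rw [this]
    exact Subalgebra.algebraMap_mem _ _
  add_mem' := by
    intro c d hc hd m
    exact add_mem (hc m) (hd m)
  zero_mem' m := by
    have : (fun y : Y => coeff m ((0 : Y → ℂ⟦X⟧) y)) = 0 := by ext; simp
    rw [this]
    exact zero_mem _
  neg_mem' := by
    intro c hc m
    have : (fun y : Y => coeff m ((-c) y)) = -(fun y => coeff m (c y)) := by ext; simp
    rw [this]
    exact neg_mem (hc m)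

variable {A}

theorem FunAlg.const_mem (c : ℂ) : (fun _ : Y => c) ∈ A.toSubalgebra :=
  Subalgebra.algebraMap_mem A.toSubalgebra c

theorem FunAlg.div_mem {f g : Y → ℂ} (hf : f ∈ A.toSubalgebra) (hg : g ∈ A.toSubalgebra)
    (h : ∀ y, g y ≠ 0) : (fun y => f y / g y) ∈ A.toSubalgebra := by
  simp only [div_eq_mul_inv]
  exact mul_mem hf (A.inv_mem g hg h)

theorem serRing.const_mem (s : ℂ⟦X⟧) : (fun _ : Y => s) ∈ serRing A :=
  fun m => FunAlg.const_mem (coeff m s)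

theorem serRing.mk_mem {f : ℕ → Y → ℂ} (hf : ∀ m, f m ∈ A.toSubalgebra) :
    (fun y => PowerSeries.mk fun m => f m y) ∈ serRing A := by
  intro m
  simpa only [coeff_mk] using hf m

theorem serRing.C_mem {f : Y → ℂ} (hf : f ∈ A.toSubalgebra) :
    (fun y => C (f y)) ∈ serRing A := by
  intro m
  by_cases hm : m = 0
  · subst hm
    simpa using hf
  · simp only [coeff_C, hm, if_false]
    exact zero_mem A.toSubalgebra

theorem serRing.fmul_mem {c d : Y → ℂ⟦X⟧} (hc : c ∈ serRing A) (hd : d ∈ serRing A) :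
    (fun y => c y * d y) ∈ serRing A := mul_mem hc hd

theorem serRing.fadd_mem {c d : Y → ℂ⟦X⟧} (hc : c ∈ serRing A) (hd : d ∈ serRing A) :
    (fun y => c y + d y) ∈ serRing A := add_mem hc hd

theorem serRing.fsub_mem {c d : Y → ℂ⟦X⟧} (hc : c ∈ serRing A) (hd : d ∈ serRing A) :
    (fun y => c y - d y) ∈ serRing A := sub_mem hc hd

theorem serRing.derivative_mem {c : Y → ℂ⟦X⟧} (hc : c ∈ serRing A) :
    (fun y => derivative ℂ (c y)) ∈ serRing A := by
  intro m
  simp only [coeff_derivative]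
  exact mul_mem (hc (m + 1)) (FunAlg.const_mem _)

/-- The recursion for the coefficients of an inverse divides only by the constant term, which
vanishes nowhere. -/
theorem serRing.inv_mem {c : Y → ℂ⟦X⟧} (hc : c ∈ serRing A) (h : ∀ y, coeff 0 (c y) ≠ 0) :
    (fun y => (c y)⁻¹) ∈ serRing A := by
  have hc0 := A.inv_mem _ (hc 0) h
  simp only [coeff_zero_eq_constantCoeff_apply] at hc0
  intro m
  induction m using Nat.strong_induction_on with
  | _ m ih =>
    by_cases hm : m = 0
    · subst hm
      simpa using hc0
    · have : (fun y => coeff m (c y)⁻¹) =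
          -(fun y => (constantCoeff (c y))⁻¹) * ∑ x ∈ Finset.HasAntidiagonal.antidiagonal m,
          if x.2 < m then (fun y => coeff x.1 (c y)) * (fun y => coeff x.2 (c y)⁻¹) else 0 := by
        ext y
        rw [coeff_inv, if_neg hm]
        simp only [Pi.mul_apply, Pi.neg_apply, Finset.sum_apply]
        congr 1
        refine Finset.sum_congr rfl fun x _ => ?_
        split_ifs <;> rfl
      rw [this]
      refine mul_mem (neg_mem hc0) (sum_mem fun x _ => ?_)
      split_ifs with hx
      · exact mul_mem (hc _) (ih _ hx)
      · exact zero_mem _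

end Series

/-! ### The operator `z ↦ b² z' + c b z` -/

/-- The operator `z ↦ b² z' + c b z` on `ℂ[[b]]`. -/
def eul (c : ℂ) (z : ℂ⟦X⟧) : ℂ⟦X⟧ := X ^ 2 * derivative ℂ z + C c * X * z

theorem coeff_zero_eul (c : ℂ) (z : ℂ⟦X⟧) : coeff 0 (eul c z) = 0 := by
  simp [eul]

/-- The operator is diagonal up to a shift of the degree, so m = -c is its only resonance: it
accounts both for the kernel, spanned by b^m, and for an obstruction in degree m + 1. -/
theorem coeff_succ_eul (c : ℂ) (z : ℂ⟦X⟧) (m : ℕ) :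
    coeff (m + 1) (eul c z) = (m + c) * coeff m z := by
  have : eul c z = X * (X * derivative ℂ z + C c * z) := by simp only [eul]; ring
  rw [this, coeff_succ_X_mul]
  cases m with
  | zero => simp
  | succ m =>
    rw [map_add, coeff_succ_X_mul, coeff_derivative, coeff_C_mul]
    push_cast
    ring

theorem eul_add (c : ℂ) (z z' : ℂ⟦X⟧) : eul c (z + z') = eul c z + eul c z' := by
  simp only [eul, map_add]; ring

theorem eul_sub (c : ℂ) (z z' : ℂ⟦X⟧) : eul c (z - z') = eul c z - eul c z' := by
  simp only [eul, map_sub]; ring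

theorem eul_zero (c : ℂ) : eul c 0 = 0 := by simp [eul]

theorem eul_C_mul (c x : ℂ) (z : ℂ⟦X⟧) : eul c (C x * z) = C x * eul c z := by
  simp only [eul, Derivation.leibniz, derivative_C, smul_eq_mul]; ring

theorem eul_eq_iff {c : ℂ} {z g : ℂ⟦X⟧} :
    eul c z = g ↔ coeff 0 g = 0 ∧ ∀ m : ℕ, (m + c) * coeff m z = coeff (m + 1) g := by
  constructor
  · rintro rfl
    exact ⟨coeff_zero_eul _ _, fun m => (coeff_succ_eul _ _ _).symm⟩
  · rintro ⟨h0, h⟩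
    ext m
    cases m with
    | zero => rw [coeff_zero_eul, h0]
    | succ m => rw [coeff_succ_eul, h]

theorem serRing.eul_mem {Y : Type u} {A : FunAlg Y} (c : ℂ) {z : Y → ℂ⟦X⟧} (hz : z ∈ serRing A) :
    (fun y => eul c (z y)) ∈ serRing A :=
  add_mem (mul_mem (const_mem (X ^ 2)) (derivative_mem hz))
    (mul_mem (const_mem (C c * X)) hz)

/-- The equation `b² z' + c b z = g` with parameters. -/
theorem exists_eul_eq {Y : Type u} {A : FunAlg Y} (c : ℂ) {g : Y → ℂ⟦X⟧} (hg : g ∈ serRing A)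
    (h0 : ∀ y, coeff 0 (g y) = 0)
    (h : ∀ m : ℕ, (m : ℂ) + c = 0 → ∀ y, coeff (m + 1) (g y) = 0) :
    ∃ z ∈ serRing A, (∀ y, eul c (z y) = g y) ∧
      ∀ y m, coeff m (z y) = coeff (m + 1) (g y) / (m + c) := by
  -- In the resonant degree the divisor is 0, and the convention x / 0 = 0 selects the solution with
  -- no component in the kernel.
  refine ⟨fun y => PowerSeries.mk fun m => coeff (m + 1) (g y) / (m + c),
    serRing.mk_mem (f := fun m y => coeff (m + 1) (g y) / (m + c)) fun m => ?_,
    fun y => eul_eq_iff.2 ⟨h0 y, fun m => ?_⟩, fun y m => coeff_mk _ _⟩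
  · simp only [div_eq_mul_inv]
    exact mul_mem (hg (m + 1)) (FunAlg.const_mem _)
  · rw [coeff_mk]
    by_cases hm : (m : ℂ) + c = 0
    · rw [hm, h m hm y]; simp
    · field_simp

/-! ### Chains of equations `b² z' + c b z = g` -/

section Chains

variable {Y : Type u} (A : FunAlg Y) (p : ℕ → ℕ) (T : ℕ → Y → ℂ⟦X⟧)

/-- The partial sums `p_0 + ⋯ + p_{t-1}`. -/
def partialSum (t : ℕ) : ℕ := ∑ l ∈ Finset.range t, p l

theorem partialSum_succ (t : ℕ) : partialSum p (t + 1) = partialSum p t + p t :=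
  Finset.sum_range_succ _ _

theorem partialSum_mono : Monotone (partialSum p) :=
  monotone_nat_of_le_succ fun t => by rw [partialSum_succ]; omega

/-- The exponent `t - (p_0 + ⋯ + p_{t-1})`. -/
def chainExp (t : ℕ) : ℂ := t - partialSum p t

/-- The system `b² z_t' + c_t b z_t = g`, `b² z_{s+1}' + c_{s+1} b z_{s+1} = T_s z_s` for
`t ≤ s < K` has a solution. -/
def ChainSolvable (K t : ℕ) (g : Y → ℂ⟦X⟧) : Prop :=
  ∃ z : ℕ → Y → ℂ⟦X⟧, (∀ s, z s ∈ serRing A) ∧ (∀ y, eul (chainExp p t) (z t y) = g y) ∧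
    ∀ s, t ≤ s → s < K → ∀ y, eul (chainExp p (s + 1)) (z (s + 1) y) = T s y * z s y

variable {A p T}

theorem ChainSolvable.last {K : ℕ} {g z : Y → ℂ⟦X⟧} (hz : z ∈ serRing A)
    (h : ∀ y, eul (chainExp p K) (z y) = g y) : ChainSolvable A p T K K g :=
  ⟨fun _ => z, fun _ => hz, h, fun s h1 h2 => by omega⟩

theorem ChainSolvable.cons {K t : ℕ} {g z : Y → ℂ⟦X⟧} (hz : z ∈ serRing A)
    (h : ∀ y, eul (chainExp p t) (z y) = g y)
    (h' : ChainSolvable A p T K (t + 1) (fun y => T t y * z y)) : ChainSolvable A p T K t g := by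
  obtain ⟨x, hx, hx1, hx2⟩ := h'
  refine ⟨fun s => if s = t then z else x s, fun s => ?_, by simpa using h, fun s h1 h2 y => ?_⟩
  · dsimp only
    split_ifs
    exacts [hz, hx s]
  · have h3 : s + 1 ≠ t := by omega
    by_cases hs : s = t
    · subst hs
      simpa using hx1 y
    · simpa [hs, h3] using hx2 s (by omega) h2 y

/-- Locates the resonance of the equation of index t: with r = `partialSum p t` - t, if this is not
negative, the kernel is spanned by b^r and the obstruction is the coefficient of b^(r+1). -/
theorem natCast_add_chainExp_eq_zero {m t : ℕ} :
    (m : ℂ) + chainExp p t = 0 ↔ m + t = partialSum p t := by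
  rw [chainExp, ← add_sub_assoc, sub_eq_zero]
  exact_mod_cast Iff.rfl

theorem coeff_mul_of_vanish {f g : ℂ⟦X⟧} {d m : ℕ} (hg : ∀ l < d, coeff l g = 0) (hm : m < d) :
    coeff m (f * g) = 0 := by
  rw [coeff_mul]
  refine Finset.sum_eq_zero fun i hi => ?_
  rw [hg i.2 (by have := Finset.HasAntidiagonal.mem_antidiagonal.1 hi; omega), mul_zero]

theorem coeff_mul_of_vanish_lead {f g : ℂ⟦X⟧} {d : ℕ} (hg : ∀ l < d, coeff l g = 0) :
    coeff d (f * g) = coeff 0 f * coeff d g := by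
  rw [coeff_mul, Finset.sum_eq_single (0, d)]
  · rintro ⟨i, j⟩ hi hne
    have h1 : i + j = d := Finset.HasAntidiagonal.mem_antidiagonal.1 hi
    have h2 : j < d := by
      rcases Nat.eq_zero_or_pos i with h | h
      · subst h
        exact absurd (by simpa using h1) (by simpa using hne)
      · omega
    rw [hg j h2, mul_zero]
  · intro h
    exact absurd (Finset.HasAntidiagonal.mem_antidiagonal.2 (by simp)) h

/-- If no obstruction can occur, the system can be solved. -/
theorem chainSolvable_of_lt {K : ℕ} (hT : ∀ s, T s ∈ serRing A) (hK : partialSum p K < K) :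
    ∀ d t, t + d = K → ∀ g ∈ serRing A, (∀ y, ∀ m < d + 1, coeff m (g y) = 0) →
      ChainSolvable A p T K t g := by
  intro d
  induction d with
  | zero =>
    rintro t rfl g hg hg0
    obtain ⟨z, hz, hz1, -⟩ := exists_eul_eq (chainExp p t) hg (fun y => hg0 y 0 (by omega))
      (fun m hm => by
        rw [natCast_add_chainExp_eq_zero] at hm; simp only [Nat.add_zero] at hK; omega)
    exact ChainSolvable.last hz hz1
  | succ d ih =>
    rintro t ht g hg hg0
    -- The right-hand side of index t vanishes below degree K - t + 1, and the obstruction sits in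
    -- degree `partialSum p t` - t + 1, which is smaller as `partialSum p K` < K. Solving loses one
    -- degree, as does the bound when t becomes t + 1.
    have hle : partialSum p t ≤ partialSum p K := partialSum_mono p (by omega)
    obtain ⟨z, hz, hz1, hz2⟩ := exists_eul_eq (chainExp p t) hg (fun y => hg0 y 0 (by omega))
      (fun m hm y => hg0 y _ (by rw [natCast_add_chainExp_eq_zero] at hm; omega))
    refine ChainSolvable.cons hz hz1 (ih (t + 1) (by omega) _ (serRing.fmul_mem (hT t) hz) ?_)
    intro y m hm
    refine coeff_mul_of_vanish (d := d + 1) (fun l hl => ?_) hm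
    rw [hz2, hg0 y _ (by omega), zero_div]

/-- If the first obstruction vanishes, the following ones can be made to vanish. -/
theorem chainSolvable_of_le {K : ℕ} (hT : ∀ s, T s ∈ serRing A)
    (hTp : ∀ s, 1 ≤ s → s < K → ∀ y, coeff (p s) (T s y) ≠ 0) :
    ∀ d t, 1 ≤ t → t + d = K → K ≤ partialSum p t → ∀ g ∈ serRing A,
      (∀ y, ∀ m < d + 1, coeff m (g y) = 0) →
      (∀ y, coeff (partialSum p t - t + 1) (g y) = 0) → ChainSolvable A p T K t g := by
  intro d
  induction d with
  | zero =>
    rintro t - rfl hK g hg hg0 hgo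
    obtain ⟨z, hz, hz1, -⟩ := exists_eul_eq (chainExp p t) hg (fun y => hg0 y 0 (by omega))
      (fun m hm y => by
        rw [natCast_add_chainExp_eq_zero] at hm
        rw [← hgo y, ← hm]; simp)
    exact ChainSolvable.last hz hz1
  | succ d ih =>
    rintro t ht1 ht hK g hg hg0 hgo
    obtain ⟨z, hz, hz1, hz2⟩ := exists_eul_eq (chainExp p t) hg (fun y => hg0 y 0 (by omega))
      (fun m hm y => by
        rw [natCast_add_chainExp_eq_zero] at hm
        rw [← hgo y, ← hm]; simp)
    set r := partialSum p t - t with hr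
    -- The solution may be changed by a multiple of the kernel element b^r. The next obstruction is
    -- the coefficient of b^(r + p_t) in T_t z_t, and x is chosen to cancel it, the coefficient of
    -- b^(p_t) in T_t being invertible.
    let x : Y → ℂ := fun y => -coeff (r + p t) (T t y * z y) / coeff (p t) (T t y)
    have hx : x ∈ A.toSubalgebra := FunAlg.div_mem
      (neg_mem (serRing.fmul_mem (hT t) hz _)) (hT t _) (hTp t ht1 (by omega))
    have hz' : (fun y => z y + C (x y) * X ^ r) ∈ serRing A :=
      serRing.fadd_mem hz (serRing.fmul_mem (serRing.C_mem hx) (serRing.const_mem _))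
    have hzero : eul (chainExp p t) (X ^ r) = 0 := by
      rw [eul_eq_iff]
      refine ⟨by simp, fun m => ?_⟩
      rw [coeff_X_pow]
      split_ifs with hm
      · rw [natCast_add_chainExp_eq_zero.2 (by omega)]; simp
      · simp
    refine ChainSolvable.cons hz' (fun y => ?_) (ih (t + 1) (by omega) (by omega)
      (hK.trans (partialSum_mono p (by omega))) _ (serRing.fmul_mem (hT t) hz') ?_ ?_)
    · rw [eul_add, eul_C_mul, hzero, hz1, mul_zero, add_zero]
    · intro y m hm
      -- Since r ≥ K - t, the correction does not disturb the low degrees.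
      refine coeff_mul_of_vanish (d := d + 1) (fun l hl => ?_) hm
      rw [map_add, hz2, hg0 y _ (by omega), zero_div, coeff_C_mul, coeff_X_pow,
        if_neg (by omega), mul_zero, add_zero]
    · intro y
      have he : partialSum p (t + 1) - (t + 1) + 1 = r + p t := by
        rw [partialSum_succ]; omega
      rw [he, mul_add, map_add]
      have : T t y * (C (x y) * X ^ r) = C (x y) * (X ^ r * T t y) := by ring
      rw [this, coeff_C_mul, add_comm r, coeff_X_pow_mul]
      have h0 := hTp t ht1 (by omega) y
      simp only [x]
      rw [add_comm r]
      field_simp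
      ring

/-- The system can be solved after a correction of the right hand side by a multiple of a series
with the critical valuation. -/
theorem exists_chainSolvable_sub {K t₀ : ℕ} (hT : ∀ s, T s ∈ serRing A)
    (hTp : ∀ s, 1 ≤ s → s < K → ∀ y, coeff (p s) (T s y) ≠ 0)
    (hT0 : ∀ s, 1 ≤ s → s < K → ∀ y, coeff 0 (T s y) ≠ 0)
    (ht₀ : t₀ ≤ K) (hK : K ≤ partialSum p t₀) (hmin : ∀ t < t₀, partialSum p t < K) :
    ∀ d t, 1 ≤ t → t + d = t₀ → ∀ g ∈ serRing A, ∀ e ∈ serRing A,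
      (∀ y, ∀ m < K - t + 1, coeff m (g y) = 0) →
      (∀ y, ∀ m < partialSum p t₀ - t + 1, coeff m (e y) = 0) →
      (∀ y, coeff (partialSum p t₀ - t + 1) (e y) ≠ 0) →
      ∃ x ∈ A.toSubalgebra, ChainSolvable A p T K t fun y => g y - C (x y) * e y := by
  intro d
  induction d with
  | zero =>
    rintro t ht1 rfl g hg e he hg0 he0 he1
    simp only [Nat.add_zero] at *
    -- At the critical index, subtracting the right multiple of e makes the first obstruction
    -- vanish; the later ones are absorbed by kernel elements.
    set q := partialSum p t - t + 1
    refine ⟨fun y => coeff q (g y) / coeff q (e y), FunAlg.div_mem (hg _) (he _) he1,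
      chainSolvable_of_le hT hTp (K - t) t ht1 (by omega) hK _ (serRing.fsub_mem hg
        (serRing.fmul_mem (serRing.C_mem (FunAlg.div_mem (hg _) (he _) he1)) he))
        (fun y m hm => ?_) (fun y => ?_)⟩
    · rw [map_sub, coeff_C_mul, hg0 y m hm, he0 y m (by omega)]; simp
    · rw [map_sub, coeff_C_mul, div_mul_cancel₀ _ (he1 y), sub_self]
  | succ d ih =>
    rintro t ht1 ht g hg e he hg0 he0 he1
    have hlt := hmin t (by omega)
    -- Before the critical index, `partialSum p t` < K keeps the obstruction below the valuations of
    -- g and of e, so both can be pushed to index t + 1.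
    obtain ⟨z, hz, hz1, hz2⟩ := exists_eul_eq (chainExp p t) hg (fun y => hg0 y 0 (by omega))
      (fun m hm y => hg0 y _ (by rw [natCast_add_chainExp_eq_zero] at hm; omega))
    obtain ⟨z', hz', hz1', hz2'⟩ := exists_eul_eq (chainExp p t) he (fun y => he0 y 0 (by omega))
      (fun m hm y => he0 y _ (by rw [natCast_add_chainExp_eq_zero] at hm; omega))
    have hv : ∀ y, ∀ l < partialSum p t₀ - t, coeff l (z' y) = 0 := fun y l hl => by
      rw [hz2', he0 y _ (by omega), zero_div]
    obtain ⟨x, hx, hsol⟩ : ∃ x ∈ A.toSubalgebra, ChainSolvable A p T K (t + 1)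
        fun y => T t y * z y - C (x y) * (T t y * z' y) := by
      refine ih (t + 1) (by omega) (by omega) _ (serRing.fmul_mem (hT t) hz) _
        (serRing.fmul_mem (hT t) hz') (fun y m hm => ?_) (fun y m hm => ?_) (fun y => ?_)
      · refine coeff_mul_of_vanish (d := K - t) (fun l hl => ?_) (by omega)
        rw [hz2, hg0 y _ (by omega), zero_div]
      · exact coeff_mul_of_vanish (hv y) (by omega)
      -- The leading coefficient of e gets multiplied by T_t(0) / (`partialSum p t₀` - `partialSum p
      -- t`), where the denominator is not zero by the minimality of t₀.
      · have h1 : partialSum p t₀ - (t + 1) + 1 = partialSum p t₀ - t := by omega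
        rw [h1, coeff_mul_of_vanish_lead (hv y), hz2']
        refine mul_ne_zero (hT0 t ht1 (by omega) y) (div_ne_zero (he1 y) ?_)
        rw [Ne, natCast_add_chainExp_eq_zero]
        omega
    have hC := serRing.C_mem hx
    refine ⟨x, hx, ChainSolvable.cons (serRing.fsub_mem hz (serRing.fmul_mem hC hz'))
      (fun y => by rw [eul_sub, eul_C_mul, hz1, hz1']) ?_⟩
    have : (fun y => T t y * (z y - C (x y) * z' y)) =
        fun y => T t y * z y - C (x y) * (T t y * z' y) := by ext1 y; ring
    rw [this]
    exact hsol

/-- The homogeneous reduction: a series can be made polynomial. -/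
theorem exists_chain_reduction {K : ℕ} (hK1 : 1 ≤ K) (hT : ∀ s, T s ∈ serRing A)
    (hTp : ∀ s, 1 ≤ s → s < K → ∀ y, coeff (p s) (T s y) ≠ 0)
    (hT0 : ∀ s, 1 ≤ s → s < K → ∀ y, coeff 0 (T s y) ≠ 0) {g : Y → ℂ⟦X⟧} (hg : g ∈ serRing A) :
    ∃ z : ℕ → Y → ℂ⟦X⟧, (∀ s, z s ∈ serRing A) ∧
      (∀ s, 1 ≤ s → s < K → ∀ y, eul (chainExp p (s + 1)) (z (s + 1) y) = T s y * z s y) ∧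
      ∀ m, K ≤ m → (∀ t, 1 ≤ t → t ≤ K → (∀ s < t, partialSum p s < K) → m ≠ partialSum p t) →
        ∀ y, coeff m (g y + eul (chainExp p 1) (z 1 y)) = 0 := by
  -- The terms of g of degree at least K, with the opposite sign: this is what the operator should
  -- produce from z_1, up to one critical monomial.
  have hh : (fun y => PowerSeries.mk fun m => if m < K then 0 else -coeff m (g y)) ∈
      serRing A := by
    refine serRing.mk_mem (f := fun m y => if m < K then 0 else -coeff m (g y)) fun m => ?_
    by_cases hm : m < K
    · simp only [hm, if_true]; exact FunAlg.const_mem 0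
    · simp only [hm, if_false]; exact neg_mem (hg m)
  by_cases hlt : partialSum p K < K
  · obtain ⟨z, hz, hz1, hz2⟩ := chainSolvable_of_lt hT hlt (K - 1) 1 (by omega) _ hh
      (fun y m hm => by rw [coeff_mk, if_pos (by omega)])
    refine ⟨z, hz, hz2, fun m hm _ y => ?_⟩
    rw [map_add, hz1, coeff_mk, if_neg (by omega), add_neg_cancel]
  · have hex : ∃ t, K ≤ partialSum p t := ⟨K, by omega⟩
    classical
    -- `partialSum p t₀` is the exponent q_j of the canonical form, the only degree ≥ K that
    -- survives.
    let t₀ := Nat.find hex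
    have h1 : K ≤ partialSum p t₀ := Nat.find_spec hex
    have h2 : ∀ t < t₀, partialSum p t < K := fun t ht => not_le.1 (Nat.find_min hex ht)
    have h3 : t₀ ≤ K := Nat.find_min' hex (by omega)
    have h4 : 1 ≤ t₀ := by
      by_contra h
      have : t₀ = 0 := by omega
      rw [this] at h1
      simp [partialSum] at h1
      omega
    obtain ⟨x, hx, z, hz, hz1, hz2⟩ := exists_chainSolvable_sub hT hTp hT0 h3 h1 h2 (t₀ - 1) 1
      le_rfl (by omega) _ hh _ (serRing.const_mem (X ^ partialSum p t₀))
      (fun y m hm => by rw [coeff_mk, if_pos (by omega)])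
      (fun y m hm => by rw [coeff_X_pow, if_neg (by omega)])
      (fun y => by rw [coeff_X_pow, if_pos (by omega)]; exact one_ne_zero)
    refine ⟨z, hz, hz2, fun m hm hmt y => ?_⟩
    rw [map_add, hz1, map_sub, coeff_mk, if_neg (by omega), coeff_C_mul, coeff_X_pow,
      if_neg (hmt t₀ h4 h3 h2)]
    ring

/-- The inhomogeneous reduction. -/
theorem exists_chain_reduction_add {K : ℕ} (hK1 : 1 ≤ K) (hT : ∀ s, T s ∈ serRing A)
    (hTp : ∀ s, 1 ≤ s → s < K → ∀ y, coeff (p s) (T s y) ≠ 0)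
    (hT0 : ∀ s, 1 ≤ s → s < K → ∀ y, coeff 0 (T s y) ≠ 0) {g : Y → ℂ⟦X⟧} (hg : g ∈ serRing A)
    {r : ℕ → Y → ℂ⟦X⟧} (hr : ∀ s, r s ∈ serRing A) :
    ∃ z : ℕ → Y → ℂ⟦X⟧, (∀ s, z s ∈ serRing A) ∧
      (∀ s, 1 ≤ s → s < K → ∀ y,
        eul (chainExp p (s + 1)) (z (s + 1) y) + r s y = T s y * z s y) ∧
      ∀ m, K ≤ m → (∀ t, 1 ≤ t → t ≤ K → (∀ s < t, partialSum p s < K) → m ≠ partialSum p t) →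
        ∀ y, coeff m (g y + eul (chainExp p 1) (z 1 y)) = 0 := by
  -- A particular solution by descending recursion: z_K = 0, then z_s is the left-hand side of the
  -- equation of index s divided by the unit T_s. The homogeneous reduction is afterwards applied to
  -- g corrected by z_1.
  have hpart : ∀ d, d < K → ∃ z : ℕ → Y → ℂ⟦X⟧, (∀ s, z s ∈ serRing A) ∧
      (∀ s, K - d ≤ s → s < K → ∀ y,
        eul (chainExp p (s + 1)) (z (s + 1) y) + r s y = T s y * z s y) := by
    intro d
    induction d with
    | zero => exact fun _ => ⟨0, fun s => zero_mem _, fun s h1 h2 => by omega⟩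
    | succ d ih =>
      intro hd
      obtain ⟨z, hz, hz1⟩ := ih (by omega)
      set t := K - (d + 1) with ht
      refine ⟨fun s => if s = t then (fun y => (T t y)⁻¹ * (eul (chainExp p (t + 1)) (z (t + 1) y) +
        r t y)) else z s, fun s => ?_, fun s h1 h2 y => ?_⟩
      · dsimp only
        split_ifs
        · by_cases hs : 1 ≤ t
          · exact serRing.fmul_mem (serRing.inv_mem (hT t) (hT0 t (by omega) (by omega)))
              (serRing.fadd_mem (serRing.eul_mem _ (hz _)) (hr _))
          · omega
        · exact hz s
      · have h3 : s + 1 ≠ t := by omega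
        by_cases hs : s = t
        · rw [← hs] at h3 ⊢
          simp only [if_true, h3, if_false]
          rw [← mul_assoc, PowerSeries.mul_inv_cancel _
            (by simpa using hT0 s (by omega) h2 y), one_mul]
        · simp only [hs, if_false, h3]
          exact hz1 s (by omega) h2 y
  obtain ⟨z, hz, hz1⟩ := hpart (K - 1) (by omega)
  obtain ⟨x, hx, hx1, hx2⟩ := exists_chain_reduction hK1 hT hTp hT0
    (serRing.fadd_mem hg (serRing.eul_mem (chainExp p 1) (hz 1)))
  refine ⟨fun s => z s + x s, fun s => add_mem (hz s) (hx s), fun s h1 h2 y => ?_,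
    fun m hm hmt y => ?_⟩
  · simp only [Pi.add_apply]
    rw [eul_add, mul_add, ← hx1 s h1 h2, ← hz1 s (by omega) h2]
    ring
  · simp only [Pi.add_apply]
    rw [eul_add, ← add_assoc]
    exact hx2 m hm hmt y

end Chains

/-! ### Reduction to the canonical form -/

section Reduction

variable {Y : Type u} {A : FunAlg Y}

/-- The exponent `λ_{j+1} - λ_1 = p_1 + ⋯ + p_j - j`. -/
def expoShift (p : ℕ → ℕ) (j : ℕ) : ℚ := partialSum p j - j

theorem partialSum_shift (p : ℕ → ℕ) (i t : ℕ) :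
    partialSum p (i + t) = partialSum p i + partialSum (fun l => p (i + l)) t :=
  Finset.sum_range_add _ _ _

/-- Turns row i of a change of basis into a chain for the shifted sequence p_i, p_{i+1}, …. -/
theorem chainExp_shift (p : ℕ → ℕ) (i t : ℕ) :
    chainExp (fun l => p (i + l)) t = (expoShift p i - expoShift p (i + t) : ℚ) := by
  simp only [chainExp, expoShift, partialSum_shift]
  push_cast
  ring

/-- `m` is one of the exponents of the monomials spanning the space `V` of polynomials attached
to the integers `p_0, …, p_{K-1}`, or is less than `K`. -/
def IsFreeExponent (p : ℕ → ℕ) (K m : ℕ) : Prop :=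
  m < K ∨ ∃ t, 1 ≤ t ∧ t ≤ K ∧ (∀ s < t, partialSum p s < K) ∧ m = partialSum p t

/-- The new basis is w'_j = ∑ U_ij w_i, and the relations express that w' has the invariants S'. Row
i involves only row i + 1 and the S'_j with j ≥ i, so rows are found from the last to the first. For
j = i the relation defines S'_i as S_i plus the image of U_{i,i+1}; for j = i + s with s ≥ 1 it is a
chain in z_s = U_{i,i+s} with known multipliers S'_{i+s}. The chain reduction chooses the z_s so
that S'_i has only free exponents. -/
theorem exists_reduction (n : ℕ) (p : ℕ → ℕ) {S : ℕ → Y → ℂ⟦X⟧} (hS : ∀ j, S j ∈ serRing A)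
    (hS0 : ∀ j < n, ∀ y, coeff 0 (S j y) = 1) (hSp : ∀ j < n, ∀ y, coeff (p j) (S j y) ≠ 0) :
    ∃ (S' : ℕ → Y → ℂ⟦X⟧) (U : ℕ → ℕ → Y → ℂ⟦X⟧), (∀ j, S' j ∈ serRing A) ∧
      (∀ i j, U i j ∈ serRing A) ∧ (∀ i y, U i i y = 1) ∧ (∀ i j y, j < i → U i j y = 0) ∧
      (∀ i j, i ≤ j → j < n → ∀ y,
        eul (expoShift p i - expoShift p (j + 1) : ℚ) (U i (j + 1) y) +
          S i y * U (i + 1) (j + 1) y =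
          S' j y * U i j y) ∧
      ∀ j < n, ∀ y, coeff 0 (S' j y) = 1 ∧ coeff (p j) (S' j y) ≠ 0 ∧
        ∀ m, ¬ IsFreeExponent (fun l => p (j + l)) (n - j) m → coeff m (S' j y) = 0 := by
  suffices h : ∀ d ≤ n, ∃ (S' : ℕ → Y → ℂ⟦X⟧) (U : ℕ → ℕ → Y → ℂ⟦X⟧), (∀ j, S' j ∈ serRing A) ∧
      (∀ i j, U i j ∈ serRing A) ∧ (∀ i y, U i i y = 1) ∧ (∀ i j y, j < i → U i j y = 0) ∧
      (∀ i j, n - d ≤ i → i ≤ j → j < n → ∀ y,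
        eul (expoShift p i - expoShift p (j + 1) : ℚ) (U i (j + 1) y) +
          S i y * U (i + 1) (j + 1) y =
          S' j y * U i j y) ∧
      ∀ j, n - d ≤ j → j < n → ∀ y, coeff 0 (S' j y) = 1 ∧ coeff (p j) (S' j y) ≠ 0 ∧
        ∀ m, ¬ IsFreeExponent (fun l => p (j + l)) (n - j) m → coeff m (S' j y) = 0 by
    obtain ⟨S', U, h1, h2, h3, h4, h5, h6⟩ := h n le_rfl
    exact ⟨S', U, h1, h2, h3, h4, fun i j => h5 i j (by omega), fun j => h6 j (by omega)⟩
  intro d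
  induction d with
  | zero =>
    intro _
    refine ⟨fun _ => 0, fun i j _ => if i = j then 1 else 0, fun _ => zero_mem _, fun i j => ?_,
      fun i y => if_pos rfl, fun i j y h => if_neg (by omega),
      fun i j h1 h2 h3 => by omega, fun j h1 h2 => by omega⟩
    exact serRing.const_mem _
  | succ d ih =>
    intro hd
    obtain ⟨S', U, h1, h2, h3, h4, h5, h6⟩ := ih (by omega)
    obtain ⟨i, hi⟩ : ∃ i, i = n - (d + 1) := ⟨_, rfl⟩
    -- The row already found supplies the inhomogeneous terms of the chain.
    have hr : ∀ s, (fun y => S i y * U (i + 1) (i + s + 1) y) ∈ serRing A :=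
      fun s => serRing.fmul_mem (hS i) (h2 _ _)
    obtain ⟨z, hz, hz1, hz2⟩ := exists_chain_reduction_add (K := n - i) (p := fun l => p (i + l))
      (T := fun s => S' (i + s)) (by omega) (fun s => h1 _)
      (fun s h7 h8 y => (h6 (i + s) (by omega) (by omega) y).2.1)
      (fun s h7 h8 y => by rw [(h6 (i + s) (by omega) (by omega) y).1]; exact one_ne_zero)
      (hS i) hr
    have hS' : (fun y => S i y + eul (chainExp (fun l => p (i + l)) 1) (z 1 y)) ∈ serRing A :=
      serRing.fadd_mem (hS i) (serRing.eul_mem _ (hz 1))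
    refine ⟨fun j => if j = i then
        (fun y => S i y + eul (chainExp (fun l => p (i + l)) 1) (z 1 y)) else S' j,
      fun i' j => if i' = i then (if j = i then 1 else if i < j then z (j - i) else 0) else U i' j,
      fun j => ?_, fun i' j => ?_, fun i' y => ?_, fun i' j y h => ?_, fun i' j h7 h8 h9 y => ?_,
      fun j h7 h8 y => ?_⟩
    · dsimp only
      split_ifs
      exacts [hS', h1 j]
    · dsimp only
      split_ifs
      exacts [one_mem _, hz _, zero_mem _, h2 _ _]
    · dsimp only
      split_ifs
      exacts [rfl, h3 _ _]
    · dsimp only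
      split_ifs <;> first | omega | rfl | exact h4 _ _ _ h
    · dsimp only
      by_cases hi' : i' = i
      · subst hi'
        rw [if_pos rfl, if_neg (by omega), if_pos (by omega), if_neg (by omega), if_pos rfl]
        by_cases hj : j = i'
        · subst hj
          rw [if_pos rfl, if_pos rfl, h3, ← chainExp_shift, Nat.add_sub_cancel_left]
          simp only [Pi.one_apply]
          ring
        · rw [if_neg hj, if_neg hj, if_pos (by omega)]
          have h := hz1 (j - i') (by omega) (by omega) y
          have e1 : i' + (j - i') = j := by omega
          have e2 : j + 1 - i' = j - i' + 1 := by omega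
          have e3 : i' + (j - i' + 1) = j + 1 := by omega
          rw [chainExp_shift, e3, e1] at h
          rw [e2]
          exact h
      · rw [if_neg hi', if_neg (by omega), if_neg hi', if_neg (by omega)]
        exact h5 i' j (by omega) h8 h9 y
    · dsimp only
      by_cases hj : j = i
      · subst hj
        rw [if_pos rfl]
        refine ⟨by rw [map_add, coeff_zero_eul, hS0 j h8 y, add_zero], ?_, fun m hm => ?_⟩
        -- The degree p_j is exactly the obstruction degree of the first equation, so the change of
        -- basis leaves the coefficient of b^(p_j) unchanged.
        · have : coeff (p j) (eul (chainExp (fun l => p (j + l)) 1) (z 1 y)) = 0 := by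
            rcases Nat.eq_zero_or_pos (p j) with h0 | h0
            · rw [h0, coeff_zero_eul]
            · obtain ⟨m, hm⟩ : ∃ m, p j = m + 1 := ⟨p j - 1, by omega⟩
              rw [hm, coeff_succ_eul, natCast_add_chainExp_eq_zero.2 (by simp [partialSum, hm]),
                zero_mul]
          rw [map_add, this, add_zero]
          exact hSp j h8 y
        · simp only [IsFreeExponent, not_or, not_lt, not_exists, not_and] at hm
          exact hz2 m hm.1 (fun t h1 h2 h3 => hm.2 t h1 h2 h3) y
      · rw [if_neg hj]
        exact h6 j (by omega) h8 y

end Reduction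

/-! ### Transfer of the reduction to sequences indexed by `Fin`, and comparison with the spaces V_j
-/

section FinIndexed

variable {n : ℕ}

/-- The extension by zero of a finite sequence of integers. -/
def natExt (p : Fin n → ℕ) (j : ℕ) : ℕ := if h : j < n then p ⟨j, h⟩ else 0

theorem natExt_apply (p : Fin n → ℕ) (j : Fin n) : natExt p j = p j := by
  simp [natExt]

theorem expo_eq (lam1 : ℚ) (p : Fin n → ℕ) (j : Fin (n + 1)) :
    expo lam1 p j = lam1 + expoShift (natExt p) j := by
  have h1 : ∀ i : Fin n, (if i.1 < j.1 then (p i : ℚ) - 1 else 0) =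
      (fun i : ℕ => if i < j.1 then (natExt p i : ℚ) - 1 else 0) i.1 := by
    intro i
    simp [natExt_apply]
  rw [expo, add_right_inj, Finset.sum_congr rfl fun i _ => h1 i,
    Fin.sum_univ_eq_sum_range (fun i : ℕ => if i < j.1 then (natExt p i : ℚ) - 1 else 0),
    ← Finset.sum_filter]
  have h2 : Finset.filter (fun i => i < j.1) (Finset.range n) = Finset.range j.1 := by
    ext i
    simp only [Finset.mem_filter, Finset.mem_range]
    omega
  rw [h2, Finset.sum_sub_distrib, expoShift, partialSum]
  simp

theorem pSum_eq (p : Fin n → ℕ) (i : Fin n) (h : ℕ) :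
    pSum p i h = partialSum (fun l => natExt p (i + l)) (h + 1) := by
  have h1 : ∀ l : Fin n, (if i.1 ≤ l.1 ∧ l.1 ≤ i.1 + h then p l else 0) =
      (fun l : ℕ => if i.1 ≤ l ∧ l ≤ i.1 + h then natExt p l else 0) l.1 := by
    intro l
    simp [natExt_apply]
  rw [pSum, Finset.sum_congr rfl fun l _ => h1 l,
    Fin.sum_univ_eq_sum_range (fun l : ℕ => if i.1 ≤ l ∧ l ≤ i.1 + h then natExt p l else 0),
    ← Finset.sum_filter, partialSum]
  have h3 : ∑ l ∈ Finset.range (h + 1), natExt p (i + l) =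
      ∑ l ∈ Finset.Ico i.1 (i.1 + (h + 1)), natExt p l := by
    rw [Finset.sum_Ico_eq_sum_range]
    simp
  rw [h3]
  refine Finset.sum_subset (fun l hl => ?_) (fun l hl hl' => ?_)
  · simp only [Finset.mem_filter, Finset.mem_range, Finset.mem_Ico] at hl ⊢
    omega
  · simp only [Finset.mem_filter, Finset.mem_range, Finset.mem_Ico] at hl hl'
    rw [natExt, dif_neg (by omega)]

/-- A sum of t terms starting at p_i corresponds to h = t - 1; the minimality of t among the sums
reaching n - i is that of h. -/
theorem mem_vExponents_of_isFreeExponent (p : Fin n → ℕ) (i : Fin n) {m : ℕ}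
    (hm : IsFreeExponent (fun l => natExt p (i + l)) (n - i) m) : m ∈ vExponents p i := by
  simp only [vExponents, Finset.mem_union, Finset.mem_range]
  by_cases hlt : m < n - i
  · exact Or.inl hlt
  right
  obtain h | ⟨t, h1, h2, h3, rfl⟩ := hm
  · exact absurd h hlt
  have hmono := partialSum_mono (fun l => natExt p (i + l))
  have hn : t ≤ n + 1 := by omega
  rw [if_neg (by rw [pSum_eq]; have := hmono hn; omega)]
  have hs : sInf {h : ℕ | n - i.1 ≤ pSum p i h} = t - 1 := by
    refine le_antisymm (Nat.sInf_le ?_) (le_csInf ⟨t - 1, ?_⟩ fun h hh => ?_)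
    · show n - i.1 ≤ pSum p i (t - 1)
      rw [pSum_eq, Nat.sub_add_cancel h1]; omega
    · show n - i.1 ≤ pSum p i (t - 1)
      rw [pSum_eq, Nat.sub_add_cancel h1]; omega
    · by_contra hlt'
      have hh' : n - i.1 ≤ pSum p i h := hh
      rw [pSum_eq] at hh'
      have := h3 (h + 1) (by omega)
      omega
  rw [hs, pSum_eq, Nat.sub_add_cancel h1]
  simp

/-- A chain of extensions can be reduced to the canonical form. -/
theorem exists_canonical_reduction {Y : Type u} {A : FunAlg Y} (lam1 : ℚ) (p : Fin n → ℕ)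
    {S : Fin n → Y → ℂ⟦X⟧}
    (hS : ∀ j, S j ∈ serRing A) (hS0 : ∀ j y, coeff 0 (S j y) = 1)
    (hSp : ∀ j y, coeff (p j) (S j y) ≠ 0) :
    ∃ (S' : Fin n → Y → ℂ⟦X⟧) (U : Fin (n + 1) → Fin (n + 1) → Y → ℂ⟦X⟧),
      (∀ j, S' j ∈ serRing A) ∧ (∀ j y, S' j y ∈ W p j) ∧
      (∀ i j, U i j ∈ serRing A) ∧ (∀ i y, U i i y = 1) ∧ (∀ i j y, j < i → U i j y = 0) ∧
      ∀ (i : Fin (n + 1)) (j : Fin n) (y : Y),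
        eul (expo lam1 p i - expo lam1 p j.succ : ℚ) (U i j.succ y) +
          (if h : i.1 < n then S ⟨i, h⟩ y * U ⟨i + 1, by omega⟩ j.succ y else 0) =
          S' j y * U i j.castSucc y := by
  have hSx : ∀ j : ℕ, (if h : j < n then S ⟨j, h⟩ else 0) ∈ serRing A := by
    intro j
    split_ifs
    exacts [hS _, zero_mem _]
  obtain ⟨S', U, h1, h2, h3, h4, h5, h6⟩ := exists_reduction n (natExt p) hSx
    (fun j hj y => by rw [dif_pos hj]; exact hS0 _ y)
    (fun j hj y => by rw [dif_pos hj, natExt, dif_pos hj]; exact hSp _ y)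
  refine ⟨fun j => S' j, fun i j => U i j, fun j => h1 _, fun j y => ⟨?_, ?_, ?_⟩,
    fun i j => h2 _ _, fun i => h3 _, fun i j y h => h4 _ _ _ h, fun i j y => ?_⟩
  · rw [mem_V_iff]
    intro m hm
    exact (h6 j j.2 y).2.2 m fun h => hm (mem_vExponents_of_isFreeExponent p j h)
  · exact (h6 j j.2 y).1
  · have := (h6 j j.2 y).2.1
    rwa [natExt_apply] at this
  · have hj := j.2
    rw [expo_eq, expo_eq, add_sub_add_left_eq_sub]
    by_cases hij : i.1 ≤ j.1
    · have h := h5 i.1 j.1 hij hj y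
      rw [dif_pos (by omega)] at h
      rw [dif_pos (by omega)]
      exact h
    -- Below the diagonal all terms contain a zero entry, except possibly the image of U_ii = 1,
    -- which vanishes because its exponent difference is 0.
    · simp only [Fin.val_castSucc, Fin.val_succ]
      rw [h4 i.1 j.1 y (by omega), mul_zero]
      have h7 : eul ((expoShift (natExt p) i - expoShift (natExt p) (j + 1) : ℚ) : ℂ)
          (U i (j + 1) y) = 0 := by
        rcases Nat.lt_or_ge (j.1 + 1) i.1 with h | h
        · rw [h4 _ _ _ h, eul_zero]
        · have : i.1 = j.1 + 1 := by omega
          rw [this, h3, sub_self, Rat.cast_zero]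
          simp [eul]
      rw [h7, zero_add]
      split_ifs
      · rw [h4 _ _ _ (show j.1 + 1 < i.1 + 1 by omega), mul_zero]
      · rfl

end FinIndexed

/-! ### Stable submodules and flags -/

section Flags

theorem ABMod.genSubmodule_le {M : ABMod.{v}} {P : Submodule ℂ⟦X⟧ M} (hP : ∀ x ∈ P, M.a x ∈ P)
    {m : M} (hm : m ∈ P) : M.genSubmodule m ≤ P := by
  refine Submodule.span_le.2 ?_
  rintro _ ⟨ν, rfl⟩
  induction ν with
  | zero => exact hm
  | succ ν ih =>
    simp only [Function.iterate_succ_apply']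
    exact hP _ ih

theorem ABMod.mem_genSubmodule_self {M : ABMod.{v}} (m : M) : m ∈ M.genSubmodule m :=
  Submodule.subset_span ⟨0, rfl⟩

theorem ABMod.a_mem_sup_span {M : ABMod.{v}} {P : Submodule ℂ⟦X⟧ M} (hP : ∀ x ∈ P, M.a x ∈ P)
    {m : M} (hm : M.a m ∈ P ⊔ Submodule.span ℂ⟦X⟧ {m}) :
    ∀ x ∈ P ⊔ Submodule.span ℂ⟦X⟧ {m}, M.a x ∈ P ⊔ Submodule.span ℂ⟦X⟧ {m} := by
  intro x hx
  obtain ⟨y, hy, z, hz, rfl⟩ := Submodule.mem_sup.1 hx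
  obtain ⟨f, rfl⟩ := Submodule.mem_span_singleton.1 hz
  rw [map_add, M.a_smul]
  refine add_mem (Submodule.mem_sup_left (hP y hy)) (add_mem (Submodule.smul_mem _ _ hm)
    (Submodule.smul_mem _ _ (Submodule.mem_sup_right (Submodule.mem_span_singleton_self m))))

theorem ABMod.genSubmodule_smul {M : ABMod.{v}} {f : ℂ⟦X⟧} (hf : coeff 0 f ≠ 0) (m : M) :
    M.genSubmodule (f • m) = M.genSubmodule m := by
  refine le_antisymm (genSubmodule_le (fun x => M.a_mem_genSubmodule m)
    (Submodule.smul_mem _ _ (mem_genSubmodule_self m)))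
    (genSubmodule_le (fun x => M.a_mem_genSubmodule _) ?_)
  have h : m = f⁻¹ • f • m := by
    rw [smul_smul, PowerSeries.inv_mul_cancel _ (by simpa using hf), one_smul]
  have h2 := Submodule.smul_mem (M.genSubmodule (f • m)) f⁻¹ (mem_genSubmodule_self (f • m))
  rwa [← h] at h2

variable {n : ℕ}

/-- A flag of stable submodules whose successive quotients are the modules `E_{λ_j}`. -/
structure IsFlag (lam1 : ℚ) (p : Fin n → ℕ) (M : ABMod.{v})
    (F : Fin (n + 2) → Submodule ℂ⟦X⟧ M) : Prop where
  zero : F 0 = ⊥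
  stable : ∀ j, ∀ x ∈ F j, M.a x ∈ F j
  step : ∀ j : Fin (n + 1), ∃ e : M,
      F j.succ = F j.castSucc ⊔ Submodule.span ℂ⟦X⟧ {e} ∧
      (∀ f : ℂ⟦X⟧, f • e ∈ F j.castSucc → f = 0) ∧
      M.a e - (C (expo lam1 p j : ℂ) * X) • e ∈ F j.castSucc

theorem IsFlag.map {lam1 : ℚ} {p : Fin n → ℕ} {M : ABMod.{v}} {M' : ABMod.{z}}
    {F : Fin (n + 2) → Submodule ℂ⟦X⟧ M} (hF : IsFlag lam1 p M F) (g : M →ₗ[ℂ⟦X⟧] M')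
    (hg : Function.Injective g) (hga : ∀ m, g (M.a m) = M'.a (g m)) :
    IsFlag lam1 p M' fun j => (F j).map g where
  zero := by rw [hF.zero, Submodule.map_bot]
  stable := by
    rintro j _ ⟨x, hx, rfl⟩
    exact ⟨_, hF.stable j x hx, hga x⟩
  step j := by
    obtain ⟨e, h1, h2, h3⟩ := hF.step j
    refine ⟨g e, ?_, fun f hf => ?_, ?_⟩
    · rw [h1, Submodule.map_sup, Submodule.map_span, Set.image_singleton]
    · rw [← map_smul] at hf
      obtain ⟨x, hx, hxe⟩ := hf
      exact h2 f (hg hxe ▸ hx)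
    · rw [← hga, ← map_smul, ← map_sub]
      exact ⟨_, h3, rfl⟩

/-- Composition of a theme with the inclusion of a generated submodule. -/
theorem IsThemeWithInvariants.exists_flag {lam1 : ℚ} {p : Fin n → ℕ} {E : ABMod.{v}}
    (hE : IsThemeWithInvariants lam1 p E) {M : ABMod.{z}} {φ : M}
    (i : E.Iso (M.generated φ)) :
    ∃ F, IsFlag lam1 p M F ∧ F (Fin.last (n + 1)) = M.genSubmodule φ := by
  obtain ⟨-, F, h0, h1, h2, h3⟩ := hE
  refine ⟨_, (IsFlag.mk h0 h2 h3 : IsFlag lam1 p E F).map (M.incl φ ∘ₗ i.toEquiv.toLinearMap)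
    ((M.incl_injective φ).comp i.toEquiv.injective) (fun m => ?_), ?_⟩
  · exact congrArg (M.incl φ) (i.map_a m)
  · rw [h1, Submodule.map_top, LinearMap.range_comp, LinearEquiv.range, Submodule.map_top]
    exact Submodule.range_subtype _

end Flags

/-! ### Coordinates in `Ξ_Λ^{(N)}` -/

section Coordinates

variable {Λ : Finset ℚ} {N : ℕ}

/-- The coordinate of index `(l, i)`, zero for `N < i`. -/
def xiCoord (l : Λ) (i : ℕ) : Xi Λ N →ₗ[ℂ⟦X⟧] ℂ⟦X⟧ where
  toFun ψ := if h : i < N + 1 then (ψ : Λ × Fin (N + 1) → ℂ⟦X⟧) (l, ⟨i, h⟩) else 0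
  map_add' ψ χ := by
    split_ifs
    exacts [rfl, (add_zero 0).symm]
  map_smul' f ψ := by
    split_ifs
    exacts [rfl, (smul_zero f).symm]

theorem xiCoord_apply (l : Λ) (i : Fin (N + 1)) (ψ : Xi Λ N) :
    xiCoord l i ψ = (ψ : Λ × Fin (N + 1) → ℂ⟦X⟧) (l, i) := dif_pos i.2

theorem xiCoord_of_lt (l : Λ) {i : ℕ} (h : N < i) (ψ : Xi Λ N) : xiCoord l i ψ = 0 :=
  dif_neg (by omega)

theorem xi_ext {ψ χ : Xi Λ N} (h : ∀ l i, xiCoord l i ψ = xiCoord l i χ) : ψ = χ := by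
  have : (ψ : Λ × Fin (N + 1) → ℂ⟦X⟧) = χ := by
    funext i
    rw [← xiCoord_apply i.1 i.2 ψ, ← xiCoord_apply i.1 i.2 χ, h]
  exact this

theorem xiCoord_a (l : Λ) (i : ℕ) (ψ : Xi Λ N) :
    xiCoord l i ((Xi Λ N).a ψ) = eul (l.1 : ℂ) (xiCoord l i ψ) + X * xiCoord l (i + 1) ψ := by
  by_cases hi : i < N + 1
  · rw [xiCoord_apply l ⟨i, hi⟩, xiCoord_apply l ⟨i, hi⟩]
    have : ((Xi Λ N).a ψ : Λ × Fin (N + 1) → ℂ⟦X⟧) (l, ⟨i, hi⟩) =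
        eul (l.1 : ℂ) ((ψ : Λ × Fin (N + 1) → ℂ⟦X⟧) (l, ⟨i, hi⟩)) +
        if h : i + 1 < N + 1 then X * (ψ : Λ × Fin (N + 1) → ℂ⟦X⟧) (l, ⟨i + 1, h⟩) else 0 := rfl
    rw [this]
    split_ifs with h
    · rw [xiCoord_apply l ⟨i + 1, h⟩]
    · rw [xiCoord_of_lt l (by omega), mul_zero]
  · rw [xiCoord_of_lt l (by omega), xiCoord_of_lt l (by omega), xiCoord_of_lt l (by omega),
      eul_zero, mul_zero, add_zero]

/-- For each l, an equation (a - μb)ψ = g becomes a list of scalar equations, where index i is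
linked only to index i + 1. -/
theorem xiCoord_sub (l : Λ) (i : ℕ) (ψ : Xi Λ N) (μ : ℚ) :
    xiCoord l i ((Xi Λ N).a ψ - (C (μ : ℂ) * X) • ψ) =
      eul (l.1 - μ : ℚ) (xiCoord l i ψ) + X * xiCoord l (i + 1) ψ := by
  rw [map_sub, xiCoord_a, map_smul, smul_eq_mul]
  simp only [eul]
  push_cast
  rw [map_sub]
  ring

/-- The elements with coordinates vanishing except those of index `(l, i)` with `l` in a given
set and `i < j`. -/
def xiSub (N : ℕ) (G : Set Λ) (j : ℕ) : Submodule ℂ⟦X⟧ (Xi Λ N) where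
  carrier := {ψ | ∀ l i, (l ∈ G → j ≤ i) → xiCoord l i ψ = 0}
  add_mem' hx hy l i h := by rw [map_add, hx l i h, hy l i h, add_zero]
  zero_mem' l i _ := map_zero _
  smul_mem' f x hx l i h := by rw [map_smul, hx l i h, smul_zero]

theorem coeff_eq_zero_of_eul_eq_zero {c : ℂ} {z : ℂ⟦X⟧} (h : eul c z = 0) {m : ℕ}
    (hm : (m : ℂ) + c ≠ 0) : coeff m z = 0 := by
  have := (eul_eq_iff.1 h).2 m
  rw [map_zero] at this
  exact (mul_eq_zero.1 this).resolve_left hm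

/-- At most one degree can resonate, so the kernel is at most a line, spanned by a monomial. -/
theorem eq_C_mul_X_pow_of_eul_eq_zero {c : ℂ} {z : ℂ⟦X⟧} (h : eul c z = 0) (hz : z ≠ 0) :
    ∃ (m : ℕ) (γ : ℂ), γ ≠ 0 ∧ (m : ℂ) + c = 0 ∧ z = C γ * X ^ m := by
  obtain ⟨m, hm⟩ : ∃ m, coeff m z ≠ 0 := by
    by_contra! h'
    exact hz (ext fun m => by simpa using h' m)
  have hmc : (m : ℂ) + c = 0 := by
    by_contra h'
    exact hm (coeff_eq_zero_of_eul_eq_zero h h')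
  refine ⟨m, coeff m z, hm, hmc, ext fun k => ?_⟩
  rw [coeff_C_mul, coeff_X_pow]
  split_ifs with hk
  · rw [hk, mul_one]
  · rw [mul_zero]
    refine coeff_eq_zero_of_eul_eq_zero h fun hkc => hk ?_
    have := hkc.trans hmc.symm
    exact_mod_cast add_right_cancel this

/-- Descending induction. Once the following term is zero, x_{i+1} lies in the kernel and has at
most one non-zero coefficient, in the resonant degree m. The equation of index i in degree m + 1
kills it, since the image of x_i has no component there. -/
theorem vanish_of_eul_add {c : ℂ} {x : ℕ → ℂ⟦X⟧} {J j : ℕ} (hx : ∀ i, J < i → x i = 0)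
    (h : ∀ i, j ≤ i → eul c (x i) + X * x (i + 1) = 0) : ∀ i, j < i → x i = 0 := by
  suffices h' : ∀ d i, J + 1 ≤ i + d → j < i → x i = 0 from
    fun i hi => h' (J + 1) i (by omega) hi
  intro d
  induction d with
  | zero => exact fun i hi _ => hx i (by omega)
  | succ d ih =>
    intro i hi hj
    obtain ⟨i, rfl⟩ : ∃ i', i = i' + 1 := ⟨i - 1, by omega⟩
    have h1 := h (i + 1) (by omega)
    rw [ih (i + 1 + 1) (by omega) (by omega), mul_zero, add_zero] at h1
    have h2 : eul c (x i) = - (X * x (i + 1)) := eq_neg_of_add_eq_zero_left (h i (by omega))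
    ext m
    by_cases hm : (m : ℂ) + c = 0
    · have := (eul_eq_iff.1 h2).2 m
      rw [hm, zero_mul, map_neg, coeff_succ_X_mul] at this
      simpa using this.symm
    · simpa using coeff_eq_zero_of_eul_eq_zero h1 hm

/-- The elements of `Λ` congruent to `λ_1` modulo `ℤ`. -/
def congrSet (Λ : Finset ℚ) (lam1 : ℚ) : Set Λ := {l | ∃ s : ℤ, lam1 = l.1 + s}

/-- The interval ]0,1] contains exactly one representative of each class modulo ℤ. -/
theorem congrSet_subsingleton (hΛ : ∀ l ∈ Λ, 0 < l ∧ l ≤ 1) (lam1 : ℚ) :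
    (congrSet Λ lam1).Subsingleton := by
  rintro ⟨l, hl⟩ ⟨s, hs⟩ ⟨l', hl'⟩ ⟨s', hs'⟩
  obtain ⟨h1, h2⟩ := hΛ l hl
  obtain ⟨h1', h2'⟩ := hΛ l' hl'
  dsimp only at hs hs'
  have h3 : (s : ℚ) < s' + 1 := by linarith
  have h4 : (s' : ℚ) < s + 1 := by linarith
  have h5 : s = s' := by
    have h3' : s < s' + 1 := by exact_mod_cast h3
    have h4' : s' < s + 1 := by exact_mod_cast h4
    omega
  subst h5
  exact Subtype.ext (by dsimp only; linarith)

/-- For l not congruent to λ_1 nothing resonates and all coordinates vanish; for the congruent one,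
`vanish_of_eul_add` lets the index grow by at most one. -/
theorem xi_kernel {lam1 μ : ℚ} (hμ : ∃ s : ℤ, μ = lam1 + s) {j : ℕ} {ψ : Xi Λ N}
    (h : (Xi Λ N).a ψ - (C (μ : ℂ) * X) • ψ ∈ xiSub N (congrSet Λ lam1) j) :
    ψ ∈ xiSub N (congrSet Λ lam1) (j + 1) ∧
      ∀ l, eul (l.1 - μ : ℚ) (xiCoord l j ψ) = 0 := by
  have hbad : ∀ l i, l ∉ congrSet Λ lam1 → xiCoord l i ψ = 0 := by
    intro l i hl
    have h1 : ∀ i, eul (l.1 - μ : ℚ) (xiCoord l i ψ) + X * xiCoord l (i + 1) ψ = 0 :=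
      fun i => by rw [← xiCoord_sub]; exact h l i fun h => absurd h hl
    have h2 := vanish_of_eul_add (x := fun i => xiCoord l i ψ) (J := N) (j := 0)
      (fun i hi => xiCoord_of_lt l hi ψ) (fun i _ => h1 i)
    cases i with
    | succ i => exact h2 _ (by omega)
    | zero =>
      have h3 := h1 0
      rw [h2 1 (by omega), mul_zero, add_zero] at h3
      ext m
      rw [map_zero]
      refine coeff_eq_zero_of_eul_eq_zero h3 fun hm => hl ?_
      obtain ⟨s, hs⟩ := hμ
      refine ⟨m - s, ?_⟩
      have : (m : ℚ) + (l.1 - μ) = 0 := by exact_mod_cast hm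
      push_cast
      linarith
  have hgood : ∀ l i, j < i → xiCoord l i ψ = 0 := by
    intro l
    by_cases hl : l ∈ congrSet Λ lam1
    · refine vanish_of_eul_add (c := (l.1 - μ : ℚ)) (x := fun i => xiCoord l i ψ) (J := N)
        (fun i hi => xiCoord_of_lt l hi ψ) (fun i hi => ?_)
      rw [← xiCoord_sub]
      exact h l i fun _ => hi
    · exact fun i _ => hbad l i hl
  refine ⟨fun l i hi => ?_, fun l => ?_⟩
  · by_cases hl : l ∈ congrSet Λ lam1
    · exact hgood l i (hi hl)
    · exact hbad l i hl
  · have h1 := h l j fun _ => le_rfl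
    rwa [xiCoord_sub, hgood l _ (Nat.lt_succ_self j), mul_zero, add_zero] at h1

end Coordinates

/-! ### Flags in `Ξ_Λ^{(N)}` -/

section XiFlags

variable {Λ : Finset ℚ} {N n : ℕ} {lam1 : ℚ} {p : Fin n → ℕ}
  {F : Fin (n + 2) → Submodule ℂ⟦X⟧ (Xi Λ N)}

theorem expo_congr (lam1 : ℚ) (p : Fin n → ℕ) (j : Fin (n + 1)) :
    ∃ s : ℤ, expo lam1 p j = lam1 + s := by
  refine ⟨partialSum (natExt p) j - j, ?_⟩
  rw [expo_eq, expoShift]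
  push_cast
  rfl

/-- Each quotient of rank one brings in at most one further index, by `xi_kernel`. -/
theorem IsFlag.le_xiSub (hF : IsFlag lam1 p (Xi Λ N) F) :
    ∀ j : Fin (n + 2), F j ≤ xiSub N (congrSet Λ lam1) j := by
  intro j
  induction j using Fin.induction with
  | zero => rw [hF.zero]; exact bot_le
  | succ j ih =>
    obtain ⟨e, h1, -, h3⟩ := hF.step j
    rw [h1]
    refine sup_le (ih.trans fun ψ hψ l i hi => hψ l i fun hl => ?_) ?_
    · have := hi hl
      simp only [Fin.val_succ, Fin.val_castSucc] at this ⊢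
      omega
    · rw [Submodule.span_singleton_le_iff_mem]
      exact (xi_kernel (expo_congr lam1 p j) (ih h3)).1

/-- Otherwise the first step of the flag would be generated by 0. -/
theorem IsFlag.congrSet_nonempty (hF : IsFlag lam1 p (Xi Λ N) F) : (congrSet Λ lam1).Nonempty := by
  by_contra h
  rw [Set.not_nonempty_iff_eq_empty] at h
  obtain ⟨e, h1, h2, -⟩ := hF.step 0
  have he : e ∈ F (Fin.succ 0) := by
    rw [h1]
    exact Submodule.mem_sup_right (Submodule.mem_span_singleton_self e)
  have he0 : e = 0 := xi_ext fun l i => by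
    rw [map_zero]
    exact hF.le_xiSub _ he l i fun hl => by rw [h] at hl; exact absurd hl (Set.notMem_empty l)
  exact one_ne_zero (h2 1 (by rw [he0, smul_zero]; exact zero_mem _))

/-- The leading coordinates of a flag. -/
theorem IsFlag.exists_lead (hF : IsFlag lam1 p (Xi Λ N) F) {l : Λ} (hl : congrSet Λ lam1 = {l})
    (j : Fin (n + 1)) : ∃ (e : Xi Λ N) (m : ℕ) (γ : ℂ), γ ≠ 0 ∧ expo lam1 p j = l.1 + m ∧
      F j.succ = F j.castSucc ⊔ Submodule.span ℂ⟦X⟧ {e} ∧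
      (∀ f : ℂ⟦X⟧, f • e ∈ F j.castSucc → f = 0) ∧
      (Xi Λ N).a e - (C (expo lam1 p j : ℂ) * X) • e ∈ F j.castSucc ∧
      xiCoord l j e = C γ * X ^ m := by
  -- `lead` and `key` feed each other along the flag. If F_j contains b^k times everything with
  -- indices below j, the coordinate of index j of the generator e cannot vanish: otherwise b^k e
  -- would be in F_j, against the freeness of the quotient. It is then a kernel monomial, and
  -- dividing by it yields the same containment for F_{j+1}.
  have lead : ∀ j : Fin (n + 1), (∃ k : ℕ, ∀ ψ ∈ xiSub N (congrSet Λ lam1) j.castSucc,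
      (X : ℂ⟦X⟧) ^ k • ψ ∈ F j.castSucc) → ∃ (e : Xi Λ N) (m : ℕ) (γ : ℂ), γ ≠ 0 ∧
      expo lam1 p j = l.1 + m ∧
      F j.succ = F j.castSucc ⊔ Submodule.span ℂ⟦X⟧ {e} ∧
      (∀ f : ℂ⟦X⟧, f • e ∈ F j.castSucc → f = 0) ∧
      (Xi Λ N).a e - (C (expo lam1 p j : ℂ) * X) • e ∈ F j.castSucc ∧
      xiCoord l j e = C γ * X ^ m := by
    rintro j ⟨k, hk⟩
    obtain ⟨e, h1, h2, h3⟩ := hF.step j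
    obtain ⟨he1, he2⟩ := xi_kernel (expo_congr lam1 p j) (hF.le_xiSub _ h3)
    have hne : xiCoord l j e ≠ 0 := by
      intro h0
      refine pow_ne_zero k X_ne_zero (h2 _ (hk e fun l' i hi => ?_))
      by_cases hij : i = j
      · subst hij
        by_cases hl' : l' ∈ congrSet Λ lam1
        · have : l' = l := by rw [hl] at hl'; exact hl'
          rw [this, h0]
        · exact he1 l' j fun h => absurd h hl'
      · refine he1 l' i fun h => ?_
        have := hi h
        simp only [Fin.val_castSucc] at this ⊢
        omega
    obtain ⟨m, γ, hγ, hm, he⟩ := eq_C_mul_X_pow_of_eul_eq_zero (he2 l) hne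
    refine ⟨e, m, γ, hγ, ?_, h1, h2, h3, he⟩
    have : (m : ℚ) + (l.1 - expo lam1 p j) = 0 := by exact_mod_cast hm
    linarith
  have key : ∀ j : Fin (n + 2), ∃ k : ℕ, ∀ ψ ∈ xiSub N (congrSet Λ lam1) j,
      (X : ℂ⟦X⟧) ^ k • ψ ∈ F j := by
    intro j
    induction j using Fin.induction with
    | zero =>
      refine ⟨0, fun ψ hψ => ?_⟩
      have : ψ = 0 := xi_ext fun l i => by
        rw [map_zero]; exact hψ l i fun _ => Nat.zero_le _
      rw [this, smul_zero]
      exact zero_mem _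
    | succ j ih =>
      obtain ⟨e, m, γ, hγ, -, h1, h2, h3, he⟩ := lead j ih
      obtain ⟨k, hk⟩ := ih
      have heF : e ∈ F j.succ := by
        rw [h1]
        exact Submodule.mem_sup_right (Submodule.mem_span_singleton_self e)
      refine ⟨k + m, fun ψ hψ => ?_⟩
      -- The multiple of e is chosen to have the same coordinate of index j as b^m ψ, so that the
      -- difference belongs to the previous stage.
      have hχ : (X : ℂ⟦X⟧) ^ m • ψ - (C γ⁻¹ * xiCoord l j ψ) • e ∈
          xiSub N (congrSet Λ lam1) j.castSucc := by
        intro l' i hi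
        rw [map_sub, map_smul, map_smul, smul_eq_mul, smul_eq_mul]
        have hgt : (l' ∈ congrSet Λ lam1 → j.1 + 1 ≤ i) → X ^ m * xiCoord l' i ψ -
            C γ⁻¹ * xiCoord l j ψ * xiCoord l' i e = 0 := by
          intro h
          rw [hψ l' i h, hF.le_xiSub _ heF l' i h, mul_zero, mul_zero, sub_zero]
        by_cases hij : i = j
        · subst hij
          by_cases hl' : l' ∈ congrSet Λ lam1
          · have : l' = l := by rw [hl] at hl'; exact hl'
            rw [this, he]
            have hc : (C γ⁻¹ : ℂ⟦X⟧) * C γ = 1 := by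
              rw [← map_mul, inv_mul_cancel₀ hγ, map_one]
            linear_combination (-(X ^ m * xiCoord l j ψ)) * hc
          · exact hgt fun h => absurd h hl'
        · refine hgt fun h => ?_
          have := hi h
          simp only [Fin.val_castSucc] at this
          omega
      have h4 : (X : ℂ⟦X⟧) ^ (k + m) • ψ =
          (X : ℂ⟦X⟧) ^ k • ((X : ℂ⟦X⟧) ^ m • ψ - (C γ⁻¹ * xiCoord l j ψ) • e) +
          (X ^ k * (C γ⁻¹ * xiCoord l j ψ)) • e := by
        rw [smul_sub, smul_smul, smul_smul, pow_add, sub_add_cancel]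
      rw [h4]
      refine add_mem ?_ (Submodule.smul_mem _ _ heF)
      rw [h1]
      exact Submodule.mem_sup_left (hk _ hχ)
  exact lead j (key _)

theorem IsFlag.exists_expo (hF : IsFlag lam1 p (Xi Λ N) F) {l : Λ} (hl : congrSet Λ lam1 = {l})
    (j : Fin (n + 1)) : ∃ m : ℕ, expo lam1 p j = l.1 + m := by
  obtain ⟨-, m, -, -, h, -⟩ := hF.exists_lead hl j
  exact ⟨m, h⟩

/-- The leading coordinate of a generator of a term of a flag. -/
theorem IsFlag.lead_of_generator (hF : IsFlag lam1 p (Xi Λ N) F) {l : Λ}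
    (hl : congrSet Λ lam1 = {l}) {j : Fin (n + 1)} {m : ℕ} (hm : expo lam1 p j = l.1 + m)
    {φ : Xi Λ N} (hφ : (Xi Λ N).genSubmodule φ = F j.succ) :
    ∃ κ : ℂ⟦X⟧, coeff 0 κ ≠ 0 ∧ xiCoord l j φ = X ^ m * κ := by
  obtain ⟨e, m', γ, hγ, hm', h1, h2, h3, he⟩ := hF.exists_lead hl j
  obtain rfl : m' = m := by
    have : (m' : ℚ) = m := by linarith
    exact_mod_cast this
  have hφF : φ ∈ F j.castSucc ⊔ Submodule.span ℂ⟦X⟧ {e} := by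
    rw [← h1, ← hφ]
    exact ABMod.mem_genSubmodule_self φ
  have heF : e ∈ F j.succ := by
    rw [h1]
    exact Submodule.mem_sup_right (Submodule.mem_span_singleton_self e)
  obtain ⟨f, hf, x, hx, rfl⟩ := Submodule.mem_sup.1 hφF
  obtain ⟨u, rfl⟩ := Submodule.mem_span_singleton.1 hx
  refine ⟨u * C γ, ?_, ?_⟩
  · intro h0
    have hu : X ∣ u := by
      rw [X_dvd_iff]
      simpa [hγ] using h0
    obtain ⟨v, rfl⟩ := hu
    -- If u were divisible by b, φ would lie in F_j + ℂ[[b]] b e. This submodule is stable under a,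
    -- so it would contain all that φ generates, in particular e; then e is a multiple of b e modulo
    -- F_j, which is absurd.
    have hst := ABMod.a_mem_sup_span (m := (X : ℂ⟦X⟧) • e) (hF.stable j.castSucc) (by
      rw [ABMod.a_smul]
      have h4 : (X : ℂ⟦X⟧) • (Xi Λ N).a e + (X ^ 2 * derivative ℂ (X : ℂ⟦X⟧)) • e =
          (X : ℂ⟦X⟧) • ((Xi Λ N).a e - (C (expo lam1 p j : ℂ) * X) • e) +
          (C (expo lam1 p j : ℂ) * X + X) • ((X : ℂ⟦X⟧) • e) := by
        rw [derivative_X, smul_sub, smul_smul, smul_smul, sub_add_eq_add_sub, add_sub_assoc,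
          ← sub_smul]
        congr 2
        ring
      rw [h4]
      exact add_mem (Submodule.mem_sup_left (Submodule.smul_mem _ _ h3))
        (Submodule.smul_mem _ _ (Submodule.mem_sup_right (Submodule.mem_span_singleton_self _))))
    have h5 : f + (X * v) • e ∈ F j.castSucc ⊔ Submodule.span ℂ⟦X⟧ {(X : ℂ⟦X⟧) • e} := by
      refine add_mem (Submodule.mem_sup_left hf) (Submodule.mem_sup_right ?_)
      rw [mul_comm, mul_smul]
      exact Submodule.smul_mem _ _ (Submodule.mem_span_singleton_self _)
    have h6 := ABMod.genSubmodule_le hst h5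
    rw [hφ] at h6
    obtain ⟨g, hg, x, hx, hgx⟩ := Submodule.mem_sup.1 (h6 heF)
    obtain ⟨r, rfl⟩ := Submodule.mem_span_singleton.1 hx
    have h7 : (1 - r * X) • e = g := by
      rw [sub_smul, one_smul, mul_smul, sub_eq_iff_eq_add]
      exact hgx.symm
    have h8 := h2 _ (h7 ▸ hg)
    have := congrArg (coeff 0) h8
    simp at this
  · rw [map_add, map_smul, hF.le_xiSub _ hf l j fun _ => le_rfl, he, zero_add, smul_eq_mul]
    ring

/-- The next generator of a flag. -/
theorem IsFlag.generator_of_generator (hF : IsFlag lam1 p (Xi Λ N) F) {l : Λ}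
    (hl : congrSet Λ lam1 = {l}) {j : Fin (n + 1)} {m : ℕ} (hm : expo lam1 p j = l.1 + m)
    {φ : Xi Λ N} (hφ : (Xi Λ N).genSubmodule φ = F j.succ) {γ : ℂ} (hγ : γ ≠ 0)
    (hφl : xiCoord l j φ = C γ * X ^ m) :
    (Xi Λ N).genSubmodule ((Xi Λ N).a φ - (C (expo lam1 p j : ℂ) * X) • φ) = F j.castSucc := by
  obtain ⟨e, m', γ', hγ', hm', h1, h2, h3, he⟩ := hF.exists_lead hl j
  obtain rfl : m' = m := by
    have : (m' : ℚ) = m := by linarith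
    exact_mod_cast this
  have hne : ∀ c : ℂ, c ≠ 0 → C c * (X : ℂ⟦X⟧) ^ m' ≠ 0 := fun c hc =>
    mul_ne_zero (by simpa using hc) (pow_ne_zero _ X_ne_zero)
  have hφF : φ ∈ F j.succ := by
    rw [← hφ]
    exact ABMod.mem_genSubmodule_self φ
  set ψ := (Xi Λ N).a φ - (C (expo lam1 p j : ℂ) * X) • φ with hψ
  have hψF : ψ ∈ F j.succ := sub_mem (hF.stable _ _ hφF) (Submodule.smul_mem _ _ hφF)
  -- The leading coordinate of φ is a monomial of resonant degree, hence is killed by a - λb.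
  have hψl : xiCoord l j ψ = 0 := by
    rw [hψ, xiCoord_sub, hφl, hF.le_xiSub _ hφF l (j + 1) (fun _ => le_rfl), mul_zero, add_zero,
      eul_eq_iff]
    refine ⟨by simp, fun k => ?_⟩
    rw [map_zero, coeff_C_mul, coeff_X_pow]
    split_ifs with hk
    · rw [hk, hm]; push_cast; ring
    · simp
  have hψF' : ψ ∈ F j.castSucc := by
    rw [h1] at hψF
    obtain ⟨f, hf, x, hx, hfx⟩ := Submodule.mem_sup.1 hψF
    obtain ⟨u, rfl⟩ := Submodule.mem_span_singleton.1 hx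
    rw [← hfx, map_add, map_smul, hF.le_xiSub _ hf l j fun _ => le_rfl, he, zero_add,
      smul_eq_mul] at hψl
    rw [(mul_eq_zero.1 hψl).resolve_right (hne _ hγ'), zero_smul, add_zero] at hfx
    rwa [← hfx]
  refine le_antisymm (ABMod.genSubmodule_le (hF.stable _) hψF') fun x hx => ?_
  -- The submodule generated by ψ, increased by ℂ[[b]]φ, is stable and contains φ, hence F_j. For an
  -- element of F_j, the leading coordinate shows that its multiple of φ is zero.
  have hst := ABMod.a_mem_sup_span (m := φ) (fun x => (Xi Λ N).a_mem_genSubmodule ψ (x := x)) (by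
    have : (Xi Λ N).a φ = ψ + (C (expo lam1 p j : ℂ) * X) • φ := by rw [hψ, sub_add_cancel]
    rw [this]
    exact add_mem (Submodule.mem_sup_left (ABMod.mem_genSubmodule_self ψ))
      (Submodule.smul_mem _ _ (Submodule.mem_sup_right (Submodule.mem_span_singleton_self φ))))
  have hle := ABMod.genSubmodule_le hst
    (Submodule.mem_sup_right (Submodule.mem_span_singleton_self φ))
  have hxs : x ∈ F j.succ := by
    rw [h1]
    exact Submodule.mem_sup_left hx
  rw [← hφ] at hxs
  obtain ⟨g, hg, y, hy, rfl⟩ := Submodule.mem_sup.1 (hle hxs)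
  obtain ⟨r, rfl⟩ := Submodule.mem_span_singleton.1 hy
  have hgF := ABMod.genSubmodule_le (hF.stable _) hψF' hg
  have hr := hF.le_xiSub _ ((Submodule.add_mem_iff_right _ hgF).1 hx) l j fun _ => le_rfl
  rw [map_smul, hφl, smul_eq_mul] at hr
  rw [(mul_eq_zero.1 hr).resolve_right (hne _ hγ), zero_smul, add_zero]
  exact hg

end XiFlags

/-! ### Chains of extensions -/

section IsChain

variable {n : ℕ}

/-- The relations `(a - λ_1 b) w_1 = 0` and `(a - λ_{j+1} b) w_{j+1} = S_j w_j`. -/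
structure IsChain (lam1 : ℚ) (p : Fin n → ℕ) (S : Fin n → ℂ⟦X⟧) (M : ABMod.{v})
    (w : Fin (n + 1) → M) : Prop where
  zero : M.a (w 0) = (C (expo lam1 p 0 : ℂ) * X) • w 0
  succ : ∀ j : Fin n, M.a (w j.succ) =
    (C (expo lam1 p j.succ : ℂ) * X) • w j.succ + S j • w j.castSucc

variable {lam1 : ℚ} {p : Fin n → ℕ} {M : ABMod.{v}} {Y : Type u} {A : FunAlg Y}

/-- The families of elements spanned by the first `t` iterates of `a`. -/
def iterSpan (A : FunAlg Y) (φ : Y → M) (t : ℕ) : Submodule (serRing A) (Y → M) :=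
  Submodule.span (serRing A) ((fun (ν : ℕ) y => M.a^[ν] (φ y)) '' Set.Iio t)

theorem serRing_smul_apply (c : serRing A) (s : Y → M) (y : Y) : (c • s) y = c.1 y • s y := rfl

theorem smul_mem_of_mem_serRing {P : Submodule (serRing A) (Y → M)} {c : Y → ℂ⟦X⟧}
    (hc : c ∈ serRing A) {s : Y → M} (hs : s ∈ P) : (fun y => c y • s y) ∈ P :=
  P.smul_mem ⟨c, hc⟩ hs

/-- The operator `a` on the families spanned by given ones. -/
theorem a_mem_of_mem_span {P : Submodule (serRing A) (Y → M)} {G : Set (Y → M)}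
    (hG : ∀ g ∈ G, g ∈ P) (hGa : ∀ g ∈ G, (fun y => M.a (g y)) ∈ P) {s : Y → M}
    (hs : s ∈ Submodule.span (serRing A) G) : (fun y => M.a (s y)) ∈ P := by
  induction hs using Submodule.span_induction with
  | mem x hx => exact hGa x hx
  | zero =>
    simp only [Pi.zero_apply, map_zero]
    exact P.zero_mem
  | add x y _ _ hx hy =>
    simp only [Pi.add_apply, map_add]
    exact P.add_mem hx hy
  | smul c x hx' hx =>
    simp only [serRing_smul_apply, ABMod.a_smul]
    exact P.add_mem (smul_mem_of_mem_serRing c.2 hx) (smul_mem_of_mem_serRing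
      (serRing.fmul_mem (serRing.const_mem (X ^ 2)) (serRing.derivative_mem c.2))
      (Submodule.span_le.2 hG hx'))

theorem iterSpan_mono (φ : Y → M) {s t : ℕ} (h : s ≤ t) : iterSpan A φ s ≤ iterSpan A φ t :=
  Submodule.span_mono (Set.image_mono (Set.Iio_subset_Iio h))

theorem a_mem_iterSpan {φ : Y → M} {t : ℕ} {s : Y → M} (hs : s ∈ iterSpan A φ t) :
    (fun y => M.a (s y)) ∈ iterSpan A φ (t + 1) := by
  refine a_mem_of_mem_span ?_ ?_ hs
  · rintro _ ⟨ν, hν, rfl⟩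
    have : ν < t := hν
    exact Submodule.subset_span ⟨ν, show ν < t + 1 by omega, rfl⟩
  · rintro _ ⟨ν, hν, rfl⟩
    have : ν < t := hν
    exact Submodule.subset_span ⟨ν + 1, show ν + 1 < t + 1 by omega,
      funext fun y => Function.iterate_succ_apply' _ _ _⟩

theorem mem_iterSpan_iff {φ s : Y → M} {t : ℕ} : s ∈ iterSpan A φ t ↔
    ∃ c : Fin t → Y → ℂ⟦X⟧, (∀ ν, c ν ∈ serRing A) ∧ ∀ y, s y = ∑ ν, c ν y • M.a^[ν] (φ y) := by
  have : (fun (ν : ℕ) y => M.a^[ν] (φ y)) '' Set.Iio t =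
      Set.range fun (ν : Fin t) y => M.a^[ν] (φ y) := by
    ext x
    constructor
    · rintro ⟨ν, hν, rfl⟩
      exact ⟨⟨ν, hν⟩, rfl⟩
    · rintro ⟨ν, rfl⟩
      exact ⟨ν, ν.2, rfl⟩
  rw [iterSpan, this, Submodule.mem_span_range_iff_exists_fun]
  constructor
  · rintro ⟨c, rfl⟩
    exact ⟨fun ν => c ν, fun ν => (c ν).2, fun y => by simp [serRing_smul_apply]⟩
  · rintro ⟨c, hc, h⟩
    exact ⟨fun ν => ⟨c ν, hc ν⟩, funext fun y => by rw [h]; simp [serRing_smul_apply]⟩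

theorem mem_span_range_serRing_iff {k : ℕ} {w : Fin k → Y → M} {s : Y → M} :
    s ∈ Submodule.span (serRing A) (Set.range w) ↔
    ∃ c : Fin k → Y → ℂ⟦X⟧, (∀ i, c i ∈ serRing A) ∧ ∀ y, s y = ∑ i, c i y • w i y := by
  rw [Submodule.mem_span_range_iff_exists_fun]
  constructor
  · rintro ⟨c, rfl⟩
    exact ⟨fun ν => c ν, fun ν => (c ν).2, fun y => by simp [serRing_smul_apply]⟩
  · rintro ⟨c, hc, h⟩
    exact ⟨fun ν => ⟨c ν, hc ν⟩, funext fun y => by rw [h]; simp [serRing_smul_apply]⟩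

section

variable {S : Fin n → Y → ℂ⟦X⟧} {w : Fin (n + 1) → Y → M}

/-- Solving the relation for the lower vector, w_j = S_j⁻¹ (a - λb) w_{j+1}, costs one application
of a per index. -/
theorem IsChain.mem_iterSpan (hw : ∀ y, IsChain lam1 p (fun j => S j y) M fun i => w i y)
    (hS : ∀ j, S j ∈ serRing A) (hS0 : ∀ j y, coeff 0 (S j y) ≠ 0) (i : Fin (n + 1)) :
    w i ∈ iterSpan A (w (Fin.last n)) (n + 1 - i) := by
  induction i using Fin.reverseInduction with
  | last =>
    refine Submodule.subset_span ⟨0, ?_, rfl⟩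
    show 0 < n + 1 - n
    omega
  | cast j ih =>
    have hj := j.2
    have h1 : w j.castSucc = fun y => (S j y)⁻¹ • (M.a (w j.succ y) -
        (C (expo lam1 p j.succ : ℂ) * X) • w j.succ y) := by
      funext y
      rw [(hw y).succ, add_sub_cancel_left, smul_smul,
        PowerSeries.inv_mul_cancel _ (by simpa using hS0 j y), one_smul]
    have e : n + 1 - j.castSucc.1 = (n + 1 - j.succ.1) + 1 := by
      simp only [Fin.val_castSucc, Fin.val_succ]; omega
    rw [h1, e]
    exact smul_mem_of_mem_serRing (serRing.inv_mem (hS j) (hS0 j))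
      (Submodule.sub_mem _ (a_mem_iterSpan ih) (smul_mem_of_mem_serRing
        (serRing.const_mem _) (iterSpan_mono _ (Nat.le_succ _) ih)))

theorem IsChain.a_mem_span (hw : ∀ y, IsChain lam1 p (fun j => S j y) M fun i => w i y)
    (hS : ∀ j, S j ∈ serRing A) {s : Y → M} (hs : s ∈ Submodule.span (serRing A) (Set.range w)) :
    (fun y => M.a (s y)) ∈ Submodule.span (serRing A) (Set.range w) := by
  have hmem : ∀ i, w i ∈ Submodule.span (serRing A) (Set.range w) :=
    fun i => Submodule.subset_span ⟨i, rfl⟩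
  refine a_mem_of_mem_span (fun g hg => Submodule.subset_span hg) ?_ hs
  rintro _ ⟨i, rfl⟩
  refine Fin.cases ?_ (fun j => ?_) i
  · simp only [(hw _).zero]
    exact smul_mem_of_mem_serRing (serRing.const_mem _) (hmem _)
  · simp only [(hw _).succ]
    exact Submodule.add_mem _ (smul_mem_of_mem_serRing (serRing.const_mem _) (hmem _))
      (smul_mem_of_mem_serRing (hS j) (hmem _))

theorem IsChain.iterate_mem_span (hw : ∀ y, IsChain lam1 p (fun j => S j y) M fun i => w i y)
    (hS : ∀ j, S j ∈ serRing A) {s : Y → M} (hs : s ∈ Submodule.span (serRing A) (Set.range w))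
    (ν : ℕ) : (fun y => M.a^[ν] (s y)) ∈ Submodule.span (serRing A) (Set.range w) := by
  induction ν with
  | zero => exact hs
  | succ ν ih =>
    simp only [Function.iterate_succ_apply']
    exact IsChain.a_mem_span hw hS ih

end

/-- The action of `a` on the combinations of the elements of a chain. -/
theorem IsChain.a_sum_sub {S : Fin n → ℂ⟦X⟧} {w : Fin (n + 1) → M} (hw : IsChain lam1 p S M w)
    (u : Fin (n + 1) → ℂ⟦X⟧) (μ : ℚ) :
    M.a (∑ i, u i • w i) - (C (μ : ℂ) * X) • ∑ i, u i • w i =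
      ∑ i : Fin (n + 1), (eul (expo lam1 p i - μ : ℚ) (u i) +
          (if h : i.1 < n then S ⟨i, h⟩ * u ⟨i + 1, by omega⟩ else 0)) • w i := by
  have h1 : ∀ i : Fin (n + 1), M.a (u i • w i) =
      (eul (expo lam1 p i : ℂ) (u i)) • w i +
        u i • (M.a (w i) - (C (expo lam1 p i : ℂ) * X) • w i) := by
    intro i
    rw [ABMod.a_smul, eul, smul_sub, add_smul, smul_smul]
    rw [show u i * (C (expo lam1 p i : ℂ) * X) = C (expo lam1 p i : ℂ) * X * u i by ring]
    abel
  have h2 : ∑ i : Fin (n + 1), u i • (M.a (w i) - (C (expo lam1 p i : ℂ) * X) • w i) =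
      ∑ i : Fin (n + 1), (if h : i.1 < n then S ⟨i, h⟩ * u ⟨i + 1, by omega⟩ else 0) • w i := by
    rw [Fin.sum_univ_succ, Fin.sum_univ_castSucc (fun i : Fin (n + 1) => (if h : i.1 < n then
      S ⟨i, h⟩ * u ⟨i + 1, by omega⟩ else 0) • w i), hw.zero, sub_self, smul_zero, zero_add]
    rw [dif_neg (by simp), zero_smul, add_zero]
    refine Finset.sum_congr rfl fun i _ => ?_
    rw [hw.succ, add_sub_cancel_left, dif_pos (by simp), smul_smul, mul_comm]
    rfl
  rw [map_sum]
  simp only [h1]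
  rw [Finset.sum_add_distrib, h2, Finset.smul_sum, add_sub_right_comm, ← Finset.sum_sub_distrib,
    ← Finset.sum_add_distrib]
  refine Finset.sum_congr rfl fun i _ => ?_
  rw [smul_smul, ← sub_smul, ← add_smul]
  congr 2
  simp only [eul]
  push_cast
  rw [map_sub]
  ring

/-- The chain obtained from a reduction of the invariants. -/
theorem IsChain.change {S S' : Fin n → ℂ⟦X⟧} {w : Fin (n + 1) → M} (hw : IsChain lam1 p S M w)
    {U : Fin (n + 1) → Fin (n + 1) → ℂ⟦X⟧} (hU1 : ∀ i, U i i = 1) (hU0 : ∀ i j, j < i → U i j = 0)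
    (hU : ∀ (i : Fin (n + 1)) (j : Fin n),
        eul (expo lam1 p i - expo lam1 p j.succ : ℚ) (U i j.succ) +
          (if h : i.1 < n then S ⟨i, h⟩ * U ⟨i + 1, by omega⟩ j.succ else 0) =
          S' j * U i j.castSucc) :
    IsChain lam1 p S' M fun j => ∑ i, U i j • w i := by
  have ha := fun j => hw.a_sum_sub fun i => U i j
  constructor
  · rw [← sub_eq_zero, ha]
    refine Finset.sum_eq_zero fun i _ => ?_
    have h1 : eul (expo lam1 p i - expo lam1 p 0 : ℚ) (U i 0) = 0 := by
      by_cases hi : i = 0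
      · rw [hi, hU1, sub_self, Rat.cast_zero]
        simp [eul]
      · rw [hU0 i 0 (Fin.pos_iff_ne_zero.2 hi), eul_zero]
    rw [h1, zero_add]
    split_ifs
    · rw [hU0 _ _ (by rw [Fin.lt_def]; simp), mul_zero, zero_smul]
    · rw [zero_smul]
  · intro j
    refine sub_eq_iff_eq_add'.1 ?_
    rw [ha, Finset.smul_sum]
    refine Finset.sum_congr rfl fun i _ => ?_
    rw [hU, mul_smul]

/-- A unitriangular change of basis does not change the span. -/
theorem mem_span_unitriangular {w : Fin (n + 1) → Y → M}
    {U : Fin (n + 1) → Fin (n + 1) → Y → ℂ⟦X⟧} (hU : ∀ i j, U i j ∈ serRing A)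
    (hU1 : ∀ i y, U i i y = 1) (hU0 : ∀ i j y, j < i → U i j y = 0) (j : Fin (n + 1)) :
    w j ∈ Submodule.span (serRing A) (Set.range fun j y => ∑ i, U i j y • w i y) := by
  set P := Submodule.span (serRing A) (Set.range fun j y => ∑ i, U i j y • w i y)
  induction j using WellFoundedLT.induction with
  | _ j ih =>
    classical
    have h1 : w j = (fun y => ∑ i, U i j y • w i y) -
        ∑ i ∈ Finset.univ.erase j, fun y => U i j y • w i y := by
      funext y
      rw [Pi.sub_apply, Finset.sum_apply, ← Finset.add_sum_erase _ _ (Finset.mem_univ j), hU1,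
        one_smul, add_sub_cancel_right]
    rw [h1]
    refine P.sub_mem (Submodule.subset_span ⟨j, rfl⟩) (P.sum_mem fun i hi => ?_)
    rcases lt_or_gt_of_ne (Finset.ne_of_mem_erase hi) with h | h
    · exact smul_mem_of_mem_serRing (hU i j) (ih i h)
    · simp only [hU0 i j _ h, zero_smul]
      exact P.zero_mem

/-- Linear independence from leading coordinates. -/
theorem linearIndependent_of_lead {w : Fin (n + 1) → M} (x : ℕ → M →ₗ[ℂ⟦X⟧] ℂ⟦X⟧)
    (h0 : ∀ i j : Fin (n + 1), j < i → x i (w j) = 0) (h1 : ∀ i : Fin (n + 1), x i (w i) ≠ 0) :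
    LinearIndependent ℂ⟦X⟧ w := by
  rw [Fintype.linearIndependent_iff]
  intro g hg
  by_contra! hne
  obtain ⟨i₀, hi₀⟩ := hne
  classical
  have hs : (Finset.univ.filter fun i => g i ≠ 0).Nonempty := ⟨i₀, by simpa using hi₀⟩
  -- At the largest index carrying a non-zero coefficient, the leading coordinate sees only that
  -- term.
  obtain ⟨i, hi, hmax⟩ := Finset.exists_max_image _ id hs
  have hgi : g i ≠ 0 := by simpa using hi
  have h2 := congrArg (x i) hg
  rw [map_sum, map_zero, Finset.sum_eq_single i] at h2
  · rw [map_smul, smul_eq_mul] at h2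
    exact (mul_ne_zero hgi (h1 i)) h2
  · intro j _ hji
    rcases lt_or_gt_of_ne hji with h | h
    · rw [map_smul, h0 i j h, smul_zero]
    · have : g j = 0 := by
        by_contra hj
        exact absurd (hmax j (by simpa using hj)) (not_le.2 h)
      rw [this, zero_smul, map_zero]
  · exact fun h => absurd (Finset.mem_univ i) h

end IsChain

/-! ### Canonical chains in families of themes -/

section CanonicalChain

variable {n : ℕ} {lam1 : ℚ} {p : Fin n → ℕ}

theorem expo_succ (lam1 : ℚ) (p : Fin n → ℕ) (j : Fin n) :
    expo lam1 p j.succ = expo lam1 p j.castSucc + p j - 1 := by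
  rw [expo_eq, expo_eq, Fin.val_succ, Fin.val_castSucc, expoShift, expoShift, partialSum_succ,
    natExt_apply]
  push_cast
  ring

variable {Λ : Finset ℚ} {N : ℕ}

/-- The leading coordinates along a chain. -/
theorem coeff_lead_succ {l : Λ} {j : Fin n} {m m' : ℕ} (hm : expo lam1 p j.castSucc = l.1 + m)
    (hm' : expo lam1 p j.succ = l.1 + m') {S : ℂ⟦X⟧} {w w' : Xi Λ N}
    (h : (Xi Λ N).a w' = (C (expo lam1 p j.succ : ℂ) * X) • w' + S • w) {γ : ℂ}
    (hw : xiCoord l j w = C γ * X ^ m) :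
    coeff m' (xiCoord l (j + 1) w') = γ * coeff (p j) S := by
  have h1 : (Xi Λ N).a w' - (C (expo lam1 p j.succ : ℂ) * X) • w' = S • w := by
    rw [h, add_sub_cancel_left]
  have h2 := congrArg (xiCoord l j) h1
  rw [xiCoord_sub, map_smul, hw, smul_eq_mul] at h2
  have h3 := congrArg (coeff (m' + 1)) h2
  -- In degree m' + 1 the operator has a zero coefficient, so on the left only the next coordinate
  -- contributes. On the right, m' + 1 = p_j + m picks out the coefficient of b^(p_j) in S.
  have h4 : ((m' : ℂ) + (l.1 - expo lam1 p j.succ : ℚ)) = 0 := by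
    rw [hm']; push_cast; ring
  have h5 : m' + 1 = p j + m := by
    have := expo_succ lam1 p j
    rw [hm, hm'] at this
    have h6 : (m' : ℚ) + 1 = p j + m := by linarith
    exact_mod_cast h6
  rw [map_add, coeff_succ_eul, h4, zero_mul, zero_add, coeff_succ_X_mul, h5,
    show S * (C γ * X ^ m) = C γ * (S * X ^ m) by ring, coeff_C_mul, coeff_mul_X_pow] at h3
  exact h3

variable {Y : Type u} {A : FunAlg Y}

/-- The coordinates of a family of elements of `Ξ_Λ^{(N)}` belong to a given ring. -/
def XiRegular (A : FunAlg Y) (φ : Y → Xi Λ N) : Prop :=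
  ∀ l i, (fun y => xiCoord l i (φ y)) ∈ serRing A

theorem XiRegular.smul {φ : Y → Xi Λ N} (hφ : XiRegular A φ) {c : Y → ℂ⟦X⟧}
    (hc : c ∈ serRing A) : XiRegular A fun y => c y • φ y := fun l i => by
  simp only [map_smul, smul_eq_mul]
  exact serRing.fmul_mem hc (hφ l i)

theorem XiRegular.a_sub {φ : Y → Xi Λ N} (hφ : XiRegular A φ) (μ : ℚ) :
    XiRegular A fun y => (Xi Λ N).a (φ y) - (C (μ : ℂ) * X) • φ y := fun l i => by
  simp only [xiCoord_sub]
  exact serRing.fadd_mem (serRing.eul_mem _ (hφ l i))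
    (serRing.fmul_mem (serRing.const_mem X) (hφ l (i + 1)))

/-- A normalized generator of a term of a family of flags. -/
structure IsNormalizedGenerator (A : FunAlg Y) (l : Λ)
    (F : Y → Fin (n + 2) → Submodule ℂ⟦X⟧ (Xi Λ N)) (j : Fin (n + 1)) (m : ℕ)
    (w : Y → Xi Λ N) : Prop where
  regular : XiRegular A w
  gen : ∀ y, (Xi Λ N).genSubmodule (w y) = F y j.succ
  lead : ∃ γ ∈ A.toSubalgebra, (∀ y, γ y ≠ 0) ∧ ∀ y, xiCoord l j (w y) = C (γ y) * X ^ m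

/-- The unit part of the leading coordinate is divided out, up to its constant term, which stays in
w as γ. The factor κ, with constant term 1, will serve as S_j in the chain. -/
theorem exists_normalizedGenerator {l : Λ} (hl : congrSet Λ lam1 = {l})
    {F : Y → Fin (n + 2) → Submodule ℂ⟦X⟧ (Xi Λ N)} (hF : ∀ y, IsFlag lam1 p (Xi Λ N) (F y))
    {j : Fin (n + 1)} {m : ℕ} (hm : expo lam1 p j = l.1 + m) {φ : Y → Xi Λ N}
    (hφ : XiRegular A φ) (hgen : ∀ y, (Xi Λ N).genSubmodule (φ y) = F y j.succ) :
    ∃ w, IsNormalizedGenerator A l F j m w ∧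
      ∃ κ ∈ serRing A, (∀ y, coeff 0 (κ y) = 1) ∧ ∀ y, φ y = κ y • w y := by
  choose κ hκ0 hκ using fun y => (hF y).lead_of_generator hl hm (hgen y)
  have hκm : κ ∈ serRing A := by
    intro k
    have h1 := hφ l j (m + k)
    simp only [hκ] at h1
    have h2 : ∀ y, coeff (m + k) (X ^ m * κ y) = coeff k (κ y) := fun y => by
      rw [add_comm, coeff_X_pow_mul]
    simpa only [h2] using h1
  have hc0 : (fun y => (coeff 0 (κ y))⁻¹) ∈ A.toSubalgebra := A.inv_mem _ (hκm 0) hκ0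
  set κ' : Y → ℂ⟦X⟧ := fun y => C (coeff 0 (κ y))⁻¹ * κ y with hκ'
  have hκ'm : κ' ∈ serRing A := serRing.fmul_mem (serRing.C_mem hc0) hκm
  have hκ'0 : ∀ y, coeff 0 (κ' y) = 1 := fun y => by
    rw [hκ', coeff_C_mul, inv_mul_cancel₀ (hκ0 y)]
  have hκ'n : ∀ y, coeff 0 (κ' y) ≠ 0 := fun y => by rw [hκ'0]; exact one_ne_zero
  have hinv : (fun y => (κ' y)⁻¹) ∈ serRing A := serRing.inv_mem hκ'm hκ'n
  refine ⟨fun y => (κ' y)⁻¹ • φ y, ⟨hφ.smul hinv, fun y => ?_, fun y => coeff 0 (κ y),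
    hκm 0, hκ0, fun y => ?_⟩, κ', hκ'm, hκ'0, fun y => ?_⟩
  · rw [ABMod.genSubmodule_smul _, hgen]
    rw [coeff_zero_eq_constantCoeff_apply, constantCoeff_inv]
    exact inv_ne_zero (by simpa using hκ'n y)
  · have h1 : (κ y : ℂ⟦X⟧) = C (coeff 0 (κ y)) * κ' y := by
      rw [hκ', ← mul_assoc, ← map_mul, mul_inv_cancel₀ (hκ0 y), map_one, one_mul]
    rw [map_smul, hκ, smul_eq_mul]
    conv_lhs => rw [h1]
    have h2 := PowerSeries.inv_mul_cancel (κ' y) (by simpa using hκ'n y)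
    linear_combination (X ^ m * C (coeff 0 (κ y))) * h2
  · rw [smul_smul, PowerSeries.mul_inv_cancel _ (by simpa using hκ'n y), one_smul]

/-- Commuting a past a coefficient produces only derivatives of it, never a higher iterate. -/
theorem iterSpan_smul_le {M : ABMod.{v}} {φ : Y → M} {c : Y → ℂ⟦X⟧} (hc : c ∈ serRing A) (t : ℕ) :
    iterSpan A (fun y => c y • φ y) t ≤ iterSpan A φ t := by
  have h : ∀ ν : ℕ, (fun y => M.a^[ν] (c y • φ y)) ∈ iterSpan A φ (ν + 1) := by
    intro ν
    induction ν with
    | zero =>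
      exact smul_mem_of_mem_serRing hc
        (Submodule.subset_span ⟨0, show 0 < 0 + 1 by omega, rfl⟩)
    | succ ν ih =>
      simp only [Function.iterate_succ_apply']
      exact a_mem_iterSpan ih
  refine Submodule.span_le.2 ?_
  rintro _ ⟨ν, hν, rfl⟩
  exact iterSpan_mono _ (show ν + 1 ≤ t from hν) (h ν)

/-- A family of themes in `Ξ_Λ^{(N)}` with given invariants has a basis in canonical form. -/
theorem exists_canonical_chain [Nonempty Y] (hΛ : ∀ l ∈ Λ, 0 < l ∧ l ≤ 1) {φ : Y → Xi Λ N}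
    (hφ : XiRegular A φ) (hflag : ∀ y, ∃ F, IsFlag lam1 p (Xi Λ N) F ∧
      F (Fin.last (n + 1)) = (Xi Λ N).genSubmodule (φ y)) :
    ∃ (S : Fin n → Y → ℂ⟦X⟧) (w : Fin (n + 1) → Y → Xi Λ N),
      (∀ j, S j ∈ serRing A) ∧ (∀ j y, S j y ∈ W p j) ∧
      (∀ y, IsChain lam1 p (fun j => S j y) (Xi Λ N) fun i => w i y) ∧
      (∀ y, LinearIndependent ℂ⟦X⟧ fun i => w i y) ∧
      (∀ i, w i ∈ iterSpan A φ (n + 1)) ∧ φ ∈ Submodule.span (serRing A) (Set.range w) := by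
  choose F hF hFφ using hflag
  obtain ⟨y₀⟩ := ‹Nonempty Y›
  -- The exponent l and the integers m_j depend only on Λ, λ_1 and the p_j, so the choice made at
  -- one point serves for all.
  obtain ⟨l, hl⟩ := (congrSet_subsingleton hΛ lam1).eq_empty_or_singleton.resolve_left
    (hF y₀).congrSet_nonempty.ne_empty
  choose m hm using (hF y₀).exists_expo hl
  let G : Fin (n + 1) → Type u := fun j => {w : Y → Xi Λ N // IsNormalizedGenerator A l F j (m j) w}
  have hstep : ∀ (j : Fin n) (w : G j.succ), ∃ w' : G j.castSucc,
      ∃ κ ∈ serRing A, (∀ y, coeff 0 (κ y) = 1) ∧ ∀ y, (Xi Λ N).a (w.1 y) -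
        (C (expo lam1 p j.succ : ℂ) * X) • w.1 y = κ y • w'.1 y := by
    rintro j ⟨w, hw⟩
    obtain ⟨γ, -, hγ0, hγ⟩ := hw.lead
    obtain ⟨w', hw', κ, hκ⟩ := exists_normalizedGenerator (A := A) hl hF (hm j.castSucc)
      (hw.regular.a_sub (expo lam1 p j.succ)) fun y =>
        (hF y).generator_of_generator hl (hm j.succ) (hw.gen y) (hγ0 y) (hγ y)
    exact ⟨⟨w', hw'⟩, κ, hκ⟩
  choose step κ hκ hκ0 hstep using hstep
  obtain ⟨w₀, hw₀, κ₀, hκ₀, hκ₀0, hφw₀⟩ := exists_normalizedGenerator (A := A) hl hF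
    (hm (Fin.last n)) hφ fun y => (hFφ y).symm
  -- Built from the last index down: (a - λb) applied to a normalized generator generates the
  -- preceding term of the flag, and normalizing it gives the next vector, with the unit factor as
  -- the invariant S_j.
  let v : ∀ j, G j := Fin.reverseInduction (motive := G) ⟨w₀, hw₀⟩ step
  have hvl : v (Fin.last n) = ⟨w₀, hw₀⟩ := Fin.reverseInduction_last ..
  have hvs : ∀ j : Fin n, v j.castSucc = step j (v j.succ) :=
    fun j => Fin.reverseInduction_castSucc ..
  have hchain : ∀ y, IsChain lam1 p (fun j => κ j (v j.succ) y) (Xi Λ N) fun i => (v i).1 y := by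
    intro y
    constructor
    · obtain ⟨γ, -, hγ0, hγ⟩ := (v 0).2.lead
      have h1 := (hF y).generator_of_generator hl (hm 0) ((v 0).2.gen y) (hγ0 y) (hγ y)
      have h2 := ABMod.mem_genSubmodule_self
        ((Xi Λ N).a ((v 0).1 y) - (C (expo lam1 p 0 : ℂ) * X) • (v 0).1 y)
      rw [h1, Fin.castSucc_zero, (hF y).zero, Submodule.mem_bot] at h2
      exact sub_eq_zero.1 h2
    · intro j
      rw [hvs]
      exact sub_eq_iff_eq_add'.1 (hstep j (v j.succ) y)
  -- This coefficient is the ratio of two consecutive leading coefficients.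
  have hp : ∀ j y, coeff (p j) (κ j (v j.succ) y) ≠ 0 := by
    intro j y h0
    obtain ⟨γ, -, hγ0, hγ⟩ := (v j.castSucc).2.lead
    obtain ⟨γ', -, hγ0', hγ'⟩ := (v j.succ).2.lead
    have h1 := coeff_lead_succ (hm j.castSucc) (hm j.succ) ((hchain y).succ j) (hγ y)
    have h2 := hγ' y
    rw [Fin.val_succ] at h2
    rw [h2, coeff_C_mul, coeff_X_pow_self, mul_one, h0, mul_zero] at h1
    exact hγ0' y h1
  obtain ⟨S, U, hS, hSW, hU, hU1, hU0, hrel⟩ := exists_canonical_reduction (A := A) lam1 p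
    (fun j => hκ j (v j.succ)) (fun j => hκ0 j (v j.succ)) hp
  have hzero : ∀ (i j : Fin (n + 1)) y, j < i → xiCoord l i ((v j).1 y) = 0 := by
    intro i j y hij
    refine (hF y).le_xiSub j.succ ?_ l i fun _ => ?_
    · rw [← (v j).2.gen]
      exact ABMod.mem_genSubmodule_self _
    · rw [Fin.val_succ]
      exact hij
  refine ⟨S, fun j y => ∑ i, U i j y • (v i).1 y, hS, hSW, fun y => ?_, fun y => ?_,
    fun i => ?_, ?_⟩
  · exact (hchain y).change (U := fun i j => U i j y) (fun i => hU1 i y) (fun i j => hU0 i j y)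
      fun i j => hrel i j y
  · refine linearIndependent_of_lead (fun i => xiCoord l i) (fun i j hij => ?_) fun i => ?_
    · rw [map_sum]
      refine Finset.sum_eq_zero fun k _ => ?_
      rw [map_smul]
      rcases lt_or_ge k i with h | h
      · rw [hzero i k y h, smul_zero]
      · rw [hU0 k j y (hij.trans_le h), zero_smul]
    · rw [map_sum, Finset.sum_eq_single i]
      · obtain ⟨γ, -, hγ0, hγ⟩ := (v i).2.lead
        rw [hU1, one_smul, hγ]
        exact mul_ne_zero (by simpa using hγ0 y) (pow_ne_zero _ X_ne_zero)
      · intro k _ hki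
        rw [map_smul]
        rcases lt_or_gt_of_ne hki with h | h
        · rw [hzero i k y h, smul_zero]
        · rw [hU0 k i y h, zero_smul]
      · exact fun h => absurd (Finset.mem_univ i) h
  · have h1 : (fun y => (κ₀ y)⁻¹ • φ y) = (v (Fin.last n)).1 := by
      funext y
      rw [hvl, hφw₀, smul_smul, PowerSeries.inv_mul_cancel _ (by
        rw [← coeff_zero_eq_constantCoeff_apply, hκ₀0]; exact one_ne_zero), one_smul]
    have h2 : ∀ k, (v k).1 ∈ iterSpan A φ (n + 1) := by
      intro k
      refine iterSpan_smul_le (serRing.inv_mem hκ₀ fun y => by rw [hκ₀0]; exact one_ne_zero)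
        (n + 1) ?_
      rw [h1]
      exact iterSpan_mono _ (Nat.sub_le _ _) (IsChain.mem_iterSpan hchain
        (fun j => hκ j (v j.succ)) (fun j y => by rw [hκ0]; exact one_ne_zero) k)
    have h3 : (fun y => ∑ k, U k i y • (v k).1 y) = ∑ k, fun y => U k i y • (v k).1 y := by
      funext y
      rw [Finset.sum_apply]
    beta_reduce
    rw [h3]
    exact Submodule.sum_mem _ fun k _ => smul_mem_of_mem_serRing (hU k i) (h2 k)
  · have h1 : φ = fun y => κ₀ y • (v (Fin.last n)).1 y := by
      funext y
      rw [hvl, hφw₀]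
    rw [h1]
    exact smul_mem_of_mem_serRing hκ₀ (mem_span_unitriangular (w := fun i => (v i).1) hU hU1 hU0 _)

end CanonicalChain

/-! ### Embedding of a chain in `Ξ_λ^{(N)}` -/

section Embedding

variable {Y : Type u} {A : FunAlg Y}

theorem eul_C_mul_X_pow {c : ℂ} {m : ℕ} (hc : (m : ℂ) + c = 0) (v : ℂ) :
    eul c (C v * X ^ m) = 0 := by
  rw [eul_eq_iff]
  refine ⟨by simp, fun k => ?_⟩
  rw [map_zero, coeff_C_mul, coeff_X_pow]
  split_ifs with hk
  · rw [hk, hc, zero_mul]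
  · simp

theorem serRing.monomial_mem {v : Y → ℂ} (hv : v ∈ A.toSubalgebra) (m : ℕ) :
    (fun y => C (v y) * X ^ m) ∈ serRing A :=
  serRing.fmul_mem (serRing.C_mem hv) (serRing.const_mem _)

/-- Resolution of the equation `(a - μ b) x = g` in `Ξ_λ^{(N)}`, in terms of coordinates. -/
theorem exists_eul_system {c : ℂ} {m d : ℕ} (hc : (m : ℂ) + c = 0) (hd : d ≤ m) (J : ℕ) :
    ∀ g : ℕ → Y → ℂ⟦X⟧, (∀ i, g i ∈ serRing A) → (∀ i, J ≤ i → ∀ y, g i y = 0) →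
      (∀ i y, ∀ k < d + 1, coeff k (g i y) = 0) → ∀ v ∈ A.toSubalgebra,
      ∃ x : ℕ → Y → ℂ⟦X⟧, (∀ i, x i ∈ serRing A) ∧ (∀ i, J < i → ∀ y, x i y = 0) ∧
        (∀ i y, eul c (x i y) + X * x (i + 1) y = g i y) ∧
        (∀ i y, ∀ k < d, coeff k (x i y) = 0) ∧ ∀ y, coeff m (x 0 y) = v y := by
  induction J with
  | zero =>
    intro g hg hgJ hgd v hv
    refine ⟨fun i => if i = 0 then (fun y => C (v y) * X ^ m) else 0, fun i => ?_, fun i hi y => ?_,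
      fun i y => ?_, fun i y k hk => ?_, fun y => ?_⟩
    · dsimp only
      split_ifs
      exacts [serRing.monomial_mem hv m, zero_mem _]
    · simp [show i ≠ 0 by omega]
    · rw [hgJ i (Nat.zero_le _) y]
      by_cases hi : i = 0
      · simp [hi, eul_C_mul_X_pow hc]
      · simp [hi, eul_zero]
    · by_cases hi : i = 0
      · simp [hi, coeff_X_pow, show k ≠ m by omega]
      · simp [hi]
    · simp
  | succ J ih =>
    intro g hg hgJ hgd v hv
    -- The coordinates of positive index are solved first. The free resonant coefficient of the
    -- coordinate of index 1 is prescribed so that b times it cancels the obstruction of index 0,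
    -- whose own resonant coefficient then remains free and is set to v.
    obtain ⟨x, hx, hxJ, hxe, hxd, hxm⟩ := ih (fun i => g (i + 1)) (fun i => hg _)
      (fun i hi => hgJ _ (by omega)) (fun i => hgd _) _ (hg 0 (m + 1))
    have hX : (fun y => X * x 0 y) ∈ serRing A := serRing.fmul_mem (serRing.const_mem X) (hx 0)
    obtain ⟨z, hz, hze, hzc⟩ := exists_eul_eq c (serRing.fsub_mem (hg 0) hX)
      (fun y => by rw [map_sub, hgd 0 y 0 (by omega), coeff_zero_X_mul, sub_zero])
      (fun k hk y => by
        have : k = m := by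
          have := hk.trans hc.symm
          exact_mod_cast add_right_cancel this
        rw [this, map_sub, coeff_succ_X_mul, hxm, sub_self])
    have hm := serRing.monomial_mem hv m
    refine ⟨fun i => i.casesOn (fun y => z y + C (v y) * X ^ m) x, fun i => ?_, fun i hi y => ?_,
      fun i y => ?_, fun i y k hk => ?_, fun y => ?_⟩
    · cases i
      exacts [serRing.fadd_mem hz hm, hx _]
    · cases i with
      | zero => omega
      | succ i => exact hxJ i (by omega) y
    · cases i with
      | zero =>
        show eul c (z y + C (v y) * X ^ m) + X * x 0 y = g 0 y
        rw [eul_add, eul_C_mul_X_pow hc, hze]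
        ring
      | succ i => exact hxe i y
    · cases i with
      | zero =>
        show coeff k (z y + C (v y) * X ^ m) = 0
        rw [map_add, hzc, map_sub, hgd 0 y _ (by omega), coeff_succ_X_mul, hxd 0 y k hk,
          coeff_C_mul, coeff_X_pow, if_neg (by omega)]
        simp
      | succ i => exact hxd i y k hk
    · show coeff m (z y + C (v y) * X ^ m) = v y
      rw [map_add, hzc, hc, div_zero, coeff_C_mul, coeff_X_pow_self, zero_add, mul_one]

variable {n : ℕ} {lam1 : ℚ} {p : Fin n → ℕ}

/-- The terms of the embedding of a chain in `Ξ_λ^{(N)}`. -/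
structure IsEmbeddedTerm (A : FunAlg Y) {Λ : Finset ℚ} {N : ℕ} (l : Λ) (d j m : ℕ)
    (w : Y → Xi Λ N) : Prop where
  regular : XiRegular A w
  zero : ∀ y i, j < i → xiCoord l i (w y) = 0
  div : ∀ y i, ∀ k < d, coeff k (xiCoord l i (w y)) = 0
  lead : ∀ y, ∃ γ : ℂ, γ ≠ 0 ∧ xiCoord l j (w y) = C γ * X ^ m

/-- The element of `Ξ_l^{(N)}` with given coordinates. -/
def xiOfCoords {l : ℚ} (N : ℕ) (x : ℕ → ℂ⟦X⟧) : Xi {l} N :=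
  fun i : ({l} : Finset ℚ) × Fin (N + 1) => x i.2

theorem xiCoord_xiOfCoords {l : ℚ} {N : ℕ} {x : ℕ → ℂ⟦X⟧} (hx : ∀ i, N < i → x i = 0)
    (l' : ({l} : Finset ℚ)) (i : ℕ) : xiCoord l' i (xiOfCoords N x : Xi {l} N) = x i := by
  by_cases hi : i < N + 1
  · exact xiCoord_apply l' ⟨i, hi⟩ _
  · rw [xiCoord_of_lt l' (by omega), hx i (by omega)]

/-- Solving (a - λb)w' = S w loses one power of b and reaches one more index. By `coeff_lead_succ`
the new coordinate is a monomial whose coefficient is γ times that of b^(p_j) in S, hence is not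
zero. -/
theorem exists_embedded_succ {l : ℚ} (l' : ({l} : Finset ℚ)) {N d : ℕ} {j : Fin n} {m m' : ℕ}
    (hN : n ≤ N)
    (hm : expo lam1 p j.castSucc = l + m) (hm' : expo lam1 p j.succ = l + m') (hd : d ≤ m')
    {S : Y → ℂ⟦X⟧} (hS : S ∈ serRing A) (hSp : ∀ y, coeff (p j) (S y) ≠ 0) {w : Y → Xi {l} N}
    (hw : IsEmbeddedTerm A l' (d + 1) j.castSucc m w) :
    ∃ w' : Y → Xi {l} N, IsEmbeddedTerm A l' d j.succ m' w' ∧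
      ∀ y, (Xi {l} N).a (w' y) = (C (expo lam1 p j.succ : ℂ) * X) • w' y + S y • w y := by
  have hl' : l'.1 = l := Finset.mem_singleton.1 l'.2
  have hc : (m' : ℂ) + (l - expo lam1 p j.succ : ℚ) = 0 := by rw [hm']; push_cast; ring
  have hj := j.2
  have hsub : ∀ l'' : ({l} : Finset ℚ), l'' = l' := fun l'' =>
    Subtype.ext ((Finset.mem_singleton.1 l''.2).trans hl'.symm)
  have hg : ∀ i, (fun y => S y * xiCoord l' i (w y)) ∈ serRing A :=
    fun i => serRing.fmul_mem hS (hw.regular l' i)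
  obtain ⟨x, hx, hxJ, hxe, hxd, -⟩ := exists_eul_system (A := A) hc hd (j + 1)
    (fun i y => S y * xiCoord l' i (w y)) hg
    (fun i hi y => by rw [hw.zero y i (by rw [Fin.val_castSucc]; omega), mul_zero])
    (fun i y k hk => coeff_mul_of_vanish (hw.div y i) hk) 0 (zero_mem _)
  have hcoord : ∀ l'' i y, xiCoord l'' i (xiOfCoords N fun i => x i y : Xi {l} N) = x i y :=
    fun l'' i y => xiCoord_xiOfCoords (fun i hi => hxJ i (by omega) y) l'' i
  have hrel : ∀ y, (Xi {l} N).a (xiOfCoords N fun i => x i y : Xi {l} N) =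
      (C (expo lam1 p j.succ : ℂ) * X) • (xiOfCoords N fun i => x i y : Xi {l} N) + S y • w y := by
    intro y
    rw [← sub_eq_iff_eq_add']
    refine xi_ext fun l'' i => ?_
    rw [hsub l'', xiCoord_sub, hcoord, hcoord, map_smul, smul_eq_mul, hl']
    exact hxe i y
  refine ⟨fun y => xiOfCoords N fun i => x i y, ⟨fun l'' i => ?_, fun y i hi => ?_,
    fun y i k hk => ?_, fun y => ?_⟩, hrel⟩
  · simp only [hcoord]
    exact hx i
  · rw [hcoord]
    exact hxJ i hi y
  · rw [hcoord]
    exact hxd i y k hk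
  · obtain ⟨γ, hγ, hγw⟩ := hw.lead y
    have h1 := coeff_lead_succ (l := l') (by rw [hl']; exact hm) (by rw [hl']; exact hm')
      (hrel y) hγw
    rw [hcoord] at h1
    refine ⟨γ * coeff (p j) (S y), mul_ne_zero hγ (hSp y), ?_⟩
    rw [hcoord, Fin.val_succ, ← h1]
    have h2 := hxe (j + 1) y
    rw [hxJ (j + 1 + 1) (by omega), mul_zero, add_zero,
      hw.zero y (j + 1) (by rw [Fin.val_castSucc]; omega), mul_zero] at h2
    ext k
    rw [coeff_C_mul, coeff_X_pow]
    split_ifs with hk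
    · rw [hk, mul_one]
    · rw [mul_zero]
      refine coeff_eq_zero_of_eul_eq_zero h2 fun hk' => hk ?_
      have := hk'.trans hc.symm
      exact_mod_cast add_right_cancel this

/-- Here m = ⌈λ_1⌉ - 1, so that l falls in ]0,1]; the strict inequality λ_1 > n is what gives m ≥ n.
-/
theorem exists_fractional_part {lam1 : ℚ} (hlam1 : (n : ℚ) < lam1) :
    ∃ (l : ℚ) (m : ℕ), 0 < l ∧ l ≤ 1 ∧ n ≤ m ∧ lam1 = l + m := by
  have h1 : (n : ℤ) < ⌈lam1⌉ := Int.lt_ceil.2 (by exact_mod_cast hlam1)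
  obtain ⟨m, hm⟩ := Int.eq_ofNat_of_zero_le (show 0 ≤ ⌈lam1⌉ - 1 by omega)
  have h2 : (⌈lam1⌉ : ℚ) = m + 1 := by
    have : ⌈lam1⌉ = m + 1 := by omega
    rw [this]
    push_cast
    rfl
  have h3 := Int.ceil_lt_add_one lam1
  have h4 := Int.le_ceil lam1
  exact ⟨lam1 - m, m, by linarith, by linarith, by omega, by ring⟩

/-- A chain of extensions can be embedded in some `Ξ_λ^{(N)}`. -/
theorem exists_embedded_chain (hlam1 : (n : ℚ) < lam1) {N : ℕ} (hN : n ≤ N)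
    {S : Fin n → Y → ℂ⟦X⟧} (hS : ∀ j, S j ∈ serRing A) (hSp : ∀ j y, coeff (p j) (S j y) ≠ 0) :
    ∃ (l : ℚ) (_ : 0 < l) (_ : l ≤ 1) (w : Fin (n + 1) → Y → Xi {l} N),
      (∀ i, XiRegular A (w i)) ∧
      (∀ y, IsChain lam1 p (fun j => S j y) (Xi {l} N) fun i => w i y) ∧
      ∀ y, LinearIndependent ℂ⟦X⟧ fun i => w i y := by
  obtain ⟨l, m₀, hl0, hl1, hm₀, hlam⟩ := exists_fractional_part hlam1
  let l' : ({l} : Finset ℚ) := ⟨l, Finset.mem_singleton_self l⟩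
  -- The subtraction is exact for j ≤ n, because m₀ ≥ n.
  let m : ℕ → ℕ := fun j => m₀ + partialSum (natExt p) j - j
  have hm : ∀ j : Fin (n + 1), expo lam1 p j = l + m j := by
    intro j
    have hj : j.1 ≤ m₀ + partialSum (natExt p) j := by have := j.2; omega
    rw [expo_eq, hlam, expoShift]
    simp only [m]
    rw [Nat.cast_sub hj]
    push_cast
    ring
  -- The vector of index j keeps divisibility by b^(n-j): the first one is b^(m₀) with m₀ ≥ n, and
  -- each step loses one power. So no right-hand side ever has a constant term.
  let G : Fin (n + 1) → Type u :=
    fun j => {w : Y → Xi {l} N // IsEmbeddedTerm A l' (n - j) j (m j) w}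
  have hstep : ∀ (j : Fin n) (w : G j.castSucc), ∃ w' : G j.succ, ∀ y,
      (Xi {l} N).a (w'.1 y) = (C (expo lam1 p j.succ : ℂ) * X) • w'.1 y + S j y • w.1 y := by
    rintro j ⟨w, hw⟩
    have e : n - j.castSucc.1 = n - j.succ.1 + 1 := by
      have := j.2
      simp only [Fin.val_castSucc, Fin.val_succ]
      omega
    rw [e] at hw
    obtain ⟨w', hw', h⟩ := exists_embedded_succ l' hN (hm j.castSucc) (hm j.succ)
      (by simp only [m, Fin.val_succ]; omega) (hS j) (hSp j) hw
    exact ⟨⟨w', hw'⟩, h⟩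
  choose step hstep using hstep
  have hcoord : ∀ (l'' : ({l} : Finset ℚ)) i, xiCoord l'' i
      (xiOfCoords N fun i => if i = 0 then X ^ m 0 else 0 : Xi {l} N) =
        if i = 0 then X ^ m 0 else 0 :=
    fun l'' i => xiCoord_xiOfCoords (fun i hi => if_neg (by omega)) l'' i
  have hw₀ : IsEmbeddedTerm A l' n 0 (m 0)
      fun _ => (xiOfCoords N fun i => if i = 0 then X ^ m 0 else 0 : Xi {l} N) := by
    refine ⟨fun l'' i => ?_, fun y i hi => ?_, fun y i k hk => ?_, fun y => ⟨1, one_ne_zero, ?_⟩⟩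
    · exact serRing.const_mem _
    · rw [hcoord, if_neg (by omega)]
    · rw [hcoord]
      have : k < m 0 := by simp only [m]; omega
      split_ifs
      · rw [coeff_X_pow, if_neg (by omega)]
      · rw [map_zero]
    · rw [hcoord, if_pos rfl, map_one, one_mul]
  let v : ∀ j, G j := Fin.induction (motive := G) ⟨_, hw₀⟩ step
  have hv0 : v 0 = ⟨_, hw₀⟩ := rfl
  have hvs : ∀ j : Fin n, v j.succ = step j (v j.castSucc) := fun j => Fin.induction_succ ..
  refine ⟨l, hl0, hl1, fun i => (v i).1, fun i => (v i).2.regular, fun y => ⟨?_, fun j => ?_⟩,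
    fun y => ?_⟩
  · rw [← sub_eq_zero]
    refine xi_ext fun l'' i => ?_
    beta_reduce
    rw [xiCoord_sub, hv0, hcoord, hcoord, if_neg (Nat.succ_ne_zero i), mul_zero, add_zero, map_zero]
    split_ifs
    · have h1 := eul_C_mul_X_pow (c := (l''.1 - expo lam1 p 0 : ℚ)) (m := m 0) (by
        rw [hm 0, Finset.mem_singleton.1 l''.2]; push_cast; simp) 1
      rwa [map_one, one_mul] at h1
    · exact eul_zero _
  · beta_reduce
    rw [hvs]
    exact hstep j _ y
  · refine linearIndependent_of_lead (fun i => xiCoord l' i)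
      (fun i j hij => (v j).2.zero y i hij) fun i => ?_
    obtain ⟨γ, hγ, h⟩ := (v i).2.lead y
    rw [h]
    exact mul_ne_zero (by simpa using hγ) (pow_ne_zero _ X_ne_zero)

end Embedding

/-! ### Holomorphic functions -/

section Holomorphic

variable {X : Type u} [TopologicalSpace X] [ReducedComplexSpace X]

theorem HolAt.analytic_comp {α : Type*} [Fintype α] {f : α → X → ℂ} {x : X}
    (hf : ∀ i, HolAt (f i) x) {G : (α → ℂ) → ℂ} (hG : AnalyticAt ℂ G fun i => f i x) :
    HolAt (fun t => G fun i => f i t) x := by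
  obtain ⟨ι, _, V, Φ, -, hx, -, -, hV⟩ := ReducedComplexSpace.chart x
  choose g hg hfg using fun i => (hV x hx (f i)).1 (hf i)
  have hgx : (fun i => g i (Φ x)) = fun i => f i x := funext fun i => ((hfg i).eq_of_nhds).symm
  refine (hV x hx _).2 ⟨fun t => G fun i => g i t, ?_, ?_⟩
  · exact AnalyticAt.fun_comp (g := G) (f := fun t i => g i t) (by rwa [hgx]) (AnalyticAt.pi hg)
  · filter_upwards [eventually_all.2 hfg] with t ht
    simp only [Function.comp_apply] at ht ⊢
    simp only [ht]

theorem HolAt.inv {f : X → ℂ} {x : X} (hf : HolAt f x) (h : f x ≠ 0) :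
    HolAt (fun t => (f t)⁻¹) x :=
  HolAt.analytic_comp (α := Unit) (f := fun _ => f) (fun _ => hf) (G := fun v => (v ())⁻¹)
    (((ContinuousLinearMap.proj (R := ℂ) (φ := fun _ : Unit => ℂ) ()).analyticAt _).inv h)

theorem HolAt.continuousAt {f : X → ℂ} {x : X} (hf : HolAt f x) : ContinuousAt f x := by
  obtain ⟨ι, _, V, Φ, hVo, hx, hemb, -, hV⟩ := ReducedComplexSpace.chart x
  obtain ⟨g, hg, hfg⟩ := (hV x hx f).1 hf
  have hΦ : ContinuousAt Φ x :=
    (continuousOn_iff_continuous_domRestrict.2 hemb.continuous).continuousAt (hVo.mem_nhds hx)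
  exact (ContinuousAt.comp (g := g) hg.continuousAt hΦ).congr hfg.symm

/-- The algebra of holomorphic functions on `X`. -/
def holAlg (X : Type u) [TopologicalSpace X] [ReducedComplexSpace X] : FunAlg X where
  carrier := {f | ∀ x, HolAt f x}
  mul_mem' hf hg x := (hf x).mul (hg x)
  add_mem' hf hg x := (hf x).add (hg x)
  algebraMap_mem' c x := HolAt.const c x
  inv_mem _ hf h x := (hf x).inv (h x)

theorem mem_serRing_holAlg {c : X → ℂ⟦X⟧} : c ∈ serRing (holAlg X) ↔ ∀ x, HolSeriesAt c x :=
  ⟨fun h _ => Eventually.of_forall fun y m => h m y, fun h m x => (h x).self_of_nhds m⟩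

variable {n : ℕ} {p : Fin n → ℕ}

theorem HolMap.paramSpace_mem {f : X → ParamSpace p} (hf : HolMap f) (j : Fin n) :
    (fun y => (f y).1 j) ∈ serRing (holAlg X) := by
  intro m x
  refine hf.comp x (fun τ : ParamSpace p => coeff m (τ.1 j)) ?_
  by_cases hm : m ∈ vExponents p j
  · exact ⟨fun w => w ⟨j, m, hm⟩, (ContinuousLinearMap.proj (R := ℂ) (φ := fun _ => ℂ)
      (⟨j, m, hm⟩ : Σ i : Fin n, vExponents p i)).analyticAt _, EventuallyEq.rfl⟩
  · refine (HolAt.const 0 _).congr (Eventually.of_forall fun t => ?_)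
    exact ((mem_V_iff p j _).1 (t.2 j).1 m hm).symm

theorem holMap_paramSpace {f : X → ParamSpace p}
    (hf : ∀ j, (fun y => (f y).1 j) ∈ serRing (holAlg X)) : HolMap f := by
  have hcoord : ∀ (i : Σ i : Fin n, vExponents p i) (x : X),
      HolAt (fun t => ParamSpace.coord p (f t) i) x := fun i x => hf i.1 i.2.1 x
  have hcont : Continuous f := by
    rw [(ParamSpace.isEmbedding_coord p).continuous_iff]
    exact continuous_pi fun i => continuous_iff_continuousAt.2 fun x => (hcoord i x).continuousAt
  refine ⟨hcont, fun x g hg => ?_⟩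
  obtain ⟨G, hG, hgG⟩ := hg
  exact (HolAt.analytic_comp (fun i => hcoord i x) hG).congr
    ((hcont.continuousAt.eventually hgG).mono fun t ht => ht.symm)

end Holomorphic

/-! ### Isomorphisms -/

section Isomorphisms

/-- The inverse of an isomorphism. -/
def ABMod.Iso.symm {M : ABMod.{v}} {N : ABMod.{z}} (i : M.Iso N) : N.Iso M where
  toEquiv := i.toEquiv.symm
  map_a m := i.toEquiv.injective (by rw [i.map_a]; simp)

/-- The composition of isomorphisms. -/
def ABMod.Iso.trans {M : ABMod.{u}} {N : ABMod.{v}} {P : ABMod.{z}} (i : M.Iso N) (j : N.Iso P) :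
    M.Iso P where
  toEquiv := i.toEquiv.trans j.toEquiv
  map_a m := by simp [i.map_a, j.map_a]

variable {X : Type u} [TopologicalSpace X] [ReducedComplexSpace X]

/-- The inverse of an isomorphism of sheaves. -/
def ABFamily.Iso.symm {E : ABFamily.{u, v} X} {H : ABFamily.{u, z} X} (i : E.Iso H) :
    H.Iso E where
  toIso x := (i.toIso x).symm
  sec_iff s x := by
    rw [i.sec_iff]
    simp [ABMod.Iso.symm]

/-- The composition of isomorphisms of sheaves. -/
def ABFamily.Iso.trans {E : ABFamily.{u, v} X} {H : ABFamily.{u, z} X} {G : ABFamily.{u, w} X}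
    (i : E.Iso H) (j : H.Iso G) : E.Iso G where
  toIso x := (i.toIso x).trans (j.toIso x)
  sec_iff s x := by
    rw [i.sec_iff, j.sec_iff]
    rfl

variable {n : ℕ} {lam1 : ℚ} {p : Fin n → ℕ} {M : ABMod.{v}} {S : Fin n → ℂ⟦X⟧}
  {w : Fin (n + 1) → M} {φ : M}

theorem IsChain.genSubmodule_eq (hw : IsChain lam1 p S M w)
    (hwφ : ∀ i, w i ∈ M.genSubmodule φ) (hφ : φ ∈ Submodule.span ℂ⟦X⟧ (Set.range w)) :
    M.genSubmodule φ = Submodule.span ℂ⟦X⟧ (Set.range w) := by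
  refine le_antisymm (ABMod.genSubmodule_le (fun x hx => ?_) hφ)
    (Submodule.span_le.2 (by rintro _ ⟨i, rfl⟩; exact hwφ i))
  obtain ⟨c, rfl⟩ := (Submodule.mem_span_range_iff_exists_fun _).1 hx
  have h := sub_eq_iff_eq_add.1 (hw.a_sum_sub c 0)
  rw [h]
  exact Submodule.add_mem _ (Submodule.sum_mem _ fun i _ =>
    Submodule.smul_mem _ _ (Submodule.subset_span ⟨i, rfl⟩)) (Submodule.smul_mem _ _ hx)

/-- The isomorphism of `E(σ)` with a module having a basis with the same relations. -/
theorem IsChain.exists_iso (hw : IsChain lam1 p S M w) (hli : LinearIndependent ℂ⟦X⟧ w)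
    (hspan : M.genSubmodule φ = Submodule.span ℂ⟦X⟧ (Set.range w)) :
    ∃ i : (canMod lam1 p S).Iso (M.generated φ), ∀ x : Fin (n + 1) → ℂ⟦X⟧,
      M.incl φ (i.toEquiv x) = ∑ k, x k • w k := by
  have hmem : ∀ x : Fin (n + 1) → ℂ⟦X⟧,
      Fintype.linearCombination ℂ⟦X⟧ w x ∈ M.genSubmodule φ := by
    intro x
    rw [hspan, Fintype.linearCombination_apply]
    exact Submodule.sum_mem _ fun i _ => Submodule.smul_mem _ _ (Submodule.subset_span ⟨i, rfl⟩)
  let L : (Fin (n + 1) → ℂ⟦X⟧) →ₗ[ℂ⟦X⟧] M.genSubmodule φ :=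
    (Fintype.linearCombination ℂ⟦X⟧ w).codRestrict _ hmem
  have hL : Function.Bijective L := by
    constructor
    · intro x y hxy
      exact (linearIndependent_iff_injective_fintypeLinearCombination.1 hli)
        (congrArg Subtype.val hxy)
    · rintro ⟨x, hx⟩
      have hx' := hx
      rw [hspan] at hx'
      obtain ⟨c, rfl⟩ := (Submodule.mem_span_range_iff_exists_fun _).1 hx'
      exact ⟨c, Subtype.ext (Fintype.linearCombination_apply _ _ _)⟩
  refine ⟨⟨LinearEquiv.ofBijective L hL, fun x => ?_⟩, fun x => rfl⟩
  refine M.incl_injective φ ?_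
  rw [M.incl_a]
  have h := hw.a_sum_sub x 0
  rw [Rat.cast_zero, map_zero, zero_mul, zero_smul, sub_zero] at h
  refine Eq.trans (Fintype.linearCombination_apply ℂ⟦X⟧ w
    ((canMod lam1 p S).a x : Fin (n + 1) → ℂ⟦X⟧)) (Eq.trans ?_ h.symm)
  refine Finset.sum_congr rfl fun i _ => ?_
  rw [sub_zero]
  rfl

end Isomorphisms

/-! ### Families with a basis in canonical form -/

section Frames

variable {Y : Type u} [TopologicalSpace Y] [ReducedComplexSpace Y]
variable {n : ℕ} {lam1 : ℚ} {p : Fin n → ℕ} {Λ : Finset ℚ} {N k : ℕ}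

theorem mem_genSubmodule_of_mem_iterSpan {Y : Type u} {A : FunAlg Y} {M : ABMod.{v}}
    {φ s : Y → M} {t : ℕ} (hs : s ∈ iterSpan A φ t) (y : Y) : s y ∈ M.genSubmodule (φ y) := by
  obtain ⟨c, -, h⟩ := mem_iterSpan_iff.1 hs
  rw [h]
  exact Submodule.sum_mem _ fun ν _ => Submodule.smul_mem _ _ (Submodule.subset_span ⟨ν, rfl⟩)

theorem mem_span_of_mem_span {Y : Type u} {A : FunAlg Y} {M : ABMod.{v}} {k : ℕ}
    {w : Fin k → Y → M} {s : Y → M} (hs : s ∈ Submodule.span (serRing A) (Set.range w)) (y : Y) :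
    s y ∈ Submodule.span ℂ⟦X⟧ (Set.range fun i => w i y) := by
  obtain ⟨c, -, h⟩ := mem_span_range_serRing_iff.1 hs
  rw [h]
  exact Submodule.sum_mem _ fun ν _ => Submodule.smul_mem _ _ (Submodule.subset_span ⟨ν, rfl⟩)

/-- The fibrewise isomorphisms e_i ↦ w_i respect sections in both directions, since the w_i and the
iterates a^ν φ are combinations of each other with holomorphic coefficients. -/
theorem nonempty_pullback_iso {f : Y → ParamSpace p} (hf : HolMap f) {φ : Y → Xi Λ N}
    (hφ : IsThematic k φ) {w : Fin (n + 1) → Y → Xi Λ N}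
    (hw : ∀ y, IsChain lam1 p (f y).1 (Xi Λ N) fun i => w i y)
    (hli : ∀ y, LinearIndependent ℂ⟦X⟧ fun i => w i y) {t : ℕ}
    (hwφ : ∀ i, w i ∈ iterSpan (holAlg Y) φ t)
    (hφw : φ ∈ Submodule.span (serRing (holAlg Y)) (Set.range w)) :
    Nonempty (((canonicalFamily lam1 p).pullback f hf).Iso (thematicFamily φ hφ)) := by
  have hspan := fun y => (hw y).genSubmodule_eq
    (fun i => mem_genSubmodule_of_mem_iterSpan (hwφ i) y) (mem_span_of_mem_span hφw y)
  choose I hI using fun y => (hw y).exists_iso (hli y) (hspan y)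
  choose c hc hcw using fun i => mem_iterSpan_iff.1 (hwφ i)
  choose d hd hdφ using fun ν => mem_span_range_serRing_iff.1
    (IsChain.iterate_mem_span hw hf.paramSpace_mem hφw ν)
  refine ⟨⟨I, fun s x => ?_⟩⟩
  have hpull : ((canonicalFamily lam1 p).pullback f hf).SecAt s x ↔
      ∀ i, HolSeriesAt (fun y => (s y : Fin (n + 1) → ℂ⟦X⟧) i) x := by
    constructor
    · rintro ⟨m, r, b, hr, hb, hs⟩ i
      refine (HolSeriesAt.sum Finset.univ fun l _ => (hb l).mul ((hr l i).comp hf)).congr ?_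
      filter_upwards [hs] with y hy
      refine Eq.trans ?_ (congrFun hy i).symm
      exact (Finset.sum_apply i Finset.univ
        fun l => b l y • (r l (f y) : Fin (n + 1) → ℂ⟦X⟧)).symm
    · intro h
      refine ⟨n + 1, fun i σ => canBasis lam1 p σ.1 i, fun i y => (s y : Fin (n + 1) → ℂ⟦X⟧) i,
        fun i j => HolSeriesAt.const ((Pi.single i 1 : Fin (n + 1) → ℂ⟦X⟧) j) _, h,
        Eventually.of_forall fun y => ?_⟩
      refine (pi_eq_sum_univ' (s y : Fin (n + 1) → ℂ⟦X⟧)).trans ?_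
      refine Finset.sum_congr rfl fun i _ => ?_
      congr 1
  rw [hpull]
  have hinc : ∀ y, (Xi Λ N).incl (φ y) ((I y).toEquiv (s y)) =
      ∑ i, (s y : Fin (n + 1) → ℂ⟦X⟧) i • w i y := fun y => hI y (s y)
  constructor
  · intro h
    refine ⟨t, fun ν y => ∑ i, (s y : Fin (n + 1) → ℂ⟦X⟧) i * c i ν y, fun ν =>
      HolSeriesAt.sum _ fun i _ => (h i).mul (mem_serRing_holAlg.1 (hc i ν) x),
      Eventually.of_forall fun y => ?_⟩
    refine (hinc y).trans ?_
    simp only [hcw, Finset.smul_sum, Finset.sum_smul, mul_smul]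
    exact Finset.sum_comm
  · rintro ⟨m, b, hb, hs⟩ i
    refine (HolSeriesAt.sum Finset.univ fun (ν : Fin m) _ =>
      (hb ν).mul (mem_serRing_holAlg.1 (hd ν i) x)).congr ?_
    filter_upwards [hs] with y hy
    replace hy := (hinc y).symm.trans hy
    simp only [hdφ, Finset.smul_sum, smul_smul] at hy
    rw [Finset.sum_comm] at hy
    simp only [← Finset.sum_smul] at hy
    have := (linearIndependent_iff_injective_fintypeLinearCombination.1 (hli y))
      ((Fintype.linearCombination_apply _ _ _).trans
        (hy.trans (Fintype.linearCombination_apply _ _ _).symm))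
    exact (congrFun this i).symm

/-- The span of r contains k independent vectors, so its rank is not less than its number of
generators. -/
theorem linearIndependent_of_mem_span {M : ABMod.{v}} {k : ℕ} {w r : Fin k → M}
    (hw : LinearIndependent ℂ⟦X⟧ w) (h : ∀ i, w i ∈ Submodule.span ℂ⟦X⟧ (Set.range r)) :
    LinearIndependent ℂ⟦X⟧ r := by
  rw [linearIndependent_iff_card_le_finrank_span]
  have h1 : LinearIndependent ℂ⟦X⟧
      (fun i => (⟨w i, h i⟩ : Submodule.span ℂ⟦X⟧ (Set.range r))) :=
    LinearIndependent.of_comp (Submodule.subtype _) hw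
  have : Module.Finite ℂ⟦X⟧ (Submodule.span ℂ⟦X⟧ (Set.range r)) :=
    Module.Finite.span_of_finite _ (Set.finite_range r)
  exact h1.fintype_card_le_finrank

/-- The n + 1 iterates span the n + 1 independent w_i, which excludes relations among them; higher
iterates are expressed through the w_i, which are stable under a, and then through the first
iterates. -/
theorem isThematic_of_chain {φ : Y → Xi Λ N} (hφ : XiRegular (holAlg Y) φ)
    {S : Fin n → Y → ℂ⟦X⟧} (hS : ∀ j, S j ∈ serRing (holAlg Y)) {w : Fin (n + 1) → Y → Xi Λ N}
    (hw : ∀ y, IsChain lam1 p (fun j => S j y) (Xi Λ N) fun i => w i y)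
    (hli : ∀ y, LinearIndependent ℂ⟦X⟧ fun i => w i y)
    (hwφ : ∀ i, w i ∈ iterSpan (holAlg Y) φ (n + 1))
    (hφw : φ ∈ Submodule.span (serRing (holAlg Y)) (Set.range w)) : IsThematic (n + 1) φ where
  hol x i := by
    have h := mem_serRing_holAlg.1 (hφ i.1 i.2) x
    simpa only [xiCoord_apply] using h
  indep y := by
    refine linearIndependent_of_mem_span (hli y) fun i => ?_
    obtain ⟨c, -, h⟩ := mem_iterSpan_iff.1 (hwφ i)
    rw [h]
    exact Submodule.sum_mem _ fun ν _ => Submodule.smul_mem _ _ (Submodule.subset_span ⟨ν, rfl⟩)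
  gen ν := by
    have h1 : Submodule.span (serRing (holAlg Y)) (Set.range w) ≤ iterSpan (holAlg Y) φ (n + 1) :=
      Submodule.span_le.2 (by rintro _ ⟨i, rfl⟩; exact hwφ i)
    obtain ⟨c, hc, h⟩ := mem_iterSpan_iff.1 (h1 (IsChain.iterate_mem_span hw hS hφw ν))
    exact ⟨c, fun j x => mem_serRing_holAlg.1 (hc j) x, h⟩

end Frames

/-! ### Uniqueness of the canonical form -/

section Uniqueness

variable {n : ℕ} {p : ℕ → ℕ} {S S' : ℕ → ℂ⟦X⟧} {U : ℕ → ℕ → ℂ⟦X⟧}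

/-- The relations satisfied by the matrix of a morphism between two modules in canonical form. -/
structure IsMorphismMatrix (n : ℕ) (p : ℕ → ℕ) (S S' : ℕ → ℂ⟦X⟧) (U : ℕ → ℕ → ℂ⟦X⟧) : Prop where
  zero : ∀ i, eul (expoShift p i - expoShift p 0 : ℚ) (U i 0) + S' i * U (i + 1) 0 = 0
  succ : ∀ i, ∀ j < n, eul (expoShift p i - expoShift p (j + 1) : ℚ) (U i (j + 1)) +
    S' i * U (i + 1) (j + 1) = S j * U i j
  of_lt : ∀ i j, n < i → U i j = 0

theorem expoShift_succ (p : ℕ → ℕ) (j : ℕ) : expoShift p (j + 1) = expoShift p j + p j - 1 := by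
  rw [expoShift, expoShift, partialSum_succ]
  push_cast
  ring

/-- Same mechanism as in Ξ, with S'_i in the role of b: x_{i+1} is a kernel monomial γ b^r, and in
degree p_i + r the image of x_i has no component, leaving γ times the coefficient of b^(p_i) in
S'_i. -/
theorem vanish_of_eul_add_mul {x : ℕ → ℂ⟦X⟧} {j : ℕ} {μ : ℚ}
    (hp : ∀ i < n, coeff (p i) (S' i) ≠ 0) (hx : ∀ i, n < i → x i = 0)
    (h : ∀ i, j ≤ i → eul (expoShift p i - μ : ℚ) (x i) + S' i * x (i + 1) = 0) :
    ∀ i, j < i → x i = 0 := by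
  suffices h' : ∀ d i, n + 1 ≤ i + d → j < i → x i = 0 from
    fun i hi => h' (n + 1) i (by omega) hi
  intro d
  induction d with
  | zero => exact fun i hi _ => hx i (by omega)
  | succ d ih =>
    intro i hi hj
    by_cases hin : n < i
    · exact hx i hin
    obtain ⟨i, rfl⟩ : ∃ i', i = i' + 1 := ⟨i - 1, by omega⟩
    have h1 := h (i + 1) (by omega)
    rw [ih (i + 1 + 1) (by omega) (by omega), mul_zero, add_zero] at h1
    by_contra hne
    obtain ⟨r, γ, hγ, hr, hxr⟩ := eq_C_mul_X_pow_of_eul_eq_zero h1 hne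
    have h2 := congrArg (coeff (p i + r)) (h i (by omega))
    have h3 : coeff (p i + r) (eul (expoShift p i - μ : ℚ) (x i)) = 0 := by
      rcases Nat.eq_zero_or_pos (p i + r) with h0 | h0
      · rw [h0, coeff_zero_eul]
      · obtain ⟨k, hk⟩ : ∃ k, p i + r = k + 1 := ⟨p i + r - 1, by omega⟩
        rw [hk, coeff_succ_eul]
        have : (k : ℂ) = p i + r - 1 := by
          rw [eq_sub_iff_add_eq]
          exact_mod_cast hk.symm
        rw [expoShift_succ] at hr
        have h4 : (k : ℂ) + (expoShift p i - μ : ℚ) = 0 := by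
          rw [this, ← hr]
          push_cast
          ring
        rw [h4, zero_mul]
    rw [map_add, h3, hxr, show S' i * (C γ * X ^ r) = C γ * (S' i * X ^ r) by ring, coeff_C_mul,
      coeff_mul_X_pow, zero_add, map_zero] at h2
    exact mul_ne_zero hγ (hp i (by omega)) h2

/-- Columns are treated from left to right: once column j is triangular, the right-hand side for
column j + 1 vanishes below the diagonal. -/
theorem IsMorphismMatrix.triangular (hU : IsMorphismMatrix n p S S' U)
    (hp : ∀ i < n, coeff (p i) (S' i) ≠ 0) : ∀ j ≤ n, ∀ i, j < i → U i j = 0 := by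
  intro j
  induction j with
  | zero =>
    exact fun _ => vanish_of_eul_add_mul (x := fun i => U i 0) hp (fun i hi => hU.of_lt i 0 hi)
      fun i _ => hU.zero i
  | succ j ih =>
    intro hj
    refine vanish_of_eul_add_mul (x := fun i => U i (j + 1)) (μ := expoShift p (j + 1)) hp
      (fun i hi => hU.of_lt i _ hi) fun i hi => ?_
    rw [hU.succ i j (by omega), ih (by omega) i (by omega), mul_zero]

/-- On the diagonal the exponent difference is 0, so the kernel consists of the constants;
comparison of constant terms in the relations next to the diagonal makes them equal. -/
theorem IsMorphismMatrix.diagonal (hU : IsMorphismMatrix n p S S' U)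
    (hp : ∀ i < n, coeff (p i) (S' i) ≠ 0) (hS : ∀ i < n, coeff 0 (S i) = 1)
    (hS' : ∀ i < n, coeff 0 (S' i) = 1) : ∀ j ≤ n, U j j = C (coeff 0 (U 0 0)) := by
  have hconst : ∀ j ≤ n, U j j = C (coeff 0 (U j j)) := by
    intro j hj
    have h1 : eul 0 (U j j) = 0 := by
      cases j with
      | zero =>
        have := hU.zero 0
        rwa [hU.triangular hp 0 hj 1 (by omega), mul_zero, add_zero, sub_self,
          Rat.cast_zero] at this
      | succ j =>
        have := hU.succ (j + 1) j (by omega)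
        rwa [hU.triangular hp (j + 1) hj _ (Nat.lt_succ_self _), mul_zero, add_zero, sub_self,
          Rat.cast_zero, hU.triangular hp j (by omega) _ (Nat.lt_succ_self _), mul_zero] at this
    ext k
    rw [coeff_C]
    split_ifs with hk
    · rw [hk]
    · exact coeff_eq_zero_of_eul_eq_zero h1 (by simpa using hk)
  intro j
  induction j with
  | zero => exact hconst 0
  | succ j ih =>
    intro hj
    have h1 := congrArg (coeff 0) (hU.succ j j (by omega))
    rw [ih (by omega), map_add, coeff_zero_eul, zero_add] at h1
    simp only [coeff_zero_eq_constantCoeff_apply, map_mul] at h1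
    simp only [← coeff_zero_eq_constantCoeff_apply] at h1
    rw [hS j (by omega), hS' j (by omega), one_mul, one_mul] at h1
    rw [hconst (j + 1) hj, h1]
    simp

/-- Excludes resonances in degrees below n - 1: the difference is a sum of t ≥ 1 terms p - 1, each
at least n - 1 ≥ 0. -/
theorem le_expoShift_sub (hp : ∀ i < n, n ≤ p i) {i t : ℕ} (ht : 1 ≤ t) (hit : i + t ≤ n) :
    (n : ℚ) - 1 ≤ expoShift p (i + t) - expoShift p i := by
  induction t with
  | zero => omega
  | succ t ih =>
    have h1 : (n : ℚ) ≤ p (i + t) := by exact_mod_cast hp (i + t) (by omega)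
    rw [← add_assoc, expoShift_succ]
    rcases Nat.eq_zero_or_pos t with h | h
    · subst h
      rw [add_zero] at h1 ⊢
      linarith
    · have h2 := ih h (by omega)
      have h3 : (1 : ℚ) ≤ n := by
        have : 1 ≤ n := by omega
        exact_mod_cast this
      linarith

theorem vanish_of_mul_vanish {f g : ℂ⟦X⟧} {d : ℕ} (hf : coeff 0 f = 1)
    (h : ∀ m < d, coeff m (f * g) = 0) : ∀ m < d, coeff m g = 0 := by
  intro m hm
  have h1 : g = f⁻¹ * (f * g) := by
    rw [← mul_assoc, PowerSeries.inv_mul_cancel _ (by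
      rw [← coeff_zero_eq_constantCoeff_apply, hf]; exact one_ne_zero), one_mul]
  rw [h1]
  exact coeff_mul_of_vanish h hm

theorem coeff_eul_of_vanish {c : ℂ} {g : ℂ⟦X⟧} {d : ℕ} (h : ∀ m < d, coeff m g = 0) :
    ∀ m < d + 1, coeff m (eul c g) = 0 := by
  intro m hm
  cases m with
  | zero => exact coeff_zero_eul _ _
  | succ m => rw [coeff_succ_eul, h m (by omega), mul_zero]

/-- Rows are treated from the last to the first, together with the bound that U_{j,j+d} has
valuation at least n - d. In row i a weaker bound, obtained from right to left, suffices for S_i =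
S'_i; this equality then starts the proof of the full bound, from left to right. -/
theorem IsMorphismMatrix.eq (hU : IsMorphismMatrix n p S S' U) (hU0 : U 0 0 ≠ 0)
    (hpn : ∀ i < n, n ≤ p i) (hp : ∀ i < n, coeff (p i) (S' i) ≠ 0)
    (hS : ∀ i < n, coeff 0 (S i) = 1) (hS' : ∀ i < n, coeff 0 (S' i) = 1)
    (hSV : ∀ i < n, ∀ m, n - i ≤ m → m ≠ p i → coeff m (S i) = 0)
    (hSV' : ∀ i < n, ∀ m, n - i ≤ m → m ≠ p i → coeff m (S' i) = 0) :
    ∀ j < n, S j = S' j := by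
  have hdiag := hU.diagonal hp hS hS'
  have hc : coeff 0 (U 0 0) ≠ 0 := by
    intro h
    refine hU0 ?_
    rw [hdiag 0 (Nat.zero_le _), h, map_zero]
  set c := coeff 0 (U 0 0)
  suffices h : ∀ e ≤ n, (∀ j, n - e ≤ j → j < n → S j = S' j) ∧
      ∀ j d, n - e ≤ j → 1 ≤ d → j + d ≤ n → ∀ k < n - d, coeff k (U j (j + d)) = 0 from
    fun j hj => (h n le_rfl).1 j (by omega) hj
  intro e
  induction e with
  | zero => exact fun _ => ⟨fun j h1 h2 => by omega, fun j d h1 h2 h3 => by omega⟩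
  | succ e ih =>
    intro he
    obtain ⟨ih1, ih2⟩ := ih (by omega)
    obtain ⟨i, hi⟩ : ∃ i, i = n - (e + 1) := ⟨_, rfl⟩
    -- The weak bound n - i - d is empty in the last column. Moving one column to the left, the
    -- operator gains one degree, the term from row i + 1 is controlled by the strong bound, and
    -- S_{i+d} is a unit.
    have hlow : ∀ r d, i + d + r = n → 1 ≤ d → ∀ k < n - i - d, coeff k (U i (i + d)) = 0 := by
      intro r
      induction r with
      | zero => exact fun d h1 h2 k hk => by omega
      | succ r ihr =>
        intro d h1 h2
        refine vanish_of_mul_vanish (hS (i + d) (by omega)) fun m hm => ?_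
        rw [← hU.succ i (i + d) (by omega), map_add,
          coeff_eul_of_vanish (g := U i (i + d + 1)) (ihr (d + 1) (by omega) (by omega)) m
            (by omega), zero_add]
        refine coeff_mul_of_vanish (d := n - d) (fun l hl => ?_) (by omega)
        rw [show i + d + 1 = i + 1 + d by omega]
        exact ih2 (i + 1) d (by omega) h2 (by omega) l hl
    have hrel := hU.succ i i (by omega)
    rw [hdiag i (by omega), hdiag (i + 1) (by omega)] at hrel
    have hpi : (p i : ℂ) - 1 + (expoShift p i - expoShift p (i + 1) : ℚ) = 0 := by
      rw [expoShift_succ]; push_cast; ring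
    -- The correction coming from U_{i,i+1} vanishes below degree n - i by the weak bound and in
    -- degree p_i by resonance; in all other degrees both series have zero coefficients.
    have hSi : S i = S' i := by
      ext m
      have h1 := congrArg (coeff m) hrel
      rw [map_add, mul_comm _ (C c), mul_comm _ (C c), coeff_C_mul, coeff_C_mul] at h1
      by_cases hm : m < n - i
      · rw [coeff_eul_of_vanish (d := n - i - 1) (hlow (n - i - 1) 1 (by omega) le_rfl) m
          (by omega), zero_add] at h1
        exact (mul_left_cancel₀ hc h1).symm
      · by_cases hmp : m = p i
        · have h2 : coeff m (eul (expoShift p i - expoShift p (i + 1) : ℚ) (U i (i + 1))) = 0 := by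
            obtain ⟨k, rfl⟩ : ∃ k, m = k + 1 := ⟨m - 1, by omega⟩
            have h3 : (k : ℂ) = p i - 1 := by rw [← hmp]; push_cast; ring
            rw [coeff_succ_eul, h3, hpi, zero_mul]
          rw [h2, zero_add] at h1
          exact (mul_left_cancel₀ hc h1).symm
        · rw [hSV i (by omega) m (by omega) hmp, hSV' i (by omega) m (by omega) hmp]
    -- For d = 1 the image of U_{i,i+1} is now 0; for larger d it is controlled by the previous
    -- column and by row i + 1. Degrees below n - 1 do not resonate, so the operator can be inverted
    -- there.
    have hup : ∀ d, 1 ≤ d → i + d ≤ n → ∀ k < n - d, coeff k (U i (i + d)) = 0 := by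
      intro d
      induction d with
      | zero => omega
      | succ d ihd =>
        intro h1 h2 k hk
        have h3 : coeff (k + 1)
            (eul (expoShift p i - expoShift p (i + d + 1) : ℚ) (U i (i + d + 1))) = 0 := by
          rcases Nat.eq_zero_or_pos d with h | h
          · subst h
            rw [hSi, add_eq_right] at hrel
            rw [add_zero, hrel, map_zero]
          · have h4 := eq_sub_of_add_eq (hU.succ i (i + d) (by omega))
            rw [h4, map_sub, coeff_mul_of_vanish (ihd h (by omega)) (by omega),
              coeff_mul_of_vanish (d := n - d) (fun l hl => ?_) (by omega), sub_zero]
            rw [show i + d + 1 = i + 1 + d by omega]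
            exact ih2 (i + 1) d (by omega) h (by omega) l hl
        rw [coeff_succ_eul] at h3
        refine (mul_eq_zero.1 h3).resolve_left fun h0 => ?_
        have h5 := le_expoShift_sub hpn (i := i) (t := d + 1) h1 h2
        have h6 : (k : ℚ) + (expoShift p i - expoShift p (i + d + 1)) = 0 := by exact_mod_cast h0
        have h7 : (k : ℚ) + 1 < n := by
          have : k + 1 < n := by omega
          exact_mod_cast this
        rw [← add_assoc] at h5
        linarith
    refine ⟨fun j h1 h2 => ?_, fun j d h1 h2 h3 => ?_⟩
    · by_cases hj : j = i
      · rw [hj, hSi]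
      · exact ih1 j (by omega) h2
    · by_cases hj : j = i
      · rw [hj]
        exact hup d h2 (by omega)
      · exact ih2 j d (by omega) h2 h3

end Uniqueness

/-! ### Uniqueness of the canonical form when p_j ≥ k - 1 for all j -/

section UniqueForms

variable {n : ℕ} {lam1 : ℚ} {p : Fin n → ℕ}

/-- As p_i alone reaches n - i, the minimal h is 0 and q is p_i. -/
theorem vExponents_subset (hp : ∀ j, n ≤ p j) (i : Fin n) {m : ℕ} (hm : m ∈ vExponents p i) :
    m < n - i ∨ m = p i := by
  have h0 : pSum p i 0 = p i := by
    rw [pSum_eq]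
    simp [partialSum, natExt_apply]
  have hi := hp i
  have hz : sInf {h : ℕ | n - i.1 ≤ pSum p i h} = 0 :=
    Nat.sInf_eq_zero.2 (Or.inl (by show n - i.1 ≤ pSum p i 0; omega))
  rw [vExponents, Finset.mem_union, Finset.mem_range, hz, h0] at hm
  refine hm.imp id fun h => ?_
  split_ifs at h
  · simp at h
  · simpa using h

/-- The coordinates on `E(σ)`. -/
def canCoord (lam1 : ℚ) (p : Fin n → ℕ) (S : Fin n → ℂ⟦X⟧) (i : Fin (n + 1)) :
    canMod lam1 p S →ₗ[ℂ⟦X⟧] ℂ⟦X⟧ :=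
  (LinearMap.proj i : (Fin (n + 1) → ℂ⟦X⟧) →ₗ[ℂ⟦X⟧] ℂ⟦X⟧)

theorem canCoord_ext {S : Fin n → ℂ⟦X⟧} {x y : canMod lam1 p S}
    (h : ∀ i, canCoord lam1 p S i x = canCoord lam1 p S i y) : x = y :=
  funext (α := Fin (n + 1)) (β := fun _ => ℂ⟦X⟧) h

theorem canCoord_canBasis (S : Fin n → ℂ⟦X⟧) (i j : Fin (n + 1)) :
    canCoord lam1 p S i (canBasis lam1 p S j) = if i = j then 1 else 0 :=
  Pi.single_apply (M := ℂ⟦X⟧) j 1 i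

theorem canCoord_a_sub (S : Fin n → ℂ⟦X⟧) (x : canMod lam1 p S) (μ : ℚ) (i : Fin (n + 1)) :
    canCoord lam1 p S i ((canMod lam1 p S).a x - (C (μ : ℂ) * X) • x) =
      eul (expo lam1 p i - μ : ℚ) (canCoord lam1 p S i x) +
        if h : i.1 < n then S ⟨i, h⟩ * canCoord lam1 p S ⟨i + 1, by omega⟩ x else 0 := by
  rw [map_sub, map_smul, smul_eq_mul]
  refine (congrArg (· - _) (canMod_a_apply lam1 p S x i)).trans ?_
  change X ^ 2 * derivative ℂ (canCoord lam1 p S i x) + C (expo lam1 p i : ℂ) * X *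
    canCoord lam1 p S i x + (if h : i.1 < n then S ⟨i, h⟩ * canCoord lam1 p S ⟨i + 1, by omega⟩ x
      else 0) - _ = _
  simp only [eul]
  push_cast
  rw [map_sub]
  ring

/-- Uniqueness of the canonical form when the `p_j` are large. -/
theorem eq_of_canMod_iso (hp : ∀ j, n ≤ p j) {σ τ : ParamSpace p}
    (θ : (canMod lam1 p σ.1).Iso (canMod lam1 p τ.1)) : σ = τ := by
  let B : Fin (n + 1) → canMod lam1 p τ.1 := fun j => θ.toEquiv (canBasis lam1 p σ.1 j)
  let U : ℕ → ℕ → ℂ⟦X⟧ := fun i j =>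
    if h : i < n + 1 ∧ j < n + 1 then canCoord lam1 p τ.1 ⟨i, h.1⟩ (B ⟨j, h.2⟩) else 0
  let ext0 : (Fin n → ℂ⟦X⟧) → ℕ → ℂ⟦X⟧ := fun S i => if h : i < n then S ⟨i, h⟩ else 0
  have hext : ∀ (S : Fin n → ℂ⟦X⟧) (i : ℕ) (h : i < n), ext0 S i = S ⟨i, h⟩ :=
    fun S i h => dif_pos h
  have hUB : ∀ (i j : ℕ) (h : i < n + 1) (h' : j < n + 1),
      U i j = canCoord lam1 p τ.1 ⟨i, h⟩ (B ⟨j, h'⟩) :=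
    fun i j h h' => dif_pos ⟨h, h'⟩
  have hUz : ∀ i j, n < i → U i j = 0 := fun i j h => dif_neg (by omega)
  have hrow : ∀ (i j : ℕ) (hi : i < n + 1) (hj : j < n + 1) (μ : ℚ),
      canCoord lam1 p τ.1 ⟨i, hi⟩ ((canMod lam1 p τ.1).a (B ⟨j, hj⟩) - (C (μ : ℂ) * X) • B ⟨j, hj⟩)
        = eul (expo lam1 p ⟨i, hi⟩ - μ : ℚ) (U i j) + ext0 τ.1 i * U (i + 1) j := by
    intro i j hi hj μ
    rw [canCoord_a_sub, hUB i j hi hj]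
    congr 1
    by_cases hin : i < n
    · rw [dif_pos hin, hext _ i hin, hUB (i + 1) j (by omega) hj]
    · rw [dif_neg hin, hUz (i + 1) j (by omega), mul_zero]
  have hexpo : ∀ (i j : ℕ) (hi : i < n + 1) (hj : j < n + 1), expo lam1 p ⟨i, hi⟩ -
      expo lam1 p ⟨j, hj⟩ = expoShift (natExt p) i - expoShift (natExt p) j := by
    intro i j hi hj
    rw [expo_eq, expo_eq, add_sub_add_left_eq_sub]
  have hU : IsMorphismMatrix n (natExt p) (ext0 σ.1) (ext0 τ.1) U := by
    refine ⟨fun i => ?_, fun i j hj => ?_, hUz⟩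
    · by_cases hi : i < n + 1
      · rw [← hexpo i 0 hi (by omega), ← hrow i 0 hi (by omega)]
        have h1 : (canMod lam1 p τ.1).a (B 0) = (C (expo lam1 p 0 : ℂ) * X) • (B 0) := by
          have := congrArg θ.toEquiv (canMod_a_basis_zero lam1 p σ.1)
          rwa [θ.map_a, map_smul] at this
        exact (congrArg _ (sub_eq_zero.2 h1)).trans (map_zero _)
      · rw [hUz i _ (by omega), hUz (i + 1) _ (by omega), eul_zero, mul_zero, add_zero]
    · by_cases hi : i < n + 1
      · rw [← hexpo i (j + 1) hi (by omega), ← hrow i (j + 1) hi (by omega), hext _ j hj,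
          hUB i j hi (by omega)]
        have h1 : (canMod lam1 p τ.1).a (B ⟨j + 1, by omega⟩) =
            (C (expo lam1 p ⟨j + 1, by omega⟩ : ℂ) * X) • (B ⟨j + 1, by omega⟩) +
              σ.1 ⟨j, hj⟩ • B ⟨j, by omega⟩ := by
          have := congrArg θ.toEquiv (canMod_a_basis_succ lam1 p σ.1 ⟨j, hj⟩)
          rw [θ.map_a, map_add, map_smul, map_smul] at this
          exact this
        exact (congrArg _ (sub_eq_iff_eq_add'.2 h1)).trans (map_smul _ _ _)
      · rw [hUz i _ (by omega), hUz (i + 1) _ (by omega), hUz i _ (by omega), eul_zero, mul_zero,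
          mul_zero, add_zero]
  have hV : ∀ (ρ : ParamSpace p), ∀ i < n, ∀ m, n - i ≤ m → m ≠ natExt p i →
      coeff m (ext0 ρ.1 i) = 0 := by
    intro ρ i hi m hm hmp
    rw [hext _ i hi]
    refine (mem_V_iff p ⟨i, hi⟩ _).1 (ρ.2 ⟨i, hi⟩).1 m fun h => ?_
    rcases vExponents_subset hp ⟨i, hi⟩ h with h1 | h1
    · dsimp only at h1; omega
    · exact hmp (h1.trans (natExt_apply p ⟨i, hi⟩).symm)
  have h0 : ∀ (ρ : ParamSpace p), ∀ i < n, coeff 0 (ext0 ρ.1 i) = 1 := by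
    intro ρ i hi
    rw [hext _ i hi]
    exact (ρ.2 ⟨i, hi⟩).2.1
  have hp' : ∀ i < n, coeff (natExt p i) (ext0 τ.1 i) ≠ 0 := by
    intro i hi
    rw [hext _ i hi, natExt_apply p ⟨i, hi⟩]
    exact (τ.2 ⟨i, hi⟩).2.2
  -- By triangularity the image of e_1 is U_00 e_1, and it is not zero since θ is injective.
  have hU0 : U 0 0 ≠ 0 := by
    intro h
    have h1 : B 0 = 0 := by
      refine canCoord_ext fun i => ?_
      rw [map_zero]
      rcases Nat.eq_zero_or_pos i.1 with hi | hi
      · obtain rfl : i = 0 := Fin.ext hi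
        exact (hUB 0 0 (by omega) (by omega)).symm.trans h
      · exact (hUB i.1 0 i.2 (by omega)).symm.trans (hU.triangular hp' 0 (Nat.zero_le _) i.1 hi)
    have h2 : canBasis lam1 p σ.1 0 = 0 := θ.toEquiv.injective (h1.trans (map_zero _).symm)
    have h3 := canCoord_canBasis (lam1 := lam1) (p := p) σ.1 0 0
    rw [h2, map_zero, if_pos rfl] at h3
    exact zero_ne_one h3
  have key := hU.eq hU0 (fun i hi => by rw [natExt_apply p ⟨i, hi⟩]; exact hp _) hp' (h0 σ) (h0 τ)
    (hV σ) (hV τ)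
  refine Subtype.ext (funext fun j => ?_)
  have := key j j.2
  rwa [hext _ j j.2, hext _ j j.2] at this

end UniqueForms

/-! ### The canonical family -/

section CanonicalFamily

variable {n : ℕ} {lam1 : ℚ} {p : Fin n → ℕ}

/-- The algebra of all functions on `Y`. -/
def allFun (Y : Type u) : FunAlg Y where
  toSubalgebra := ⊤
  inv_mem _ _ _ := trivial

theorem mem_serRing_allFun {Y : Type u} (c : Y → ℂ⟦X⟧) : c ∈ serRing (allFun Y) := fun _ => trivial

theorem coeff_zero_paramSpace_ne_zero (σ : ParamSpace p) (j : Fin n) : coeff 0 (σ.1 j) ≠ 0 := by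
  rw [(σ.2 j).2.1]
  exact one_ne_zero

/-- No localisation is needed: all the E(σ) embed in the same Ξ_l, holomorphically in σ, and the
image of the last basis vector serves as φ. -/
theorem isHolomorphicFamily_canonicalFamily (hlam1 : (n : ℚ) < lam1) :
    IsHolomorphicFamily (n + 1) (canonicalFamily lam1 p) := by
  intro x
  have hS : ∀ j, (fun y : (⊤ : Opens (ParamSpace p)) => y.1.1 j) ∈ serRing (holAlg _) :=
    (holMap_val (⊤ : Opens (ParamSpace p))).paramSpace_mem
  obtain ⟨l, hl0, hl1, w, hreg, hw, hli⟩ := exists_embedded_chain hlam1 (N := n + 1 - 1) le_rfl hS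
    fun j y => (y.1.2 j).2.2
  have hwφ : ∀ i, w i ∈ iterSpan (holAlg (⊤ : Opens (ParamSpace p))) (w (Fin.last n)) (n + 1) :=
    fun i => iterSpan_mono _ (Nat.sub_le _ _)
      (IsChain.mem_iterSpan hw hS (fun j y => coeff_zero_paramSpace_ne_zero y.1 j) i)
  have hφw : w (Fin.last n) ∈
      Submodule.span (serRing (holAlg (⊤ : Opens (ParamSpace p)))) (Set.range w) :=
    Submodule.subset_span ⟨_, rfl⟩
  refine ⟨⊤, trivial, {l}, fun l' hl' => ?_, w (Fin.last n),
    isThematic_of_chain (hreg _) hS hw hli hwφ hφw,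
    nonempty_pullback_iso (holMap_val _) _ hw hli hwφ hφw⟩
  rw [Finset.mem_singleton.1 hl']
  exact ⟨hl0, hl1⟩

/-- The submodule of `E(σ)` with basis `e_1, …, e_j`. -/
def canFlag (lam1 : ℚ) (p : Fin n → ℕ) (S : Fin n → ℂ⟦X⟧) (j : ℕ) :
    Submodule ℂ⟦X⟧ (canMod lam1 p S) where
  carrier := {x | ∀ i : Fin (n + 1), j ≤ i.1 → canCoord lam1 p S i x = 0}
  add_mem' hx hy i hi := by rw [map_add, hx i hi, hy i hi, add_zero]
  zero_mem' i _ := map_zero _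
  smul_mem' c x hx i hi := by rw [map_smul, hx i hi, smul_zero]

theorem canBasis_mem_canFlag (S : Fin n → ℂ⟦X⟧) {i : Fin (n + 1)} {j : ℕ} (h : i.1 < j) :
    canBasis lam1 p S i ∈ canFlag lam1 p S j := fun k hk => by
  rw [canCoord_canBasis, if_neg]
  rintro rfl
  omega

theorem isFlag_canFlag (S : Fin n → ℂ⟦X⟧) :
    IsFlag lam1 p (canMod lam1 p S) fun j => canFlag lam1 p S j where
  zero := by
    rw [eq_bot_iff]
    intro x hx
    refine (Submodule.mem_bot _).2 (canCoord_ext fun i => ?_)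
    rw [hx i (Nat.zero_le _), map_zero]
  stable j x hx i hi := by
    have h := canCoord_a_sub S x 0 i
    rw [Rat.cast_zero, map_zero, zero_mul, zero_smul, sub_zero, hx i hi, eul_zero, zero_add] at h
    rw [h]
    split_ifs with hin
    · rw [hx _ (Nat.le_succ_of_le hi), mul_zero]
    · rfl
  step j := by
    refine ⟨canBasis lam1 p S j, le_antisymm (fun x hx => ?_) (sup_le (fun x hx i hi => ?_) ?_),
      fun f hf => ?_, ?_⟩
    · rw [← sub_add_cancel x (canCoord lam1 p S j x • canBasis lam1 p S j)]
      refine Submodule.add_mem_sup (fun i hi => ?_)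
        (Submodule.smul_mem _ _ (Submodule.mem_span_singleton_self _))
      rw [map_sub, map_smul, canCoord_canBasis, smul_eq_mul]
      split_ifs with h
      · rw [h, mul_one, sub_self]
      · have h1 : i.1 ≠ j.1 := fun h' => h (Fin.ext h')
        have h2 : j.1 ≤ i.1 := hi
        rw [mul_zero, sub_zero, hx i (show j.1 + 1 ≤ i.1 by omega)]
    · exact hx i (Nat.le_of_succ_le hi)
    · rw [Submodule.span_singleton_le_iff_mem]
      exact canBasis_mem_canFlag S (Nat.lt_succ_self _)
    · have h := hf j le_rfl
      rwa [map_smul, canCoord_canBasis, if_pos rfl, smul_eq_mul, mul_one] at h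
    · refine Fin.cases ?_ (fun i => ?_) j
      · rw [canMod_a_basis_zero, sub_self]
        exact Submodule.zero_mem _
      · rw [canMod_a_basis_succ, add_sub_cancel_left]
        exact Submodule.smul_mem _ _ (canBasis_mem_canFlag S (Nat.lt_succ_self _))

/-- The embedding over a single point gives primitivity, and the first j basis vectors span the j-th
term of the flag. -/
theorem isThemeWithInvariants_canMod (hlam1 : (n : ℚ) < lam1) (σ : ParamSpace p) :
    IsThemeWithInvariants lam1 p (canMod lam1 p σ.1) := by
  have hF := isFlag_canFlag (lam1 := lam1) (p := p) σ.1
  refine ⟨?_, _, hF.zero, ?_, hF.stable, hF.step⟩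
  · obtain ⟨l, hl0, hl1, w, -, hw, hli⟩ := exists_embedded_chain (A := allFun Unit)
      (S := fun j _ => σ.1 j) hlam1 (le_refl n) (fun _ => mem_serRing_allFun _)
      fun j _ => (σ.2 j).2.2
    have hwφ : ∀ i, w i () ∈ (Xi {l} n).genSubmodule (w (Fin.last n) ()) := fun i =>
      mem_genSubmodule_of_mem_iterSpan (IsChain.mem_iterSpan hw (fun _ => mem_serRing_allFun _)
        (fun j _ => coeff_zero_paramSpace_ne_zero σ j) i) ()
    obtain ⟨I, -⟩ := (hw ()).exists_iso (hli ())
      ((hw ()).genSubmodule_eq hwφ (Submodule.subset_span ⟨_, rfl⟩))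
    exact ⟨l, hl0, hl1, n, _, ⟨I⟩⟩
  · refine eq_top_iff.2 fun x _ i hi => ?_
    have h1 : n + 1 ≤ i.1 := hi
    omega

theorem isFamilyWithInvariants_canonicalFamily (hlam1 : (n : ℚ) < lam1) :
    IsFamilyWithInvariants lam1 p (canonicalFamily lam1 p) :=
  ⟨isHolomorphicFamily_canonicalFamily hlam1, isThemeWithInvariants_canMod hlam1⟩

theorem IsThematic.xiRegular {Y : Type u} [TopologicalSpace Y] [ReducedComplexSpace Y] {k N : ℕ}
    {Λ : Finset ℚ} {φ : Y → Xi Λ N} (hφ : IsThematic k φ) : XiRegular (holAlg Y) φ := by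
  intro l i
  by_cases hi : i < N + 1
  · refine mem_serRing_holAlg.2 fun x => ?_
    have h := hφ.hol x (l, ⟨i, hi⟩)
    simpa only [← xiCoord_apply] using h
  · simp only [xiCoord_of_lt l (show N < i by omega)]
    exact serRing.const_mem 0

/-- The invariants S_j of a canonical chain of the family are the components of the classifying map.
-/
theorem exists_isClassifyingMap {Y : Type w} [TopologicalSpace Y] [ReducedComplexSpace Y]
    {H : ABFamily.{w, z} Y} (hH : IsFamilyWithInvariants lam1 p H) (y₀ : Y) :
    ∃ (U : Opens Y) (_ : y₀ ∈ U) (f : U → ParamSpace p),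
      IsClassifyingMap (canonicalFamily lam1 p) H U f := by
  obtain ⟨U, hy, Λ, hΛ, φ, hφ, ⟨I⟩⟩ := hH.1 y₀
  have : Nonempty U := ⟨⟨y₀, hy⟩⟩
  obtain ⟨S, w, hS, hSW, hw, hli, hwφ, hφw⟩ := exists_canonical_chain hΛ hφ.xiRegular
    fun y => (hH.2 y.1).exists_flag (I.toIso y)
  let f : U → ParamSpace p := fun y => ⟨fun j => S j y, fun j => hSW j y⟩
  have hf : HolMap f := holMap_paramSpace hS
  obtain ⟨K⟩ := nonempty_pullback_iso hf hφ hw hli hwφ hφw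
  exact ⟨U, hy, f, hf, ⟨K.trans I.symm⟩⟩

theorem isLocallyVersal_canonicalFamily (hlam1 : (n : ℚ) < lam1) :
    IsLocallyVersal.{0, 0, w, z} lam1 p (canonicalFamily lam1 p) :=
  ⟨isFamilyWithInvariants_canonicalFamily hlam1,
    fun _ _ _ _ y₀ _ hH _ => exists_isClassifyingMap hH y₀⟩

/-- Two classifying maps agree wherever both are defined, because each sends y to a canonical form
of H(y). -/
theorem HasUniqueCanonicalForms.isUniversal (hlam1 : (n : ℚ) < lam1)
    (h : HasUniqueCanonicalForms.{z} lam1 p) :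
    IsUniversal.{0, 0, w, z} lam1 p (canonicalFamily lam1 p) := by
  refine ⟨isLocallyVersal_canonicalFamily hlam1, ?_, h⟩
  rintro _ Y _ _ y₀ H hH - U U' - - f f' ⟨hf, ⟨I⟩⟩ ⟨hf', ⟨I'⟩⟩
  exact Eventually.of_forall fun y hy hy' => (h _ (hH.2 y)).unique
    ⟨(I.toIso ⟨y, hy⟩).symm⟩ ⟨(I'.toIso ⟨y, hy'⟩).symm⟩

/-- The case of a one-point parameter space in `exists_canonical_chain`. -/
theorem exists_canonical_form {T : ABMod.{z}} (hT : IsThemeWithInvariants lam1 p T) :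
    ∃ σ : ParamSpace p, Nonempty (T.Iso (canMod lam1 p σ.1)) := by
  obtain ⟨l, hl0, hl1, N, φ, ⟨I⟩⟩ := hT.1
  obtain ⟨S, w, -, hSW, hw, hli, hwφ, hφw⟩ := exists_canonical_chain (Y := Unit)
    (A := allFun Unit) (φ := fun _ => φ) (fun l' hl' => Finset.mem_singleton.1 hl' ▸ ⟨hl0, hl1⟩)
    (fun _ _ => mem_serRing_allFun _) fun _ => hT.exists_flag I
  obtain ⟨K, -⟩ := (hw ()).exists_iso (hli ()) ((hw ()).genSubmodule_eq
    (fun i => mem_genSubmodule_of_mem_iterSpan (hwφ i) ()) (mem_span_of_mem_span hφw ()))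
  exact ⟨⟨fun j => S j (), fun j => hSW j ()⟩, ⟨I.trans K.symm⟩⟩

theorem hasUniqueCanonicalForms (hp : ∀ j, n ≤ p j) : HasUniqueCanonicalForms.{z} lam1 p := by
  intro T hT
  obtain ⟨σ, ⟨I⟩⟩ := exists_canonical_form hT
  exact ⟨σ, ⟨I⟩, fun τ ⟨J⟩ => eq_of_canMod_iso hp (J.symm.trans I)⟩

end CanonicalFamily

end

end Themes

theorem theorem2p2p2 (n : ℕ) (lam1 : ℚ) (hlam1 : (n : ℚ) < lam1) (p : Fin n → ℕ) :
    Themes.IsLocallyVersal.{0, 0, w, z} lam1 p (Themes.canonicalFamily lam1 p) ∧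
    (Themes.HasUniqueCanonicalForms.{z} lam1 p →
      Themes.IsUniversal.{0, 0, w, z} lam1 p (Themes.canonicalFamily lam1 p)) ∧
    ((∀ j, n ≤ p j) → Themes.HasUniqueCanonicalForms.{z} lam1 p ∧
      Themes.IsUniversal.{0, 0, w, z} lam1 p (Themes.canonicalFamily lam1 p)) :=
  ⟨Themes.isLocallyVersal_canonicalFamily hlam1, fun h => h.isUniversal hlam1, fun hp =>
    ⟨Themes.hasUniqueCanonicalForms hp, (Themes.hasUniqueCanonicalForms hp).isUniversal hlam1⟩⟩
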